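/- Fix a countably infinite alphabet of variables. Words are elements of the free semigroup over it (so they are nonempty). A monoid $S$ satisfies an identity $u\approx v$ between words if $u$ and $v$ take the same value in $S$ under every assignment of elements of $S$ to the variables. A word $u$ is an isoterm for $S$ if $S$ satisfies no identity $u\approx v$ with $v\ne u$. $S$ is finitely based if all its identities can be deduced from some finite subset of them (deduction meaning: the fully invariant congruence on the free semigroup generated by that subset), and non-finitely based otherwise. Write $[Xn]=x_1x_2\cdots x_n$, $[nX]=x_n\cdots x_2x_1$, $[XYn]=x_1y_1x_2y_2\cdots x_ny_n$, and similarly for other letters. Write $\mathbf U^t$ (respectively ${}^t\mathbf U$) for the word obtained from $\mathbf U$ by inserting a letter $t$ after (respectively before) each occurrence of each variable. If the letter $t$ is written, or inserted, several times without an index in a word, then its different occurrences denote distinct variables, each occurring once in the word. Different letters, and the same letter with different indices, denote distinct variables. Theorem. Let $W$ and the identities $\mathbf U_n\approx \mathbf V_n$ $(n>1)$ be given by one of the following eight rows. If $S$ is a monoid that satisfies $\mathbf U_n\approx\mathbf V_n$ for each $n>1$, and every word in $W$ is an isoterm for $S$, then $S$ is non-finitely based. 1. $W=\{xyyx\}$;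 $\quad xx[Yn][nY]\approx [Yn][nY]xx$. 2. $W=\{yxxty,\ ytxxy\}$; $\quad [Zn]^t\,yxx[Zn]y\approx [Zn]^t\,xxy[Zn]y$. 3. $W=\{xtxyty\}$; $\quad [ZPn]^t\,x[ZQn]xy[PRn]y\,{}^t[QRn]\approx [ZPn]^t\,x[ZQn]yx[PRn]y\,{}^t[QRn]$ (the letters $t$ inserted on the left-hand side are the same, in the same order, as those on the right-hand side; likewise in row 2). 4. $W=\{xxyy,\ xytytx\}$; $\quad xytyz_1^2z_2^2\cdots z_n^2x\approx yxtyz_1^2z_2^2\cdots z_n^2x$. 5. $W=\{xtyxty,\ xytxy,\ xytyx\}$; $\quad xy[Zn]yxt[nZ]\approx yx[Zn]xyt[nZ]$. 6. $W=\{xtyxty,\ xytxy,\ xytyx\}$; $\quad xy[Zn]xyt[nZ]\approx yx[Zn]yxt[nZ]$. 7. $W=\{xtxyty,\ xyyx\}$; $\quad [Xn][nX][Yn][nY]\approx [Yn][nY][Xn][nX]$. 8. (for any fixed $m>2$) $W=\{xxyy\}\cup\{ytyx^dtx^{m-d},\ x^{m-d}tx^dyty \mid 0<d<m\}$; $\quad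 yt_1x^{m-1}yp_1^2\cdots p_n^2zxt_2z\approx yt_1x^{m}yp_1^2\cdots p_n^2zt_2z$. -/

import Mathlib

namespace NFB

/-- The countably infinite alphabet of variables: seven families of letters indexed by `ℕ`. -/
inductive Var : Type
  | x (i : ℕ)
  | y (i : ℕ)
  | z (i : ℕ)
  | p (i : ℕ)
  | q (i : ℕ)
  | r (i : ℕ)
  | t (i : ℕ)

/-- Words are the elements of the free semigroup over the alphabet (so they are nonempty). -/
abbrev Word : Type := FreeSemigroup Var

/-- The semigroup `S` satisfies the identity `u ≈ v`: the two words take the same value under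
every assignment of elements of `S` to the variables. -/
def Satisfies (S : Type*) [Semigroup S] (u v : Word) : Prop :=
  ∀ φ : Word →ₙ* S, φ u = φ v

/-- The word `u` is an isoterm for `S`: `S` satisfies no nontrivial identity `u ≈ v`. -/
def IsIsoterm (S : Type*) [Semigroup S] (u : Word) : Prop :=
  ∀ v : Word, Satisfies S u v → v = u

/-- Equational deduction from a set `E` of identities: the least fully invariant congruence on
the free semigroup that contains `E`. -/
inductive Deducible (E : Set (Word × Word)) : Word → Word → Prop
  | inst {u v : Word} (h : (u, v) ∈ E) (θ : Word →ₙ* Word) : Deducible E (θ u) (θ v)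
  | refl (u : Word) : Deducible E u u
  | symm {u v : Word} (h : Deducible E u v) : Deducible E v u
  | trans {u v w : Word} (h₁ : Deducible E u v) (h₂ : Deducible E v w) : Deducible E u w
  | mul {u v u' v' : Word} (h : Deducible E u v) (h' : Deducible E u' v') :
      Deducible E (u * u') (v * v')

/-- `S` is finitely based: some finite set of identities of `S` allows one to deduce every
identity of `S`. -/
def FinitelyBased (S : Type*) [Semigroup S] : Prop :=
  ∃ E : Set (Word × Word), E.Finite ∧ (∀ e ∈ E, Satisfies S e.1 e.2) ∧
    ∀ u v : Word, Satisfies S u v → Deducible E u v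

/-- `S` is non-finitely based. -/
def NonFinitelyBased (S : Type*) [Semigroup S] : Prop := ¬ FinitelyBased S

/-- The one-letter words. -/
def xs (i : ℕ) : Word := FreeSemigroup.of (Var.x i)
def ys (i : ℕ) : Word := FreeSemigroup.of (Var.y i)
def zs (i : ℕ) : Word := FreeSemigroup.of (Var.z i)
def ps (i : ℕ) : Word := FreeSemigroup.of (Var.p i)
def qs (i : ℕ) : Word := FreeSemigroup.of (Var.q i)
def rs (i : ℕ) : Word := FreeSemigroup.of (Var.r i)
def ts (i : ℕ) : Word := FreeSemigroup.of (Var.t i)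

/-- The letters written without an index. -/
def x : Word := xs 0
def y : Word := ys 0
def z : Word := zs 0
def t : Word := ts 0

/-- The word `f 1 * f 2 * ⋯ * f n` for `n ≥ 1`. (The value at `n = 0` is irrelevant: a free
semigroup has no empty word.) -/
def up (f : ℕ → Word) : ℕ → Word
  | 0 => f 1
  | 1 => f 1
  | n + 2 => up f (n + 1) * f (n + 2)

/-- The word `f n * ⋯ * f 2 * f 1` for `n ≥ 1`. (The value at `n = 0` is irrelevant.) -/
def down (f : ℕ → Word) : ℕ → Word
  | 0 => f 1
  | 1 => f 1
  | n + 2 => f (n + 2) * down f (n + 1)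

/-- The power `w ^ n` of a word for `n ≥ 1`. (The value at `n = 0` is irrelevant.) -/
def pow (w : Word) (n : ℕ) : Word := up (fun _ => w) n

/-- A row of the table: a set `W` of words and a family of identities `U n ≈ V n` (`n > 1`). -/
structure Row where
  W : Set Word
  U : ℕ → Word
  V : ℕ → Word

def row1 : Row where
  W := {x * y * y * x}
  U n := x * x * up ys n * down ys n
  V n := up ys n * down ys n * x * x

def row2 : Row where
  W := {y * x * x * t * y, y * t * x * x * y}
  U n := up (fun i => zs i * ts i) n * y * x * x * up zs n * y
  V n := up (fun i => zs i * ts i) n * x * x * y * up zs n * y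

/-- `z₁ t p₁ t z₂ t p₂ t ⋯ zₙ t pₙ t`, where different occurrences of `t` stand for different
letters (also different from those in `tQR`). -/
def ZPt (n : ℕ) : Word := up (fun i => zs i * ts (4 * i) * ps i * ts (4 * i + 1)) n

/-- `t q₁ t r₁ t q₂ t r₂ ⋯ t qₙ t rₙ`, where different occurrences of `t` stand for different
letters (also different from those in `ZPt`). -/
def tQR (n : ℕ) : Word := up (fun i => ts (4 * i + 2) * qs i * ts (4 * i + 3) * rs i) n

def row3 : Row where
  W := {x * ts 1 * x * y * ts 2 * y}
  U n := ZPt n * x * up (fun i => zs i * qs i) n * x * y * up (fun i => ps i * rs i) n * y * tQR n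
  V n := ZPt n * x * up (fun i => zs i * qs i) n * y * x * up (fun i => ps i * rs i) n * y * tQR n

def row4 : Row where
  W := {x * x * y * y, x * y * ts 1 * y * ts 2 * x}
  U n := x * y * t * y * up (fun i => zs i * zs i) n * x
  V n := y * x * t * y * up (fun i => zs i * zs i) n * x

def row5 : Row where
  W := {x * ts 1 * y * x * ts 2 * y, x * y * t * x * y, x * y * t * y * x}
  U n := x * y * up zs n * y * x * t * down zs n
  V n := y * x * up zs n * x * y * t * down zs n

def row6 : Row where
  W := {x * ts 1 * y * x * ts 2 * y, x * y * t * x * y, x * y * t * y * x}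
  U n := x * y * up zs n * x * y * t * down zs n
  V n := y * x * up zs n * y * x * t * down zs n

def row7 : Row where
  W := {x * ts 1 * x * y * ts 2 * y, x * y * y * x}
  U n := up xs n * down xs n * up ys n * down ys n
  V n := up ys n * down ys n * up xs n * down xs n

/-- The eighth row depends on a parameter `m > 2`. -/
def row8 (m : ℕ) : Row where
  W := {x * x * y * y} ∪
    {w | ∃ d : ℕ, 0 < d ∧ d < m ∧
      (w = y * ts 1 * y * pow x d * ts 2 * pow x (m - d) ∨
       w = pow x (m - d) * ts 1 * pow x d * y * ts 2 * y)}
  U n := y * ts 1 * pow x (m - 1) * y * up (fun i => ps i * ps i) n * z * x * ts 2 * z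
  V n := y * ts 1 * pow x m * y * up (fun i => ps i * ps i) n * z * ts 2 * z

/-- The table: seven single rows, and the eighth row for every `m > 2`. -/
def table : Set Row :=
  {row1, row2, row3, row4, row5, row6, row7} ∪ {R | ∃ m : ℕ, 2 < m ∧ R = row8 m}

end NFB

namespace NFB

set_option linter.unusedSimpArgs false

/-! Suppose finitely many identities of `S` formed a basis, and let `L` bound the lengths of their
sides. Then `U n` is turned into `V n` by steps `a θ(u) b → a θ(v) b` with `u ≈ v` in the basis or
its reverse; treating `a` and `b` as values of two extra letters, each step replaces `θ(u)` by
`θ(v)` with `|u| ≤ L + 2`. It is enough to find, for some large `n`, a property that holds for `U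
n`, fails for `V n` and survives every such step between words equal to `U n` in `S`
(`nonFinitelyBased_of_invariant`).

Isoterms control a step: if deleting letters from `w` leaves an isoterm, deleting the same letters
from any `w'` with `w ≈ w'` leaves the same word (`Iso.has`). By themselves they cannot protect the
property, since `S` does satisfy `U n ≈ V n`. The isoterms that would protect it contain a linear
letter (one that occurs once) in a place where `U n` has only repeated ones.

Such a letter is gained from the shortness of `u` (`Step.exists_mark`). If `n` is large, two
consecutive positions in a long stretch of `w` fall into the image `θ(d)` of a single letter `d`.
When some pair of letters at a certain distance inside that image appears nowhere else in `w`, `d`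
is linear in `u`. One letter inside `θ(d)` can then be renamed to a fresh letter, and the same
identity `u ≈ v` relates the two marked words. The fresh letter is linear in both, so the isoterms
with a linear letter apply to the marked words, while all other letters keep their places.

Each row then needs an invariant about the order of occurrences, some order relations that `W`
already enforces without marking, and one or two markings. Words are handled as lists, the pattern
"what remains after deletion" is expressed by counts and inequalities between positions (`has_iff`),
and the final deductions are linear arithmetic. -/

noncomputable instance : DecidableEq Var := Classical.decEq _

/-! ### Positions of occurrences, marking an occurrence, and patterns left by deletion -/

section Occ

variable {α : Type*} [DecidableEq α]

/-- The position in `w` of the occurrence number `k` (counted from `0`) of the letter `a`. -/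
def occ : List α → α → ℕ → ℕ
  -- When there are too few occurrences, the value comes out as the length of the list; several
  -- lemmas below therefore need no bound on the index.
  | [], _, _ => 0
  | b :: w, a, k =>
    if b = a then (match k with
      | 0 => 0
      | k + 1 => occ w a k + 1)
    else occ w a k + 1

theorem occ_cons_self_zero (a : α) (w : List α) : occ (a :: w) a 0 = 0 := by simp [occ]

theorem occ_cons_self_succ (a : α) (w : List α) (k : ℕ) :
    occ (a :: w) a (k + 1) = occ w a k + 1 := by simp [occ]

theorem occ_cons_ne {a b : α} (h : b ≠ a) (w : List α) (k : ℕ) :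
    occ (b :: w) a k = occ w a k + 1 := by simp [occ, h]

theorem getElem?_occ {w : List α} {a : α} {k : ℕ} (hk : k < w.count a) :
    w[occ w a k]? = some a := by
  induction w generalizing k with
  | nil => simp at hk
  | cons b w ih =>
    by_cases h : b = a
    · subst h
      cases k with
      | zero => simp [occ]
      | succ k =>
        rw [occ_cons_self_succ, List.getElem?_cons_succ]
        exact ih (by simpa using hk)
    · rw [occ_cons_ne h, List.getElem?_cons_succ]
      exact ih (by simpa [List.count_cons, h] using hk)

theorem occ_lt_length {w : List α} {a : α} {k : ℕ} (hk : k < w.count a) :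
    occ w a k < w.length :=
  (List.getElem?_eq_some_iff.1 (getElem?_occ hk)).1

theorem exists_occ {w : List α} {a : α} {p : ℕ} (h : w[p]? = some a) :
    ∃ k < w.count a, occ w a k = p := by
  induction w generalizing p with
  | nil => simp at h
  | cons b w ih =>
    cases p with
    | zero =>
      obtain rfl : b = a := by simpa using h
      exact ⟨0, by simp, occ_cons_self_zero _ _⟩
    | succ p =>
      obtain ⟨k, hk, e⟩ := ih (by simpa using h)
      by_cases hb : b = a
      · subst hb
        exact ⟨k + 1, by simpa using hk, by rw [occ_cons_self_succ, e]⟩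
      · exact ⟨k, by simpa [List.count_cons, hb] using hk, by rw [occ_cons_ne hb, e]⟩

/-- Only the smaller index has to be in range, because a missing occurrence is placed at the end of
the word. -/
theorem occ_lt_occ {w : List α} {a : α} {i j : ℕ} (hij : i < j) (hj : i < w.count a) :
    occ w a i < occ w a j := by
  induction w generalizing i j with
  | nil => simp at hj
  | cons b w ih =>
    by_cases h : b = a
    · subst h
      obtain ⟨j, rfl⟩ : ∃ j', j = j' + 1 := ⟨j - 1, by omega⟩
      cases i with
      | zero => simp [occ]
      | succ i =>
        rw [occ_cons_self_succ, occ_cons_self_succ]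
        exact Nat.succ_lt_succ (ih (by omega) (by simpa using hj))
    · rw [occ_cons_ne h, occ_cons_ne h]
      exact Nat.succ_lt_succ (ih hij (by simpa [List.count_cons, h] using hj))

theorem occ_ne {w : List α} {a b : α} {i j : ℕ} (hab : a ≠ b) (hi : i < w.count a)
    (hj : j < w.count b) : occ w a i ≠ occ w b j := by
  intro e
  have h₁ := getElem?_occ hi
  rw [e, getElem?_occ hj] at h₁
  exact hab (by simpa using h₁.symm)

theorem occ_append (l r : List α) (a : α) (k : ℕ) :
    occ (l ++ r) a k =
      if k < l.count a then occ l a k else l.length + occ r a (k - l.count a) := by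
  induction l generalizing k with
  | nil => simp
  | cons b l ih =>
    by_cases h : b = a
    · subst h
      cases k with
      | zero => simp [occ]
      | succ k =>
        rw [List.cons_append, occ_cons_self_succ, occ_cons_self_succ, ih]
        simp only [List.count_cons_self, Nat.add_lt_add_iff_right, List.length_cons,
          Nat.add_sub_add_right]
        split_ifs <;> omega
    · rw [List.cons_append, occ_cons_ne h, occ_cons_ne h, ih]
      simp only [List.count_cons_of_ne h, List.length_cons]
      split_ifs <;> omega

theorem occ_filter_lt {w : List α} {q : α → Bool} {a b : α} {i j : ℕ} (ha : q a) (hb : q b)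
    (hi : i < w.count a) (hj : j < w.count b) :
    occ (w.filter q) a i < occ (w.filter q) b j ↔ occ w a i < occ w b j := by
  induction w generalizing i j with
  | nil => simp at hi
  | cons c w ih =>
    by_cases hc : q c
    · rw [List.filter_cons_of_pos hc]
      by_cases hca : c = a
      · subst hca
        by_cases hcb : c = b
        · subst hcb
          cases i with
          | zero => cases j <;> simp [occ]
          | succ i =>
            cases j with
            | zero => simp [occ]
            | succ j =>
              simp only [occ_cons_self_succ, Nat.add_lt_add_iff_right]
              exact ih (by simpa using hi) (by simpa using hj)
        · cases i with
          | zero => simp [occ, hcb]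
          | succ i =>
            simp only [occ_cons_self_succ, occ_cons_ne hcb, Nat.add_lt_add_iff_right]
            exact ih (by simpa using hi) (by simpa [List.count_cons, hcb] using hj)
      · by_cases hcb : c = b
        · subst hcb
          cases j with
          | zero => simp [occ]
          | succ j =>
            simp only [occ_cons_self_succ, occ_cons_ne hca, Nat.add_lt_add_iff_right]
            exact ih (by simpa [List.count_cons, hca] using hi) (by simpa using hj)
        · simp only [occ_cons_ne hca, occ_cons_ne hcb, Nat.add_lt_add_iff_right]
          exact ih (by simpa [List.count_cons, hca] using hi)
            (by simpa [List.count_cons, hcb] using hj)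
    · have hca : c ≠ a := by rintro rfl; exact hc ha
      have hcb : c ≠ b := by rintro rfl; exact hc hb
      rw [List.filter_cons_of_neg hc, occ_cons_ne hca, occ_cons_ne hcb,
        Nat.add_lt_add_iff_right]
      exact ih (by simpa [List.count_cons, hca] using hi)
        (by simpa [List.count_cons, hcb] using hj)

/-- Replace the occurrence number `k` of `a` in `w` by the letter `c`. -/
def mark (w : List α) (a : α) (k : ℕ) (c : α) : List α := w.set (occ w a k) c

theorem mark_cons_self_zero (a : α) (w : List α) (c : α) :
    mark (a :: w) a 0 c = c :: w := by simp [mark, occ]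

theorem mark_cons_self_succ (a : α) (w : List α) (k : ℕ) (c : α) :
    mark (a :: w) a (k + 1) c = a :: mark w a k c := by simp [mark, occ]

theorem mark_cons_ne {a b : α} (h : b ≠ a) (w : List α) (k : ℕ) (c : α) :
    mark (b :: w) a k c = b :: mark w a k c := by simp [mark, occ, h]

variable {w : List α} {a b c : α} {k : ℕ}

/-- No bound on `k` is required: for a missing occurrence the position is the length of `w`, where
`List.set` changes nothing. -/
theorem count_mark_of_ne (hba : b ≠ a) (hbc : b ≠ c) :
    (mark w a k c).count b = w.count b := by
  induction w generalizing k with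
  | nil => simp [mark]
  | cons d w ih =>
    by_cases h : d = a
    · subst h
      cases k with
      | zero => simp [mark_cons_self_zero, hba.symm, hbc.symm]
      | succ k => simp [mark_cons_self_succ, List.count_cons, ih]
    · simp [mark_cons_ne h, List.count_cons, ih]

theorem occ_mark_of_ne (hba : b ≠ a) (hbc : b ≠ c) (j : ℕ) :
    occ (mark w a k c) b j = occ w b j := by
  induction w generalizing k j with
  | nil => simp [mark]
  | cons d w ih =>
    by_cases h : d = a
    · subst h
      cases k with
      | zero => rw [mark_cons_self_zero, occ_cons_ne hbc.symm, occ_cons_ne hba.symm]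
      | succ k => rw [mark_cons_self_succ, occ_cons_ne hba.symm, occ_cons_ne hba.symm, ih]
    · rw [mark_cons_ne h]
      by_cases hd : d = b
      · subst hd
        cases j with
        | zero => simp [occ]
        | succ j => rw [occ_cons_self_succ, occ_cons_self_succ, ih]
      · rw [occ_cons_ne hd, occ_cons_ne hd, ih]

theorem count_mark_new (hc : c ∉ w) (hk : k < w.count a) : (mark w a k c).count c = 1 := by
  induction w generalizing k with
  | nil => simp at hk
  | cons d w ih =>
    have hd : d ≠ c := by rintro rfl; simp at hc
    have hw : c ∉ w := fun h => hc (by simp [h])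
    by_cases h : d = a
    · subst h
      cases k with
      | zero => simp [mark_cons_self_zero, List.count_eq_zero.2 hw]
      | succ k =>
        rw [mark_cons_self_succ, List.count_cons_of_ne hd]
        exact ih hw (by simpa using hk)
    · rw [mark_cons_ne h, List.count_cons_of_ne hd]
      exact ih hw (by simpa [List.count_cons, h] using hk)

theorem occ_mark_new (hc : c ∉ w) (hk : k < w.count a) :
    occ (mark w a k c) c 0 = occ w a k := by
  induction w generalizing k with
  | nil => simp at hk
  | cons d w ih =>
    have hd : d ≠ c := by rintro rfl; simp at hc
    have hw : c ∉ w := fun h => hc (by simp [h])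
    by_cases h : d = a
    · subst h
      cases k with
      | zero => simp [mark_cons_self_zero, occ]
      | succ k =>
        rw [mark_cons_self_succ, occ_cons_ne hd, occ_cons_self_succ]
        rw [ih hw (by simpa using hk)]
    · rw [mark_cons_ne h, occ_cons_ne hd, occ_cons_ne h]
      rw [ih hw (by simpa [List.count_cons, h] using hk)]

theorem count_mark_old (hca : c ≠ a) (hk : k < w.count a) :
    (mark w a k c).count a + 1 = w.count a := by
  induction w generalizing k with
  | nil => simp at hk
  | cons d w ih =>
    by_cases h : d = a
    · subst h
      cases k with
      | zero => simp [mark_cons_self_zero, hca]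
      | succ k =>
        rw [mark_cons_self_succ, List.count_cons_self, List.count_cons_self]
        rw [ih (by simpa using hk)]
    · rw [mark_cons_ne h, List.count_cons_of_ne h, List.count_cons_of_ne h]
      exact ih (by simpa [List.count_cons, h] using hk)

theorem occ_mark_old (hca : c ≠ a) (hk : k < w.count a) (j : ℕ) :
    occ (mark w a k c) a j = if j < k then occ w a j else occ w a (j + 1) := by
  induction w generalizing k j with
  | nil => simp at hk
  | cons d w ih =>
    by_cases h : d = a
    · subst h
      cases k with
      | zero => rw [mark_cons_self_zero, occ_cons_ne hca]; simp [occ]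
      | succ k =>
        rw [mark_cons_self_succ]
        cases j with
        | zero => simp [occ]
        | succ j =>
          simp only [occ_cons_self_succ]
          rw [ih (by simpa using hk)]
          simp only [Nat.add_lt_add_iff_right]
          split_ifs <;> rfl
    · rw [mark_cons_ne h, occ_cons_ne h, occ_cons_ne h, occ_cons_ne h]
      rw [ih (by simpa [List.count_cons, h] using hk)]
      split_ifs <;> rfl

theorem not_mem_mark {b : α} (hb : b ∉ w) (hbc : b ≠ c) : b ∉ mark w a k c := by
  intro h
  rcases List.mem_or_eq_of_mem_set h with h | h
  · exact hb h
  · exact hbc h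

/-- A word with exactly one occurrence of `c` is obtained by marking an occurrence of `a` in the
word in which `c` is renamed to `a`. -/
theorem exists_eq_mark {v : List α} (hv : v.count c = 1) :
    ∃ k < (v.map fun e => if e = c then a else e).count a,
      v = mark (v.map fun e => if e = c then a else e) a k c := by
  induction v with
  | nil => simp at hv
  | cons d v ih =>
    by_cases hd : d = c
    · subst hd
      have h0 : d ∉ v := by
        rw [List.count_cons_self] at hv
        exact List.count_eq_zero.1 (by omega)
      have hm : (v.map fun e => if e = d then a else e) = v := by
        rw [List.map_congr_left (g := id), List.map_id]
        intro e he
        have : e ≠ d := by rintro rfl; exact h0 he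
        simp [this]
      exact ⟨0, by simp, by simp only [List.map_cons, if_true, mark_cons_self_zero, hm]⟩
    · obtain ⟨k, hk, e⟩ := ih (by rwa [List.count_cons_of_ne hd] at hv)
      simp only [List.map_cons, if_neg hd]
      by_cases hda : d = a
      · subst hda
        exact ⟨k + 1, by simpa using hk, by rw [mark_cons_self_succ, ← e]⟩
      · exact ⟨k, by simpa [List.count_cons, hda] using hk, by rw [mark_cons_ne hda, ← e]⟩

/-- `Inc w s p`: the occurrences in `w` of the letters of `p`, each numbered from its count in
`s`, come in the order of `p`. -/
def Inc (w : List α) : List α → List α → Prop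
  | _, [] => True
  | _, [_] => True
  | s, a :: b :: p =>
    occ w a (s.count a) < occ w b ((a :: s).count b) ∧ Inc w (a :: s) (b :: p)

/-- The word `p` is what remains of `w` when the letters outside `p` are deleted. -/
def Has (w p : List α) : Prop := w.filter (· ∈ p) = p

theorem occ_reverse_append_cons (s r : List α) (a : α) :
    occ (s.reverse ++ a :: r) a (s.count a) = s.length := by
  rw [occ_append]; simp [occ]

/-- The part of `p` already read is kept reversed in `s`. Hence the next letter stands at position
`s.length` of `p`, and its number there is its count in `s`; `occ_filter_lt` carries the order in
`p` back to `w`. -/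
theorem inc_of_filter {p : List α} (h : Has w p) :
    ∀ s r : List α, s.reverse ++ r = p → Inc w s r
  | _, [], _ => trivial
  | _, [_], _ => trivial
  | s, a :: b :: r, e => by
    have hq : ∀ d ∈ p, p.count d = w.count d := by
      intro d hd
      conv_lhs => rw [← h]
      rw [List.count_filter (by simpa using hd)]
    have e' : (a :: s).reverse ++ b :: r = p := by simpa using e
    refine ⟨?_, inc_of_filter h (a :: s) (b :: r) e'⟩
    have ha : a ∈ p := by rw [← e]; simp
    have hb : b ∈ p := by rw [← e]; simp
    rw [← occ_filter_lt (w := w) (q := fun d => decide (d ∈ p)) (by simpa using ha)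
      (by simpa using hb)]
    · rw [show w.filter (fun d => decide (d ∈ p)) = p from h]
      have h₁ := occ_reverse_append_cons s (b :: r) a
      have h₂ := occ_reverse_append_cons (a :: s) r b
      rw [e] at h₁
      rw [e'] at h₂
      rw [h₁, h₂]; simp
    · rw [← hq a ha, ← e]; simp
    · rw [← hq b hb, ← e', List.count_append, List.count_reverse, List.count_cons_self (l := r)]
      omega

/-- Greedy embedding: the first letter of `p` is matched with its numbered occurrence, and `Inc`
puts the next one strictly later, so the induction continues in the suffix behind the match. The
bound `n` records where that suffix starts. -/
theorem sublist_drop_of_inc : ∀ (s p : List α) (n : ℕ),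
    (∀ d ∈ p, s.count d + p.count d ≤ w.count d) → Inc w s p →
    (∀ d r, p = d :: r → n ≤ occ w d (s.count d)) → p.Sublist (w.drop n)
  | _, [], _, _, _, _ => List.nil_sublist _
  | s, a :: p, n, hc, hi, hn => by
    have h₀ := hc a (by simp)
    rw [List.count_cons_self] at h₀
    have hk : s.count a < w.count a := by omega
    have h₁ := hn a p rfl
    have hl := occ_lt_length hk
    have key : p.Sublist (w.drop (occ w a (s.count a) + 1)) := by
      refine sublist_drop_of_inc (a :: s) p _ ?_ ?_ ?_
      · intro d hd
        have := hc d (by simp [hd])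
        simp only [List.count_cons] at this ⊢
        omega
      · cases p with
        | nil => trivial
        | cons b p => exact hi.2
      · rintro d r rfl
        exact hi.1
    have hg : w[occ w a (s.count a)] = a := by
      have := getElem?_occ hk
      rw [List.getElem?_eq_getElem hl] at this
      simpa using this
    have h₂ : w.drop (occ w a (s.count a)) = a :: w.drop (occ w a (s.count a) + 1) := by
      rw [List.drop_eq_getElem_cons hl, hg]
    have h₃ : (a :: p).Sublist (w.drop (occ w a (s.count a))) := by
      rw [h₂]; exact key.cons_cons a
    refine h₃.trans ?_
    obtain ⟨m, hm⟩ := Nat.exists_eq_add_of_le h₁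
    rw [hm, ← List.drop_drop]
    exact List.drop_sublist _ _

/-- This turns a pattern into arithmetic: all later uses of isoterms go through counts and
inequalities between positions. -/
theorem has_iff {p : List α} :
    Has w p ↔ (∀ d ∈ p, w.count d = p.count d) ∧ Inc w [] p := by
  constructor
  · intro h
    refine ⟨fun d hd => ?_, inc_of_filter h [] p (by simp)⟩
    conv_rhs => rw [← h]
    rw [List.count_filter (by simpa using hd)]
  -- The word `p` embeds in `w`, hence in the filtered word; equal counts give equal lengths, so the
  -- embedding is an equality.
  · rintro ⟨hc, hi⟩
    have hs : p.Sublist w := by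
      simpa using sublist_drop_of_inc (w := w) [] p 0 (fun d hd => by simp [hc d hd]) hi
        (by simp)
    have hs' : p.Sublist (w.filter (· ∈ p)) := by
      have := hs.filter (· ∈ p)
      rwa [List.filter_eq_self.2 (by simp)] at this
    refine (hs'.eq_of_length ?_).symm
    refine (List.perm_iff_count.2 fun d => ?_).length_eq
    by_cases hd : d ∈ p
    · rw [List.count_filter (by simpa using hd), hc d hd]
    · rw [List.count_eq_zero.2 hd, eq_comm, List.count_eq_zero]
      simp [hd]

end Occ

/-! ### Identities of a monoid and isoterms -/

section Sat

variable {S : Type*} [Monoid S] {α β : Type*}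

/-- The monoid `S` satisfies the identity `u ≈ v`, where `u` and `v` may be empty. -/
def Sat (S : Type*) [Monoid S] {α : Type*} (u v : List α) : Prop :=
  ∀ φ : α → S, (u.map φ).prod = (v.map φ).prod

theorem Sat.symm {u v : List α} (h : Sat S u v) : Sat S v u := fun φ => (h φ).symm

theorem Sat.trans {u v w : List α} (h : Sat S u v) (h' : Sat S v w) : Sat S u w :=
  fun φ => (h φ).trans (h' φ)

theorem Sat.append {u v u' v' : List α} (h : Sat S u v) (h' : Sat S u' v') :
    Sat S (u ++ u') (v ++ v') := fun φ => by
  rw [List.map_append, List.map_append, List.prod_append, List.prod_append, h φ, h' φ]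

theorem Sat.refl (u : List α) : Sat S u u := fun _ => rfl

theorem map_flatMap_prod (θ : α → List β) (φ : β → S) (u : List α) :
    ((u.flatMap θ).map φ).prod = (u.map fun a => ((θ a).map φ).prod).prod := by
  induction u with
  | nil => simp
  | cons a u ih => simp [ih]

theorem Sat.flatMap {u v : List α} (h : Sat S u v) (θ : α → List β) :
    Sat S (u.flatMap θ) (v.flatMap θ) := fun φ => by
  rw [map_flatMap_prod, map_flatMap_prod]; exact h _

theorem flatMap_ite_singleton (q : α → Bool) (u : List α) :
    (u.flatMap fun a => if q a then [a] else []) = u.filter q := by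
  induction u with
  | nil => rfl
  | cons a u ih => by_cases h : q a <;> simp [h, ih]

/-- Deleting letters is the substitution of the empty word for them; it is here that the unit of `S`
matters. -/
theorem Sat.filter {u v : List α} (h : Sat S u v) (q : α → Bool) :
    Sat S (u.filter q) (v.filter q) := by
  have := h.flatMap fun a => if q a then [a] else []
  rwa [flatMap_ite_singleton, flatMap_ite_singleton] at this

/-- Isoterms among the words that may be empty. -/
def Iso (S : Type*) [Monoid S] {α : Type*} (p : List α) : Prop := ∀ v : List α, Sat S p v → v = p

variable [DecidableEq α]

/-- The main use of isoterms: a pattern passes from one side of an identity of `S` to the other. -/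
theorem Iso.has {p w w' : List α} (hp : Iso S p) (h : Sat S w w') (hw : Has w p) : Has w' p := by
  have := h.filter (· ∈ p)
  rw [show w.filter (· ∈ p) = p from hw] at this
  exact hp _ this

omit [DecidableEq α] in
-- Nonempty images with distinct first letters can be decoded from left to right.
theorem flatMap_injOn {θ : α → List β} {l : List α} (h0 : ∀ a ∈ l, θ a ≠ [])
    (h1 : ∀ a ∈ l, ∀ b ∈ l, (θ a).head? = (θ b).head? → a = b) :
    ∀ u v : List α, u ⊆ l → v ⊆ l → u.flatMap θ = v.flatMap θ → u = v
  | [], [], _, _, _ => rfl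
  | [], b :: v, _, hv, e => by
    exact absurd (by simpa using e.symm : θ b = [] ∧ _).1 (h0 b (hv (by simp)))
  | a :: u, [], hu, _, e => by
    exact absurd (by simpa using e : θ a = [] ∧ _).1 (h0 a (hu (by simp)))
  | a :: u, b :: v, hu, hv, e => by
    have ha := h0 a (hu (by simp))
    have hb := h0 b (hv (by simp))
    have hab : a = b := by
      refine h1 a (hu (by simp)) b (hv (by simp)) ?_
      have := congrArg List.head? e
      rw [List.flatMap_cons, List.flatMap_cons, List.head?_append_of_ne_nil _ ha,
        List.head?_append_of_ne_nil _ hb] at this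
      exact this
    subst hab
    rw [flatMap_injOn h0 h1 u v (fun x hx => hu (by simp [hx])) (fun x hx => hv (by simp [hx]))
      (by simpa using e)]

/-- A word `v` with `p ≈ v` can differ from `p` only by letters outside `p`. If `c` is one,
substitute `p` for it: `p` is unchanged, while `v` gains at least one more occurrence of the first
letter of `p`, although the hypothesis prescribes its number both before and after. -/
theorem Iso.of_has {p : List α} (hp0 : p ≠ []) (hp : ∀ w : List α, Sat S p w → Has w p) :
    Iso S p := by
  intro v hv
  by_contra hne
  have hex : ∃ c ∈ v, c ∉ p := by
    by_contra hcon
    push Not at hcon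
    refine hne ?_
    have := hp v hv
    unfold Has at this
    rwa [List.filter_eq_self.2 (by simpa using hcon)] at this
  obtain ⟨c, hcv, hcp⟩ := hex
  have h := hp _ (hv.flatMap (fun a => if a = c then p else [a]) |> fun h => by
    have e : (p.flatMap fun a => if a = c then p else [a]) = p := by
      conv_rhs => rw [← List.flatMap_singleton' p]
      refine List.flatMap_congr fun a ha => ?_
      rw [if_neg (by rintro rfl; exact hcp ha)]
    rw [e] at h; exact h)
  have h' := hp v hv
  obtain ⟨l, r, rfl⟩ := List.append_of_mem hcv
  obtain ⟨d, p', rfl⟩ := List.exists_cons_of_ne_nil hp0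
  rw [has_iff] at h h'
  have h₁ := h.1 d (by simp)
  have h₂ := h'.1 d (by simp)
  have hd : c ≠ d := by rintro rfl; simp at hcp
  have hmono : ∀ u : List α, u.count d ≤
      (u.flatMap fun a => if a = c then d :: p' else [a]).count d := by
    intro u
    induction u with
    | nil => simp
    | cons a u ih =>
      by_cases hac : a = c
      · subst hac
        rw [List.flatMap_cons, List.count_append, List.count_cons_of_ne hd]
        omega
      · rw [List.flatMap_cons, List.count_append, if_neg hac]
        simp only [List.count_cons, List.count_nil]
        omega
  have hl := hmono l
  have hr := hmono r
  simp only [List.flatMap_append, List.flatMap_cons, List.count_append, if_true,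
    List.count_cons_self, List.count_cons_of_ne hd] at h₁ h₂
  omega

/-- A word whose image under a prefix substitution is a factor of an isoterm is an isoterm. -/
theorem Iso.of_subst {q : List β} (hq : Iso S q) {p : List α} (θ : α → List β) (l r : List β)
    (hp0 : p ≠ []) (e : q = l ++ p.flatMap θ ++ r) (h0 : ∀ a ∈ p, θ a ≠ [])
    (h1 : ∀ a ∈ p, ∀ b ∈ p, (θ a).head? = (θ b).head? → a = b) : Iso S p := by
  refine Iso.of_has hp0 fun w hw => ?_
  have h := hw.filter (· ∈ p)
  rw [List.filter_eq_self.2 (by simp)] at h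
  -- Only the part of `w` over the letters of `p` is substituted, since `θ` is controlled on these
  -- letters alone; in the context `l`, `r` it must give back `q`.
  have h' := ((Sat.refl l).append (h.flatMap θ)).append (Sat.refl r)
  rw [← e] at h'
  have h'' := hq _ h'
  rw [e, List.append_cancel_right_eq, List.append_cancel_left_eq] at h''
  refine flatMap_injOn h0 h1 _ _ ?_ (fun _ h => h) h''
  intro a ha
  simpa using (List.mem_filter.1 ha).2

/-- A letter `c` on one side only would, after deletion of all others, give `[] ≈ c ⋯ c`; multiplied
by `c` this is a nontrivial identity for the isoterm `[c]`. -/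
theorem mem_of_sat (h1 : ∀ c : α, Iso S [c]) {u v : List α} (h : Sat S u v) {c : α}
    (hc : c ∈ v) : c ∈ u := by
  by_contra hcu
  have h' := h.filter (· = c)
  rw [List.filter_eq_nil_iff.2 (by intro a ha; simp; rintro rfl; exact hcu ha)] at h'
  have h₂ := h1 c _ ((Sat.refl [c]).append h')
  have h₃ : c ∈ v.filter (· = c) := by simpa using hc
  have h₄ : v.filter (· = c) = [] := by simpa using h₂
  rw [h₄] at h₃
  simp at h₃

theorem has_singleton {w : List α} {c : α} : Has w [c] ↔ w.count c = 1 := by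
  rw [has_iff]; simp [Inc]

/-! ### Single deduction steps and the marking lemma -/

/-- `w'` is the image of a word `v` under a substitution that takes a word `u` of length at most
`L` to `w`, and `u ≈ v` holds in `S`. -/
def Step (S : Type*) [Monoid S] (L : ℕ) {α : Type*} (w w' : List α) : Prop :=
  ∃ (β : Type) (u v : List β) (θ : β → List α),
    u.length ≤ L ∧ Sat S u v ∧ w = u.flatMap θ ∧ w' = v.flatMap θ

omit [DecidableEq α] in
theorem Step.sat {L : ℕ} {w w' : List α} (h : Step S L w w') : Sat S w w' := by
  obtain ⟨β, u, v, θ, -, h, rfl, rfl⟩ := h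
  exact h.flatMap θ

omit [DecidableEq α] in
-- Pigeonhole for `n + 1` increasing positions in at most `n` blocks. If `p 1` lies in the first
-- block, so does `p 0`. Otherwise the first block and `p 0` are dropped and the remaining positions
-- are shifted by the length of that block.
theorem exists_block {β : Type*} (θ : β → List α) : ∀ (u : List β) (p : ℕ → ℕ) (n : ℕ),
    u.length ≤ n → (∀ i < n, p i < p (i + 1)) → p n < (u.flatMap θ).length →
    ∃ i < n, ∃ u₁ d u₂, u = u₁ ++ d :: u₂ ∧ (u₁.flatMap θ).length ≤ p i ∧
      p (i + 1) < (u₁.flatMap θ).length + (θ d).length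
  | [], _, _, _, _, h => by simp at h
  | d :: u, p, n, hn, hp, h => by
    obtain ⟨n, rfl⟩ : ∃ m, n = m + 1 := ⟨n - 1, by simp at hn; omega⟩
    by_cases h₁ : p 1 < (θ d).length
    · exact ⟨0, by omega, [], d, u, rfl, by simp, by simpa using h₁⟩
    · have hmono : ∀ i ≤ n, p 1 ≤ p (i + 1) := by
        intro i
        induction i with
        | zero => simp
        | succ i ih =>
          intro hi
          have h₂ := ih (by omega)
          have h₃ := hp (i + 1) (by omega)
          omega
      obtain ⟨i, hi, u₁, e, u₂, rfl, h₂, h₃⟩ :=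
        exists_block θ u (fun i => p (i + 1) - (θ d).length) n (by simpa using hn)
          (fun i hi => by
            have h₂ := hmono i (by omega)
            have h₃ := hp (i + 1) (by omega)
            omega)
          (by
            have h₂ := hmono n le_rfl
            simp only [List.flatMap_cons, List.length_append] at h
            omega)
      refine ⟨i + 1, by omega, d :: u₁, e, u₂, rfl, ?_, ?_⟩
      · have h₄ := hmono i (by omega)
        simp only [List.flatMap_cons, List.length_append]
        omega
      · have h₄ := hmono (i + 1) (by omega)
        simp only [List.flatMap_cons, List.length_append]
        omega

omit [DecidableEq α] in
theorem map_flatMap_update {β : Type*} [DecidableEq β] (π : α → α) (θ : β → List α) (d : β)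
    (s : List α) (hs : s.map π = θ d) (u : List β)
    (hu : ∀ e ∈ u, e ≠ d → (θ e).map π = θ e) :
    (u.flatMap (Function.update θ d s)).map π = u.flatMap θ := by
  rw [List.map_flatMap]
  refine List.flatMap_congr fun e he => ?_
  by_cases hed : e = d
  · subst hed; simpa using hs
  · rw [Function.update_of_ne hed, hu e he hed]

omit [DecidableEq α] in
theorem flatMap_update_of_notMem {β : Type*} [DecidableEq β] (θ : β → List α) (d : β)
    (s : List α) (u : List β) (hu : d ∉ u) :
    u.flatMap (Function.update θ d s) = u.flatMap θ := by
  refine List.flatMap_congr fun e he => ?_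
  rw [Function.update_of_ne (by rintro rfl; exact hu he)]

omit [DecidableEq α] in
theorem Iso.single {β : Type*} [DecidableEq β] {c : α} (h : Iso S [c]) (d : β) : Iso S [d] :=
  h.of_subst (fun _ => [c]) [] [] (by simp) (by simp) (by simp) (by simp)

/-- Among `L + 1` positions in `w` given by `p`, two consecutive ones delimit a part of `w` in
which occurrences of letters can be replaced by a new linear letter. -/
theorem Step.exists_mark {c₀ : α} (h1 : Iso S [c₀]) {L : ℕ} {w w' : List α} (hs : Step S L w w')
    (p : ℕ → ℕ) (hp : ∀ i < L, p i < p (i + 1)) (hL : p L < w.length) :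
    ∃ i < L, ∀ (a b c : α) (k j : ℕ), c ∉ w → c ≠ a → k < w.count a → j < w.count b →
      p i ≤ occ w a k → occ w a k < occ w b j → occ w b j ≤ p (i + 1) →
      (∀ k' < w.count a, ∀ j' < w.count b,
        occ w b j' + occ w a k = occ w b j + occ w a k' → k' = k) →
      ∃ k' < w'.count a, c ∉ w' ∧ Step S L (mark w a k c) (mark w' a k' c) := by
  classical
  obtain ⟨β, u, v, θ, hu, h, rfl, rfl⟩ := hs
  obtain ⟨i, hi, u₁, d, u₂, rfl, hi₁, hi₂⟩ := exists_block θ u p L hu hp hL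
  refine ⟨i, hi, fun a b c k j hcw hca hk hj hpk hkj hjp huniq => ?_⟩
  have hvu : ∀ e ∈ v, e ∈ u₁ ++ d :: u₂ := fun e he => mem_of_sat (fun e => h1.single e) h he
  have hcθ : ∀ e ∈ u₁ ++ d :: u₂, c ∉ θ e := fun e he hce =>
    hcw (List.mem_flatMap.2 ⟨e, he, hce⟩)
  have hcv : c ∉ v.flatMap θ := by
    intro hc
    obtain ⟨e, he, hce⟩ := List.mem_flatMap.1 hc
    exact hcθ e (hvu e he) hce
  have hA := getElem?_occ hk
  have hB := getElem?_occ hj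
  obtain ⟨f, hf⟩ : ∃ f, occ ((u₁ ++ d :: u₂).flatMap θ) a k = (u₁.flatMap θ).length + f :=
    Nat.exists_eq_add_of_le (by omega)
  obtain ⟨g, hg⟩ : ∃ g, occ ((u₁ ++ d :: u₂).flatMap θ) b j = (u₁.flatMap θ).length + g :=
    Nat.exists_eq_add_of_le (by omega)
  have hfd : f < (θ d).length := by omega
  have hgd : g < (θ d).length := by omega
  have hpos : ∀ (v₁ v₂ : List β) (n : ℕ), n < (θ d).length →
      ((v₁ ++ d :: v₂).flatMap θ)[(v₁.flatMap θ).length + n]? = (θ d)[n]? := by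
    intro v₁ v₂ n hn
    rw [List.flatMap_append, List.flatMap_cons, List.getElem?_append_right (by omega),
      Nat.add_sub_cancel_left, List.getElem?_append_left hn]
  have hA' : (θ d)[f]? = some a := by rw [← hpos u₁ u₂ f hfd, ← hf]; exact hA
  have hB' : (θ d)[g]? = some b := by rw [← hpos u₁ u₂ g hgd, ← hg]; exact hB
  -- Every occurrence of `d` in `u` yields a copy of `a` and `b` at the distance `g - f`; the
  -- uniqueness hypothesis says that this can only be the given copy. Hence `d` occurs neither in
  -- `u₁` nor in `u₂`.
  have hsplit : ∀ v₁ v₂ : List β, u₁ ++ d :: u₂ = v₁ ++ d :: v₂ →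
      (v₁.flatMap θ).length = (u₁.flatMap θ).length := by
    intro v₁ v₂ e
    have h₁ := hpos v₁ v₂ f hfd
    have h₂ := hpos v₁ v₂ g hgd
    rw [← e, hA'] at h₁
    rw [← e, hB'] at h₂
    obtain ⟨k', hk', ek⟩ := exists_occ h₁
    obtain ⟨j', hj', ej⟩ := exists_occ h₂
    have := huniq k' hk' j' hj' (by omega)
    subst this
    omega
  have hd₁ : d ∉ u₁ := by
    intro hd
    obtain ⟨s, t, rfl⟩ := List.append_of_mem hd
    have := hsplit s (t ++ d :: u₂) (by simp)
    simp only [List.flatMap_append, List.flatMap_cons, List.length_append] at this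
    omega
  have hd₂ : d ∉ u₂ := by
    intro hd
    obtain ⟨s, t, rfl⟩ := List.append_of_mem hd
    have := hsplit (u₁ ++ d :: s) t (by simp)
    simp only [List.flatMap_append, List.flatMap_cons, List.length_append] at this
    omega
  -- The marking is made inside the substitution, so `u ≈ v` still applies.
  set θ' := Function.update θ d ((θ d).set f c) with hθ'
  have hw₁ : mark ((u₁ ++ d :: u₂).flatMap θ) a k c = (u₁ ++ d :: u₂).flatMap θ' := by
    rw [mark, hf, List.flatMap_append, List.flatMap_append, List.flatMap_cons,
      List.flatMap_cons, hθ', flatMap_update_of_notMem _ _ _ _ hd₁,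
      flatMap_update_of_notMem _ _ _ _ hd₂, Function.update_self,
      List.set_append_right _ _ (by omega), Nat.add_sub_cancel_left,
      List.set_append_left _ _ hfd]
  have hsat : Sat S ((u₁ ++ d :: u₂).flatMap θ') (v.flatMap θ') := h.flatMap θ'
  -- The fresh letter is linear on the left, and `[c]` is an isoterm, so it is linear on the right.
  have hone : (v.flatMap θ').count c = 1 := by
    have := (h1.single c).has hsat (has_singleton.2 (by
      rw [← hw₁]; exact count_mark_new hcw hk))
    exact has_singleton.1 this
  have hid : ∀ l : List α, c ∉ l → (l.map fun e => if e = c then a else e) = l := by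
    intro l hl
    conv_rhs => rw [← List.map_id l]
    refine List.map_congr_left fun e he => ?_
    rw [if_neg (by rintro rfl; exact hl he)]; rfl
  -- Renaming `c` back to `a` restores `w'`, so the marked right-hand side is `w'` with one
  -- occurrence of `a` replaced. Which occurrence that is remains open here.
  have hmap : ((v.flatMap θ').map fun e => if e = c then a else e) = v.flatMap θ := by
    refine map_flatMap_update _ _ _ _ ?_ _ fun e he _ => hid _ (hcθ e (hvu e he))
    rw [List.map_set, if_pos rfl, hid _ (hcθ d (by simp))]
    have hl : (θ d)[f] = a := by
      rw [List.getElem?_eq_getElem hfd] at hA'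
      simpa using hA'
    conv_lhs => rw [← hl]
    exact List.set_getElem_self hfd
  obtain ⟨k', hk', e⟩ := exists_eq_mark (a := a) hone
  rw [hmap] at hk' e
  refine ⟨k', hk', hcv, β, u₁ ++ d :: u₂, v, θ', hu, h, hw₁, e.symm⟩

end Sat

/-! ### From words and deductions to lists and steps -/

/-- The list of letters of a word. -/
def lst (w : Word) : List Var := w.head :: w.tail

theorem lst_of (a : Var) : lst (FreeSemigroup.of a) = [a] := rfl

theorem lst_mul (u v : Word) : lst (u * v) = lst u ++ lst v := rfl

theorem lst_ne_nil (u : Word) : lst u ≠ [] := by simp [lst]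

theorem exists_lst_eq {l : List Var} (h : l ≠ []) : ∃ u : Word, lst u = l := by
  obtain ⟨a, l, rfl⟩ := List.exists_cons_of_ne_nil h
  exact ⟨⟨a, l⟩, rfl⟩

theorem map_word_eq_prod {S : Type*} [Monoid S] (φ : Word →ₙ* S) (u : Word) :
    φ u = ((lst u).map fun a => φ (FreeSemigroup.of a)).prod := by
  induction u using FreeSemigroup.recOnMul with
  | ih1 a => simp [lst_of]
  | ih2 a u h₁ h₂ =>
    rw [map_mul, h₁, h₂, lst_mul, List.map_append, List.prod_append]

theorem lst_subst (θ : Word →ₙ* Word) (u : Word) :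
    lst (θ u) = (lst u).flatMap fun a => lst (θ (FreeSemigroup.of a)) := by
  induction u using FreeSemigroup.recOnMul with
  | ih1 a => simp [lst_of]
  | ih2 a u h₁ h₂ => rw [map_mul, lst_mul, h₁, h₂, lst_mul, List.flatMap_append]

variable {S : Type*} [Monoid S]

theorem satisfies_iff {u v : Word} : Satisfies S u v ↔ Sat S (lst u) (lst v) := by
  constructor
  · intro h φ
    have := h (FreeSemigroup.lift φ)
    simpa [map_word_eq_prod] using this
  · intro h φ
    rw [map_word_eq_prod, map_word_eq_prod]
    exact h _

/-- Only the empty word is new as a possible right-hand side. If `u ≈ 1` held, then so would `u ≈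
uu`, against the isoterm property among nonempty words. -/
theorem IsIsoterm.iso {u : Word} (h : IsIsoterm S u) : Iso S (lst u) := by
  have key : ∀ l : List Var, l ≠ [] → Sat S (lst u) l → l = lst u := by
    intro l hl hs
    obtain ⟨v, rfl⟩ := exists_lst_eq hl
    rw [h v (satisfies_iff.2 hs)]
  intro l hs
  by_cases hl : l = []
  · subst hl
    have h₂ := key (lst u ++ lst u) (by simp [lst_ne_nil]) (by
      have := (Sat.refl (S := S) (lst u)).append hs.symm
      simpa using this)
    simp [lst_ne_nil] at h₂
  · exact key l hl hs

/-- An elementary step of a deduction from `E`. -/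
def Rewrite (E : Set (Word × Word)) (w w' : List Var) : Prop :=
  ∃ (a b : List Var) (u v : Word) (θ : Word →ₙ* Word), ((u, v) ∈ E ∨ (v, u) ∈ E) ∧
    w = a ++ lst (θ u) ++ b ∧ w' = a ++ lst (θ v) ++ b

theorem Rewrite.context {E : Set (Word × Word)} {w w' : List Var} (h : Rewrite E w w')
    (l r : List Var) : Rewrite E (l ++ w ++ r) (l ++ w' ++ r) := by
  obtain ⟨a, b, u, v, θ, hE, rfl, rfl⟩ := h
  exact ⟨l ++ a, b ++ r, u, v, θ, hE, by simp, by simp⟩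

theorem Rewrite.symm {E : Set (Word × Word)} {w w' : List Var} (h : Rewrite E w w') :
    Rewrite E w' w := by
  obtain ⟨a, b, u, v, θ, hE, rfl, rfl⟩ := h
  exact ⟨a, b, v, u, θ, hE.symm, rfl, rfl⟩

/-- A deduction is flattened into a chain of replacements in context: a product of two deductions is
carried out first in the left factor and then in the right one. -/
theorem Deducible.rewrites {E : Set (Word × Word)} {u v : Word} (h : Deducible E u v) :
    Relation.ReflTransGen (Rewrite E) (lst u) (lst v) := by
  have ctx : ∀ {w w' : List Var} (l r : List Var), Relation.ReflTransGen (Rewrite E) w w' →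
      Relation.ReflTransGen (Rewrite E) (l ++ w ++ r) (l ++ w' ++ r) := by
    intro w w' l r h
    induction h with
    | refl => exact .refl
    | tail _ h ih => exact ih.tail (h.context l r)
  have sym : ∀ {w w' : List Var}, Relation.ReflTransGen (Rewrite E) w w' →
      Relation.ReflTransGen (Rewrite E) w' w := by
    intro w w' h
    induction h with
    | refl => exact .refl
    | tail _ h ih => exact .head h.symm ih
  induction h with
  | @inst u v h θ => exact .single ⟨[], [], u, v, θ, Or.inl h, by simp, by simp⟩
  | refl u => exact .refl
  | symm _ ih =>
    exact sym ih
  | trans _ _ h₁ h₂ => exact h₁.trans h₂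
  | @mul u v u' v' _ _ h₁ h₂ =>
    have e₁ := ctx [] (lst u') h₁
    have e₂ := ctx (lst v) [] h₂
    rw [lst_mul, lst_mul]
    exact (by simpa using e₁ : Relation.ReflTransGen (Rewrite E) _ (lst v ++ lst u')).trans
      (by simpa using e₂)

/-- The possibly empty contexts become the values of two additional letters, one at each end, which
costs the `+ 2`. -/
theorem Rewrite.step {E : Set (Word × Word)} (hE : ∀ e ∈ E, Satisfies S e.1 e.2) {L : ℕ}
    (hL : ∀ e ∈ E, (lst e.1).length ≤ L ∧ (lst e.2).length ≤ L) {w w' : List Var}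
    (h : Rewrite E w w') : Step S (L + 2) w w' := by
  obtain ⟨a, b, u, v, θ, h, rfl, rfl⟩ := h
  have hs : Sat S (lst u) (lst v) ∧ (lst u).length ≤ L := by
    rcases h with h | h
    · exact ⟨satisfies_iff.1 (hE _ h), (hL _ h).1⟩
    · exact ⟨(satisfies_iff.1 (hE _ h)).symm, (hL _ h).2⟩
  refine ⟨Var ⊕ Bool, .inr true :: ((lst u).map .inl ++ [.inr false]),
    .inr true :: ((lst v).map .inl ++ [.inr false]),
    Sum.elim (fun c => lst (θ (FreeSemigroup.of c))) (fun c => if c then a else b),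
    by simpa using hs.2, ?_, ?_, ?_⟩
  · intro φ
    have := hs.1 fun c => φ (.inl c)
    simp only [List.map_cons, List.map_append, List.map_map, List.prod_cons, List.prod_append,
      List.map_nil]
    rw [show (φ ∘ Sum.inl : Var → S) = fun c => φ (.inl c) from rfl, this]
  · rw [lst_subst θ u]; simp [List.flatMap_map]
  · rw [lst_subst θ v]; simp [List.flatMap_map]

/-- The choice of `n` comes after the length bound of a supposed finite basis, which is what lets
the stretches of `U n` outgrow the words of the basis. The invariant need only survive on words
equal to `U n` in `S`, so everything that the isoterms enforce there may be used. -/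
theorem nonFinitelyBased_of_invariant {U V : ℕ → Word} (P : ℕ → List Var → Prop)
    (hUV : ∀ n, 1 < n → Satisfies S (U n) (V n)) (hU : ∀ n, 1 < n → P n (lst (U n)))
    (hV : ∀ n, 1 < n → ¬ P n (lst (V n)))
    (hstep : ∀ L, 1 < L → ∃ n, 1 < n ∧ ∀ w w', Sat S (lst (U n)) w → P n w → Step S L w w' →
      P n w') :
    NonFinitelyBased S := by
  rintro ⟨E, hfin, hE, hded⟩
  obtain ⟨L, hL⟩ : ∃ L, ∀ e ∈ E, (lst e.1).length ≤ L ∧ (lst e.2).length ≤ L := by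
    obtain ⟨L, hL⟩ := (hfin.image fun e => max (lst e.1).length (lst e.2).length).bddAbove
    refine ⟨L, fun e he => ?_⟩
    have := hL ⟨e, he, rfl⟩
    simpa using this
  obtain ⟨n, hn, h⟩ := hstep (L + 2) (by omega)
  have hd := (hded _ _ (hUV n hn)).rewrites
  have key : ∀ w, Relation.ReflTransGen (Rewrite E) (lst (U n)) w →
      Sat S (lst (U n)) w ∧ P n w := by
    intro w hw
    induction hw with
    | refl => exact ⟨Sat.refl _, hU n hn⟩
    | tail _ hr ih =>
      have hs := hr.step hE hL
      exact ⟨ih.1.trans hs.sat, h _ _ ih.1 ih.2 hs⟩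
  exact hV n hn (key _ hd).2

/-! ### Counts and positions in products of blocks of equal length -/

section UpDown

variable {f : ℕ → Word} {a : Var} {ℓ : ℕ}

theorem length_up (hℓ : ∀ j, (lst (f j)).length = ℓ) : ∀ n, (lst (up f (n + 1))).length = ℓ * (n + 1)
  | 0 => by simp [up, hℓ]
  | n + 1 => by rw [up, lst_mul, List.length_append, length_up hℓ n, hℓ]; ring

theorem length_down (hℓ : ∀ j, (lst (f j)).length = ℓ) :
    ∀ n, (lst (down f (n + 1))).length = ℓ * (n + 1)
  | 0 => by simp [down, hℓ]
  | n + 1 => by rw [down, lst_mul, List.length_append, length_down hℓ n, hℓ]; ring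

theorem count_up_of_notMem (h : ∀ j, a ∉ lst (f j)) : ∀ n, (lst (up f n)).count a = 0
  | 0 => List.count_eq_zero.2 (h _)
  | 1 => List.count_eq_zero.2 (h _)
  | n + 2 => by
    rw [up, lst_mul, List.count_append, count_up_of_notMem h (n + 1),
      List.count_eq_zero.2 (h _)]

theorem count_down_of_notMem (h : ∀ j, a ∉ lst (f j)) : ∀ n, (lst (down f n)).count a = 0
  | 0 => List.count_eq_zero.2 (h _)
  | 1 => List.count_eq_zero.2 (h _)
  | n + 2 => by
    rw [down, lst_mul, List.count_append, count_down_of_notMem h (n + 1),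
      List.count_eq_zero.2 (h _)]

theorem count_up_add_one {i : ℕ} (h : ∀ j, j ≠ i + 1 → a ∉ lst (f j)) :
    ∀ n, (lst (up f (n + 1))).count a = if i ≤ n then (lst (f (i + 1))).count a else 0
  | 0 => by
    cases i with
    | zero => simp [up]
    | succ i => simpa [up] using List.count_eq_zero.2 (h 1 (by omega))
  | n + 1 => by
    rw [up, lst_mul, List.count_append, count_up_add_one h n]
    by_cases hi : i = n + 1
    · subst hi; simp
    · rw [List.count_eq_zero.2 (h (n + 2) (by omega))]
      split_ifs <;> first | rfl | omega

theorem count_up {i n : ℕ} (h : ∀ j, j ≠ i → a ∉ lst (f j)) (hi : 1 ≤ i) (hin : i ≤ n) :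
    (lst (up f n)).count a = (lst (f i)).count a := by
  obtain ⟨i, rfl⟩ : ∃ m, i = m + 1 := ⟨i - 1, by omega⟩
  obtain ⟨n, rfl⟩ : ∃ m, n = m + 1 := ⟨n - 1, by omega⟩
  rw [count_up_add_one h, if_pos (by omega)]

theorem count_down_add_one {i : ℕ} (h : ∀ j, j ≠ i + 1 → a ∉ lst (f j)) :
    ∀ n, (lst (down f (n + 1))).count a = if i ≤ n then (lst (f (i + 1))).count a else 0
  | 0 => by
    cases i with
    | zero => simp [down]
    | succ i => simpa [down] using List.count_eq_zero.2 (h 1 (by omega))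
  | n + 1 => by
    rw [down, lst_mul, List.count_append, count_down_add_one h n]
    by_cases hi : i = n + 1
    · subst hi; simp
    · rw [List.count_eq_zero.2 (h (n + 2) (by omega))]
      split_ifs <;> omega

theorem count_down {i n : ℕ} (h : ∀ j, j ≠ i → a ∉ lst (f j)) (hi : 1 ≤ i) (hin : i ≤ n) :
    (lst (down f n)).count a = (lst (f i)).count a := by
  obtain ⟨i, rfl⟩ : ∃ m, i = m + 1 := ⟨i - 1, by omega⟩
  obtain ⟨n, rfl⟩ : ∃ m, n = m + 1 := ⟨n - 1, by omega⟩
  rw [count_down_add_one h, if_pos (by omega)]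

theorem occ_up_add_one (hℓ : ∀ j, (lst (f j)).length = ℓ) {i k : ℕ}
    (h : ∀ j, j ≠ i + 1 → a ∉ lst (f j)) (hk : k < (lst (f (i + 1))).count a) :
    ∀ n, i ≤ n → occ (lst (up f (n + 1))) a k = ℓ * i + occ (lst (f (i + 1))) a k
  | 0, hi => by
    obtain rfl : i = 0 := by omega
    simp [up]
  | n + 1, hi => by
    rw [up, lst_mul, occ_append, count_up_add_one h n]
    by_cases hin : i = n + 1
    · subst hin
      rw [if_neg (by simp), length_up hℓ]
      simp
    · rw [if_pos (by rwa [if_pos (by omega)]), occ_up_add_one hℓ h hk n (by omega)]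

theorem occ_up (hℓ : ∀ j, (lst (f j)).length = ℓ) {i n k : ℕ}
    (h : ∀ j, j ≠ i → a ∉ lst (f j)) (hi : 1 ≤ i) (hin : i ≤ n)
    (hk : k < (lst (f i)).count a) :
    occ (lst (up f n)) a k = ℓ * (i - 1) + occ (lst (f i)) a k := by
  obtain ⟨i, rfl⟩ : ∃ m, i = m + 1 := ⟨i - 1, by omega⟩
  obtain ⟨n, rfl⟩ : ∃ m, n = m + 1 := ⟨n - 1, by omega⟩
  rw [occ_up_add_one hℓ h hk n (by omega), Nat.add_sub_cancel]

theorem occ_down_add_one (hℓ : ∀ j, (lst (f j)).length = ℓ) {i k : ℕ}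
    (h : ∀ j, j ≠ i + 1 → a ∉ lst (f j)) (hk : k < (lst (f (i + 1))).count a) :
    ∀ n, i ≤ n → occ (lst (down f (n + 1))) a k = ℓ * (n - i) + occ (lst (f (i + 1))) a k
  | 0, hi => by
    obtain rfl : i = 0 := by omega
    simp [down]
  | n + 1, hi => by
    rw [down, lst_mul, occ_append]
    by_cases hin : i = n + 1
    · subst hin
      rw [if_pos hk]
      simp
    · rw [List.count_eq_zero.2 (h (n + 2) (by omega)), if_neg (by omega), hℓ, Nat.sub_zero,
        occ_down_add_one hℓ h hk n (by omega), show n + 1 - i = n - i + 1 by omega]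
      ring

theorem occ_down (hℓ : ∀ j, (lst (f j)).length = ℓ) {i n k : ℕ}
    (h : ∀ j, j ≠ i → a ∉ lst (f j)) (hi : 1 ≤ i) (hin : i ≤ n)
    (hk : k < (lst (f i)).count a) :
    occ (lst (down f n)) a k = ℓ * (n - i) + occ (lst (f i)) a k := by
  obtain ⟨i, rfl⟩ : ∃ m, i = m + 1 := ⟨i - 1, by omega⟩
  obtain ⟨n, rfl⟩ : ∃ m, n = m + 1 := ⟨n - 1, by omega⟩
  rw [occ_down_add_one hℓ h hk n (by omega), show n + 1 - (i + 1) = n - i by omega]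

end UpDown

/-! ### Short patterns as inequalities between positions -/

section Patterns

variable {α : Type*} [DecidableEq α] {w : List α} {a b c s r : α}

/-- This and the next lemmas are `has_iff` for the patterns in use, in a form that `omega` can
consume. -/
theorem has_ab (h : [a, b].Nodup) :
    Has w [a, b] ↔
      (w.count a = 1 ∧ w.count b = 1) ∧
      occ w a 0 < occ w b 0 := by
  simp only [List.nodup_cons, List.mem_cons, List.not_mem_nil, or_false, not_or, not_false_eq_true,
    List.nodup_nil, and_true] at h
  rw [has_iff]
  simp [Inc, List.count_cons, h, Ne.symm h]

theorem has_aa :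
    Has w [a, a] ↔
      (w.count a = 2) ∧
      occ w a 0 < occ w a 1 := by
  rw [has_iff]
  simp [Inc]

theorem has_aab (h : [a, b].Nodup) :
    Has w [a, a, b] ↔
      (w.count a = 2 ∧ w.count b = 1) ∧
      occ w a 0 < occ w a 1 ∧ occ w a 1 < occ w b 0 := by
  simp only [List.nodup_cons, List.mem_cons, List.not_mem_nil, or_false, not_or, not_false_eq_true,
    List.nodup_nil, and_true] at h
  rw [has_iff]
  simp [Inc, List.count_cons, h, Ne.symm h]

theorem has_baa (h : [b, a].Nodup) :
    Has w [b, a, a] ↔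
      (w.count b = 1 ∧ w.count a = 2) ∧
      occ w b 0 < occ w a 0 ∧ occ w a 0 < occ w a 1 := by
  simp only [List.nodup_cons, List.mem_cons, List.not_mem_nil, or_false, not_or, not_false_eq_true,
    List.nodup_nil, and_true] at h
  rw [has_iff]
  simp [Inc, List.count_cons, h, Ne.symm h]

theorem has_aba (h : [a, b].Nodup) :
    Has w [a, b, a] ↔
      (w.count a = 2 ∧ w.count b = 1) ∧
      occ w a 0 < occ w b 0 ∧ occ w b 0 < occ w a 1 := by
  simp only [List.nodup_cons, List.mem_cons, List.not_mem_nil, or_false, not_or, not_false_eq_true,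
    List.nodup_nil, and_true] at h
  rw [has_iff]
  simp [Inc, List.count_cons, h, Ne.symm h]
  tauto

theorem has_aabb (h : [a, b].Nodup) :
    Has w [a, a, b, b] ↔
      (w.count a = 2 ∧ w.count b = 2) ∧
      occ w a 0 < occ w a 1 ∧ occ w a 1 < occ w b 0 ∧ occ w b 0 < occ w b 1 := by
  simp only [List.nodup_cons, List.mem_cons, List.not_mem_nil, or_false, not_or, not_false_eq_true,
    List.nodup_nil, and_true] at h
  rw [has_iff]
  simp [Inc, List.count_cons, h, Ne.symm h]

theorem has_abba (h : [a, b].Nodup) :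
    Has w [a, b, b, a] ↔
      (w.count a = 2 ∧ w.count b = 2) ∧
      occ w a 0 < occ w b 0 ∧ occ w b 0 < occ w b 1 ∧ occ w b 1 < occ w a 1 := by
  simp only [List.nodup_cons, List.mem_cons, List.not_mem_nil, or_false, not_or, not_false_eq_true,
    List.nodup_nil, and_true] at h
  rw [has_iff]
  simp [Inc, List.count_cons, h, Ne.symm h]
  tauto

theorem has_abac (h : [a, b, c].Nodup) :
    Has w [a, b, a, c] ↔
      (w.count a = 2 ∧ w.count b = 1 ∧ w.count c = 1) ∧
      occ w a 0 < occ w b 0 ∧ occ w b 0 < occ w a 1 ∧ occ w a 1 < occ w c 0 := by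
  simp only [List.nodup_cons, List.mem_cons, List.not_mem_nil, or_false, not_or, not_false_eq_true,
    List.nodup_nil, and_true] at h
  obtain ⟨⟨hab, hac⟩, hbc⟩ := h
  rw [has_iff]
  simp [Inc, List.count_cons, hab, hac, hbc, Ne.symm hab, Ne.symm hac, Ne.symm hbc]
  tauto

theorem has_abbca (h : [a, b, c].Nodup) :
    Has w [a, b, b, c, a] ↔
      (w.count a = 2 ∧ w.count b = 2 ∧ w.count c = 1) ∧
      occ w a 0 < occ w b 0 ∧ occ w b 0 < occ w b 1 ∧ occ w b 1 < occ w c 0 ∧ occ w c 0 < occ w a 1 := by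
  simp only [List.nodup_cons, List.mem_cons, List.not_mem_nil, or_false, not_or, not_false_eq_true,
    List.nodup_nil, and_true] at h
  obtain ⟨⟨hab, hac⟩, hbc⟩ := h
  rw [has_iff]
  simp [Inc, List.count_cons, hab, hac, hbc, Ne.symm hab, Ne.symm hac, Ne.symm hbc]
  tauto

theorem has_abcca (h : [a, b, c].Nodup) :
    Has w [a, b, c, c, a] ↔
      (w.count a = 2 ∧ w.count b = 1 ∧ w.count c = 2) ∧
      occ w a 0 < occ w b 0 ∧ occ w b 0 < occ w c 0 ∧ occ w c 0 < occ w c 1 ∧ occ w c 1 < occ w a 1 := by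
  simp only [List.nodup_cons, List.mem_cons, List.not_mem_nil, or_false, not_or, not_false_eq_true,
    List.nodup_nil, and_true] at h
  obtain ⟨⟨hab, hac⟩, hbc⟩ := h
  rw [has_iff]
  simp [Inc, List.count_cons, hab, hac, hbc, Ne.symm hab, Ne.symm hac, Ne.symm hbc]
  tauto

theorem has_asabrb (h : [a, s, b, r].Nodup) :
    Has w [a, s, a, b, r, b] ↔
      (w.count a = 2 ∧ w.count s = 1 ∧ w.count b = 2 ∧ w.count r = 1) ∧
      occ w a 0 < occ w s 0 ∧ occ w s 0 < occ w a 1 ∧ occ w a 1 < occ w b 0 ∧ occ w b 0 < occ w r 0 ∧ occ w r 0 < occ w b 1 := by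
  simp only [List.nodup_cons, List.mem_cons, List.not_mem_nil, or_false, not_or, not_false_eq_true,
    List.nodup_nil, and_true] at h
  obtain ⟨⟨has, hab, har⟩, ⟨hsb, hsr⟩, hbr⟩ := h
  rw [has_iff]
  simp [Inc, List.count_cons, has, hab, har, hsb, hsr, hbr, Ne.symm has, Ne.symm hab, Ne.symm har,
    Ne.symm hsb, Ne.symm hsr, Ne.symm hbr]
  tauto

theorem has_absbra (h : [a, b, s, r].Nodup) :
    Has w [a, b, s, b, r, a] ↔
      (w.count a = 2 ∧ w.count b = 2 ∧ w.count s = 1 ∧ w.count r = 1) ∧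
      occ w a 0 < occ w b 0 ∧ occ w b 0 < occ w s 0 ∧ occ w s 0 < occ w b 1 ∧ occ w b 1 < occ w r 0 ∧ occ w r 0 < occ w a 1 := by
  simp only [List.nodup_cons, List.mem_cons, List.not_mem_nil, or_false, not_or, not_false_eq_true,
    List.nodup_nil, and_true] at h
  obtain ⟨⟨hab, has, har⟩, ⟨hbs, hbr⟩, hsr⟩ := h
  rw [has_iff]
  simp [Inc, List.count_cons, hab, has, har, hbs, hbr, hsr, Ne.symm hab, Ne.symm has, Ne.symm har,
    Ne.symm hbs, Ne.symm hbr, Ne.symm hsr]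
  tauto

theorem has_asbarb (h : [a, s, b, r].Nodup) :
    Has w [a, s, b, a, r, b] ↔
      (w.count a = 2 ∧ w.count s = 1 ∧ w.count b = 2 ∧ w.count r = 1) ∧
      occ w a 0 < occ w s 0 ∧ occ w s 0 < occ w b 0 ∧ occ w b 0 < occ w a 1 ∧ occ w a 1 < occ w r 0 ∧ occ w r 0 < occ w b 1 := by
  simp only [List.nodup_cons, List.mem_cons, List.not_mem_nil, or_false, not_or, not_false_eq_true,
    List.nodup_nil, and_true] at h
  obtain ⟨⟨has, hab, har⟩, ⟨hsb, hsr⟩, hbr⟩ := h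
  rw [has_iff]
  simp [Inc, List.count_cons, has, hab, har, hsb, hsr, hbr, Ne.symm has, Ne.symm hab, Ne.symm har,
    Ne.symm hsb, Ne.symm hsr, Ne.symm hbr]
  tauto

theorem has_absab (h : [a, b, s].Nodup) :
    Has w [a, b, s, a, b] ↔
      (w.count a = 2 ∧ w.count b = 2 ∧ w.count s = 1) ∧
      occ w a 0 < occ w b 0 ∧ occ w b 0 < occ w s 0 ∧ occ w s 0 < occ w a 1 ∧ occ w a 1 < occ w b 1 := by
  simp only [List.nodup_cons, List.mem_cons, List.not_mem_nil, or_false, not_or, not_false_eq_true,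
    List.nodup_nil, and_true] at h
  obtain ⟨⟨hab, has⟩, hbs⟩ := h
  rw [has_iff]
  simp [Inc, List.count_cons, hab, has, hbs, Ne.symm hab, Ne.symm has, Ne.symm hbs]
  tauto

theorem has_absba (h : [a, b, s].Nodup) :
    Has w [a, b, s, b, a] ↔
      (w.count a = 2 ∧ w.count b = 2 ∧ w.count s = 1) ∧
      occ w a 0 < occ w b 0 ∧ occ w b 0 < occ w s 0 ∧ occ w s 0 < occ w b 1 ∧ occ w b 1 < occ w a 1 := by
  simp only [List.nodup_cons, List.mem_cons, List.not_mem_nil, or_false, not_or, not_false_eq_true,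
    List.nodup_nil, and_true] at h
  obtain ⟨⟨hab, has⟩, hbs⟩ := h
  rw [has_iff]
  simp [Inc, List.count_cons, hab, has, hbs, Ne.symm hab, Ne.symm has, Ne.symm hbs]
  tauto

end Patterns

theorem lst_x : lst x = [Var.x 0] := rfl
theorem lst_y : lst y = [Var.y 0] := rfl
theorem lst_z : lst z = [Var.z 0] := rfl
theorem lst_t : lst t = [Var.t 0] := rfl
theorem lst_ts (i : ℕ) : lst (ts i) = [Var.t i] := rfl

theorem mark_facts {α : Type*} [DecidableEq α] {w : List α} {a c : α} {k : ℕ} (hc : c ∉ w)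
    (hca : c ≠ a) (hk : k < w.count a) :
    (mark w a k c).count c = 1 ∧ occ (mark w a k c) c 0 = occ w a k ∧
      (mark w a k c).count a + 1 = w.count a ∧
      ∀ j, occ (mark w a k c) a j = if j < k then occ w a j else occ w a (j + 1) :=
  ⟨count_mark_new hc hk, occ_mark_new hc hk, count_mark_old hca hk, occ_mark_old hca hk⟩

theorem length_up_of (g : ℕ → Var) {n : ℕ} (hn : 1 ≤ n) :
    (lst (up (fun j => FreeSemigroup.of (g j)) n)).length = n := by
  obtain ⟨n, rfl⟩ : ∃ m, n = m + 1 := ⟨n - 1, by omega⟩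
  rw [length_up (ℓ := 1) (fun _ => rfl), one_mul]

theorem length_down_of (g : ℕ → Var) {n : ℕ} (hn : 1 ≤ n) :
    (lst (down (fun j => FreeSemigroup.of (g j)) n)).length = n := by
  obtain ⟨n, rfl⟩ : ∃ m, n = m + 1 := ⟨n - 1, by omega⟩
  rw [length_down (ℓ := 1) (fun _ => rfl), one_mul]

section Letters

variable {g : ℕ → Var} (hg : Function.Injective g) {i n : ℕ} (hi : 1 ≤ i) (hin : i ≤ n)

include hg hi hin

theorem count_up_of : (lst (up (fun j => FreeSemigroup.of (g j)) n)).count (g i) = 1 := by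
  rw [count_up (i := i) (by
    intro j hj; rw [lst_of, List.mem_singleton]; exact fun h => hj (hg h.symm)) hi hin]
  simp [lst_of]

theorem count_down_of : (lst (down (fun j => FreeSemigroup.of (g j)) n)).count (g i) = 1 := by
  rw [count_down (i := i) (by
    intro j hj; rw [lst_of, List.mem_singleton]; exact fun h => hj (hg h.symm)) hi hin]
  simp [lst_of]

theorem occ_up_of : occ (lst (up (fun j => FreeSemigroup.of (g j)) n)) (g i) 0 = i - 1 := by
  rw [occ_up (ℓ := 1) (fun _ => rfl) (i := i) (by
    intro j hj; rw [lst_of, List.mem_singleton]; exact fun h => hj (hg h.symm)) hi hin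
    (by simp [lst_of])]
  simp [lst_of, occ]

theorem occ_down_of : occ (lst (down (fun j => FreeSemigroup.of (g j)) n)) (g i) 0 = n - i := by
  rw [occ_down (ℓ := 1) (fun _ => rfl) (i := i) (by
    intro j hj; rw [lst_of, List.mem_singleton]; exact fun h => hj (hg h.symm)) hi hin
    (by simp [lst_of])]
  simp [lst_of, occ]

end Letters

theorem count_up_of_ne {g : ℕ → Var} {a : Var} (h : ∀ j, a ≠ g j) (n : ℕ) :
    (lst (up (fun j => FreeSemigroup.of (g j)) n)).count a = 0 :=
  count_up_of_notMem (by intro j; rw [lst_of, List.mem_singleton]; exact h j) n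

theorem count_down_of_ne {g : ℕ → Var} {a : Var} (h : ∀ j, a ≠ g j) (n : ℕ) :
    (lst (down (fun j => FreeSemigroup.of (g j)) n)).count a = 0 :=
  count_down_of_notMem (by intro j; rw [lst_of, List.mem_singleton]; exact h j) n

theorem ys_eq : ys = fun j => FreeSemigroup.of (Var.y j) := rfl
theorem xs_eq : xs = fun j => FreeSemigroup.of (Var.x j) := rfl
theorem zs_eq : zs = fun j => FreeSemigroup.of (Var.z j) := rfl

theorem x_injective : Function.Injective Var.x := fun _ _ h => by simpa using h
theorem y_injective : Function.Injective Var.y := fun _ _ h => by simpa using h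
theorem z_injective : Function.Injective Var.z := fun _ _ h => by simpa using h

theorem notMem_of_sat {S : Type*} [Monoid S] {c₀ : Var} (h1 : Iso S [c₀]) {u v : List Var}
    (h : Sat S u v) {c : Var} (hc : u.count c = 0) : c ∉ v := fun hv =>
  List.count_eq_zero.1 hc (mem_of_sat (fun d => h1.single d) h hv)

/-! ### Row 1: `xx[Yn][nY]` -/

section Row1

variable {S : Type*} [Monoid S]

theorem row1_U {n : ℕ} (hn : 1 < n) :
    (lst (row1.U n)).count (.x 0) = 2 ∧ occ (lst (row1.U n)) (.x 0) 0 = 0 ∧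
    occ (lst (row1.U n)) (.x 0) 1 = 1 ∧ (lst (row1.U n)).count (.t 0) = 0 ∧
    ∀ i, 1 ≤ i → i ≤ n → (lst (row1.U n)).count (.y i) = 2 ∧
      occ (lst (row1.U n)) (.y i) 0 = 2 + (i - 1) ∧
      occ (lst (row1.U n)) (.y i) 1 = 2 + n + (n - i) := by
  have hl := length_up_of Var.y (n := n) (by omega)
  simp only [row1, lst_mul, lst_x, ys_eq]
  refine ⟨?_, ?_, ?_, ?_, fun i hi hin => ?_⟩
  · simp [List.count_append, count_up_of_ne, count_down_of_ne]
  · simp [occ]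
  · simp [occ]
  · simp [List.count_append, count_up_of_ne, count_down_of_ne]
  · have h₁ := count_up_of y_injective hi hin
    have h₂ := count_down_of y_injective hi hin
    have h₃ := occ_up_of y_injective hi hin
    have h₄ := occ_down_of y_injective hi hin
    simp only [List.count_append, occ_append, h₁, h₂]
    simp [h₃, h₄, hl]
    omega

theorem row1_V {n : ℕ} (hn : 1 < n) :
    occ (lst (row1.V n)) (.y 1) 0 < occ (lst (row1.V n)) (.x 0) 0 := by
  have hl := length_up_of Var.y (n := n) (by omega)
  simp only [row1, lst_mul, lst_x, ys_eq]
  have h₁ := count_up_of y_injective le_rfl hn.le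
  have h₃ := occ_up_of y_injective le_rfl hn.le
  simp only [List.count_append, occ_append, h₁, h₃, hl]
  simp [count_up_of_ne, count_down_of_ne]
  omega

/-- The invariant is that the first `x` precedes the first `y 1`. The isoterm `xyyx` keeps the `y i`
nested in each other and forbids nesting between `x` and any `y i`. Marking the first occurrence of
one `y (i + 1)` by `t` makes `xxt` or `xtx` visible, which ties the first `x` to this `y (i + 1)`;
the nesting conditions carry the conclusion over to `y 1`. -/
theorem row1_nonFinitelyBased (hUV : ∀ n, 1 < n → Satisfies S (row1.U n) (row1.V n))
    (hW : ∀ w ∈ row1.W, IsIsoterm S w) : NonFinitelyBased S := by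
  have hq : Iso S [Var.x 0, .y 0, .y 0, .x 0] :=
    (hW (x * y * y * x) (by simp [row1])).iso
  have i_a : Iso S [Var.x 0] :=
    hq.of_subst (fun c => [c]) [] [.y 0, .y 0, .x 0] (by simp) (by simp) (by simp) (by simp)
  have i_aa : ∀ a : Var, Iso S [a, a] := fun a =>
    hq.of_subst (fun _ => [.y 0]) [.x 0] [.x 0] (by simp) (by simp) (by simp) (by simp)
  have i_ab : ∀ a b : Var, a ≠ b → Iso S [a, b] := fun a b h =>
    hq.of_subst (fun c => if c = a then [.x 0] else [.y 0]) [] [.y 0, .x 0]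
      (by simp) (by simp [h.symm]) (by simp [h.symm]) (by simp [h, h.symm])
  have i_aab : ∀ a b : Var, a ≠ b → Iso S [a, a, b] := fun a b h =>
    hq.of_subst (fun c => if c = a then [.y 0] else [.x 0]) [.x 0] []
      (by simp) (by simp [h.symm]) (by simp [h.symm]) (by simp [h, h.symm])
  have i_aba : ∀ a b : Var, a ≠ b → Iso S [a, b, a] := fun a b h =>
    hq.of_subst (fun c => if c = a then [.x 0] else [.y 0, .y 0]) [] []
      (by simp) (by simp [h.symm]) (by simp [h.symm]) (by simp [h, h.symm])
  have i_abba : ∀ a b : Var, a ≠ b → Iso S [a, b, b, a] := fun a b h =>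
    hq.of_subst (fun c => if c = a then [.x 0] else [.y 0]) [] []
      (by simp) (by simp [h.symm]) (by simp [h.symm]) (by simp [h, h.symm])
  have key : ∀ n, 1 < n → ∀ w, Sat S (lst (row1.U n)) w →
      w.count (.x 0) = 2 ∧ Var.t 0 ∉ w ∧ (∀ i, 1 ≤ i → i ≤ n →
        w.count (.y i) = 2 ∧ ¬ Has w [.x 0, .y i, .y i, .x 0] ∧
        ¬ Has w [.y i, .x 0, .x 0, .y i]) ∧
      ∀ i j, 1 ≤ i → i < j → j ≤ n → Has w [.y i, .y j, .y j, .y i] := by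
    intro n hn w hs
    obtain ⟨hx, hx0, hx1, ht, hy⟩ := row1_U hn
    refine ⟨?_, notMem_of_sat i_a hs ht, fun i hi hin => ⟨?_, ?_, ?_⟩, fun i j hi hij hj => ?_⟩
    · exact (has_aa.1 ((i_aa (.x 0)).has hs (has_aa.2 ⟨hx, by omega⟩))).1
    · have := hy i hi hin
      exact (has_aa.1 ((i_aa (.y i)).has hs (has_aa.2 ⟨this.1, by omega⟩))).1
    · intro h
      have h' := (has_abba (by simp)).1 ((i_abba _ _ (by simp)).has hs.symm h)
      have := hy i hi hin
      omega
    · intro h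
      have h' := (has_abba (by simp)).1 ((i_abba _ _ (by simp)).has hs.symm h)
      have := hy i hi hin
      omega
    · have h₁ := hy i hi (by omega)
      have h₂ := hy j (by omega) hj
      have hne : i ≠ j := by omega
      exact (i_abba _ _ (by simpa using hne)).has hs ((has_abba (by simpa using hne)).2
        (by omega))
  refine nonFinitelyBased_of_invariant (fun _ w => occ w (.x 0) 0 < occ w (.y 1) 0) hUV
    ?_ ?_ ?_
  · intro n hn
    obtain ⟨hx, hx0, hx1, ht, hy⟩ := row1_U hn
    have := hy 1 le_rfl hn.le
    omega
  · intro n hn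
    have := row1_V hn
    omega
  · intro L hL
    refine ⟨L + 2, by omega, fun w w' hs hP hstep => ?_⟩
    obtain ⟨hx, ht, hxy, hyy⟩ := key _ (by omega) w hs
    obtain ⟨hx', ht', hxy', hyy'⟩ := key _ (by omega) w' (hs.trans hstep.sat)
    have hc : ∀ i j, 1 ≤ i → i < j → j ≤ L + 2 → (w.count (Var.y i) = 2 ∧ w.count (Var.y j) = 2) ∧
        occ w (.y i) 0 < occ w (.y j) 0 ∧ occ w (.y j) 0 < occ w (.y j) 1 ∧
          occ w (.y j) 1 < occ w (.y i) 1 := fun i j hi hij hj =>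
      (has_abba (by simp; omega)).1 (hyy i j hi hij hj)
    obtain ⟨i, hi, hm⟩ := hstep.exists_mark i_a (fun i => occ w (.y (i + 1)) 0)
      (fun i hi => (hc (i + 1) (i + 2) (by omega) (by omega) (by omega)).2.1)
      (occ_lt_length (by rw [(hxy (L + 1) (by omega) (by omega)).1]; omega))
    have h₁ := hc (i + 1) (i + 2) (by omega) (by omega) (by omega)
    -- Uniqueness: the second `y (i + 1)` stands after both occurrences of `y (i + 2)`, so the pair
    -- cannot recur at the same distance.
    obtain ⟨k, hk, -, hst⟩ := hm (.y (i + 1)) (.y (i + 2)) (.t 0) 0 0 ht (by simp) (by omega)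
      (by omega) le_rfl (by omega) le_rfl (by
        intro k' hk' j' hj' e
        by_contra hne
        obtain rfl : k' = 1 := by omega
        obtain rfl | rfl : j' = 0 ∨ j' = 1 := by omega
        · omega
        · omega)
    have hs₁ := hst.sat
    obtain ⟨m₁, m₂, m₃, m₄⟩ := mark_facts (w := w) (a := .y (i + 1)) (c := .t 0) (k := 0) ht
      (by simp) (by omega)
    obtain ⟨m₁', m₂', m₃', m₄'⟩ := mark_facts (w := w') (a := .y (i + 1)) (c := .t 0) ht'
      (by simp) hk
    have m₄0 := m₄ 0
    have m₄0' := m₄' 0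
    have hy' := (hxy' (i + 1) (by omega) (by omega)).1
    have hcy := (has_ab (by simp)).1 ((i_ab (.t 0) (.y (i + 1)) (by simp)).has hs₁
      ((has_ab (by simp)).2 (by simp at m₄0; omega)))
    have hyy0 := occ_lt_occ (w := w') (a := .y (i + 1)) (i := 0) (j := 1) (by omega) (by omega)
    -- The mark precedes the remaining `y (i + 1)`, and this order of two linear letters is kept.
    have hk0 : k = 0 := by
      by_contra hk0
      obtain rfl : k = 1 := by omega
      simp at m₄0'
      omega
    subst hk0
    have hxw : ∀ j, occ (mark w (.y (i + 1)) 0 (.t 0)) (.x 0) j = occ w (.x 0) j := fun j =>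
      occ_mark_of_ne (by simp) (by simp) j
    have hxw' : ∀ j, occ (mark w' (.y (i + 1)) 0 (.t 0)) (.x 0) j = occ w' (.x 0) j := fun j =>
      occ_mark_of_ne (by simp) (by simp) j
    have hcx : (mark w (.y (i + 1)) 0 (.t 0)).count (.x 0) = 2 := by
      rw [count_mark_of_ne (by simp) (by simp), hx]
    have hx0 := hxw 0
    have hx1 := hxw 1
    have hx0' := hxw' 0
    have hx1' := hxw' 1
    have hy1 : occ w (.y 1) 0 ≤ occ w (.y (i + 1)) 0 := by
      rcases Nat.eq_zero_or_pos i with rfl | hi0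
      · exact le_rfl
      · exact (hc 1 (i + 1) le_rfl (by omega) (by omega)).2.1.le
    have hx01 := occ_lt_occ (w := w) (a := .x 0) (i := 0) (j := 1) (by omega) (by omega)
    have hx01' := occ_lt_occ (w := w') (a := .x 0) (i := 0) (j := 1) (by omega) (by omega)
    have hne := occ_ne (w := w) (a := .x 0) (b := .y (i + 1)) (i := 1) (j := 0) (by simp)
      (by omega) (by omega)
    have hxt : occ w' (.x 0) 0 < occ w' (.y (i + 1)) 0 := by
      rcases lt_or_gt_of_ne hne with h | h
      · have := (has_aab (by simp)).1 ((i_aab (.x 0) (.t 0) (by simp)).has hs₁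
          ((has_aab (by simp)).2 (by omega)))
        omega
      · have := (has_aba (by simp)).1 ((i_aba (.x 0) (.t 0) (by simp)).has hs₁
          ((has_aba (by simp)).2 (by omega)))
        omega
    have hy1' := hxy' 1 le_rfl (by omega)
    have hyi' := hxy' (i + 1) (by omega) (by omega)
    by_contra hP'
    rcases Nat.eq_zero_or_pos i with rfl | hi0
    · exact hP' hxt
    -- If `y 1` came before both `x`, its second occurrence would precede the second `x`, as `y x x
    -- y` is forbidden. Both `y (i + 1)`, being inside `y 1`, would then lie between the two `x`,
    -- which is forbidden as well.
    · have h₂ := (has_abba (by simp; omega)).1 (hyy' 1 (i + 1) le_rfl (by omega) (by omega))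
      have h₃ := occ_ne (w := w') (a := .x 0) (b := .y 1) (i := 0) (j := 0) (by simp)
        (by omega) (by omega)
      have h₄ := occ_ne (w := w') (a := .x 0) (b := .y 1) (i := 1) (j := 1) (by simp)
        (by omega) (by omega)
      have h₅ : occ w' (.y 1) 1 < occ w' (.x 0) 1 := by
        by_contra hcon
        exact hy1'.2.2 ((has_abba (by simp)).2 (by omega))
      exact hyi'.2.1 ((has_abba (by simp)).2 (by omega))

end Row1

attribute [simp] occ_cons_ne occ_cons_self_zero occ_cons_self_succ

/-! ### Row 2: `[Zn]^t yxx[Zn]y` -/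

section Row2

variable {S : Type*} [Monoid S]

theorem row2_prefix {n : ℕ} :
    (∀ a, (∀ j, a ≠ Var.z j) → (∀ j, a ≠ Var.t j) →
      (lst (up (fun i => zs i * ts i) n)).count a = 0) ∧
    (1 ≤ n → (lst (up (fun i => zs i * ts i) n)).length = 2 * n) ∧
    ∀ i, 1 ≤ i → i ≤ n → (lst (up (fun i => zs i * ts i) n)).count (.z i) = 1 ∧
      (lst (up (fun i => zs i * ts i) n)).count (.t i) = 1 ∧
      occ (lst (up (fun i => zs i * ts i) n)) (.z i) 0 = 2 * (i - 1) ∧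
      occ (lst (up (fun i => zs i * ts i) n)) (.t i) 0 = 2 * (i - 1) + 1 := by
  have e : ∀ j, lst (zs j * ts j) = [.z j, .t j] := fun j => rfl
  refine ⟨fun a h₁ h₂ => ?_, fun hn => ?_, fun i hi hin => ?_⟩
  · exact count_up_of_notMem (by intro j; simp [e, h₁, h₂]) n
  · obtain ⟨n, rfl⟩ : ∃ m, n = m + 1 := ⟨n - 1, by omega⟩
    exact length_up (ℓ := 2) (fun _ => rfl) n
  · have hz : ∀ j, j ≠ i → Var.z i ∉ lst (zs j * ts j) := by
      intro j hj; simp [e, hj.symm]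
    have ht : ∀ j, j ≠ i → Var.t i ∉ lst (zs j * ts j) := by
      intro j hj; simp [e, hj.symm]
    rw [count_up hz hi hin, count_up ht hi hin,
      occ_up (ℓ := 2) (fun _ => rfl) hz hi hin (by simp [e]),
      occ_up (ℓ := 2) (fun _ => rfl) ht hi hin (by simp [e])]
    simp [e, occ]

theorem row2_U {n : ℕ} (hn : 1 < n) :
    (lst (row2.U n)).count (.x 0) = 2 ∧ (lst (row2.U n)).count (.y 0) = 2 ∧
    (lst (row2.U n)).count (.p 0) = 0 ∧
    occ (lst (row2.U n)) (.y 0) 0 = 2 * n ∧ occ (lst (row2.U n)) (.x 0) 0 = 2 * n + 1 ∧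
    occ (lst (row2.U n)) (.x 0) 1 = 2 * n + 2 ∧ occ (lst (row2.U n)) (.y 0) 1 = 3 * n + 3 ∧
    ∀ i, 1 ≤ i → i ≤ n → (lst (row2.U n)).count (.z i) = 2 ∧ (lst (row2.U n)).count (.t i) = 1 ∧
      occ (lst (row2.U n)) (.z i) 0 = 2 * (i - 1) ∧
      occ (lst (row2.U n)) (.t i) 0 = 2 * (i - 1) + 1 ∧
      occ (lst (row2.U n)) (.z i) 1 = 2 * n + 3 + (i - 1) := by
  obtain ⟨h₁, h₂, h₃⟩ := row2_prefix (n := n)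
  have hl := length_up_of Var.z (n := n) (by omega)
  have hx := h₁ (.x 0) (by simp) (by simp)
  have hy := h₁ (.y 0) (by simp) (by simp)
  have hp := h₁ (.p 0) (by simp) (by simp)
  have hl' := h₂ (by omega)
  simp only [row2, lst_mul, lst_x, lst_y]
  rw [zs_eq] at *
  refine ⟨?_, ?_, ?_, ?_, ?_, ?_, ?_, fun i hi hin => ?_⟩
  · simp [hx, count_up_of_ne]
  · simp [hy, count_up_of_ne]
  · simp [hp, count_up_of_ne]
  · simp [occ_append, hy, hl', occ]
  · simp [occ_append, hx, hl', occ]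
  · simp [occ_append, hx, hl', occ]
  · simp [occ_append, hy, hl', hl, occ, count_up_of_ne]
    omega
  · obtain ⟨e₁, e₂, e₃, e₄⟩ := h₃ i hi hin
    have e₅ := count_up_of z_injective hi hin
    have e₆ := occ_up_of z_injective hi hin
    simp [occ_append, e₁, e₂, e₃, e₄, e₅, e₆, hl', count_up_of_ne]
    omega

theorem row2_V {n : ℕ} (hn : 1 < n) :
    occ (lst (row2.V n)) (.x 0) 0 < occ (lst (row2.V n)) (.y 0) 0 := by
  obtain ⟨h₁, h₂, h₃⟩ := row2_prefix (n := n)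
  have hx := h₁ (.x 0) (by simp) (by simp)
  have hy := h₁ (.y 0) (by simp) (by simp)
  have hl' := h₂ (by omega)
  simp only [row2, lst_mul, lst_x, lst_y]
  simp [occ_append, hx, hy, hl', occ]

/-- The order of `y` and `xx` would be fixed if some letter between `xx` and the last `y` were
linear, by the isoterm `yxxty`. Marking the first occurrence of a `z (i + 1)`, in the prefix, leaves
its second occurrence as such a letter. -/
theorem row2_nonFinitelyBased (hUV : ∀ n, 1 < n → Satisfies S (row2.U n) (row2.V n))
    (hW : ∀ w ∈ row2.W, IsIsoterm S w) : NonFinitelyBased S := by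
  have hq₁ : Iso S [Var.y 0, .x 0, .x 0, .t 0, .y 0] :=
    (hW (y * x * x * t * y) (by simp [row2])).iso
  have hq₂ : Iso S [Var.y 0, .t 0, .x 0, .x 0, .y 0] :=
    (hW (y * t * x * x * y) (by simp [row2])).iso
  have i_a : Iso S [Var.x 0] :=
    hq₁.of_subst (fun c => [c]) [.y 0] [.x 0, .t 0, .y 0] (by simp) (by simp) (by simp) (by simp)
  have i_aa : ∀ a : Var, Iso S [a, a] := fun a =>
    hq₁.of_subst (fun _ => [.x 0]) [.y 0] [.t 0, .y 0] (by simp) (by simp) (by simp) (by simp)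
  have i_baa : ∀ b a : Var, b ≠ a → Iso S [b, a, a] := fun b a h =>
    hq₂.of_subst (fun c => if c = a then [.x 0] else [.t 0]) [.y 0] [.y 0]
      (by simp) (by simp [h]) (by simp [h]) (by simp [h, h.symm])
  have i_aba : ∀ a b : Var, a ≠ b → Iso S [a, b, a] := fun a b h =>
    hq₁.of_subst (fun c => if c = a then [.y 0] else [.x 0, .x 0, .t 0]) [] []
      (by simp) (by simp [h.symm]) (by simp [h.symm]) (by simp [h, h.symm])
  have i_abcca : ∀ a b c : Var, [a, b, c].Nodup → Iso S [a, b, c, c, a] := fun a b c h => by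
    simp at h
    obtain ⟨⟨h₁, h₂⟩, h₃⟩ := h
    exact hq₂.of_subst (fun d => if d = a then [.y 0] else if d = b then [.t 0] else [.x 0]) [] []
      (by simp) (by simp [h₁, h₂, h₃, Ne.symm h₁, Ne.symm h₂, Ne.symm h₃])
      (by simp [h₁, h₂, h₃, Ne.symm h₁, Ne.symm h₂, Ne.symm h₃])
      (by simp [h₁, h₂, h₃, Ne.symm h₁, Ne.symm h₂, Ne.symm h₃])
  have i_abbca : ∀ a b c : Var, [a, b, c].Nodup → Iso S [a, b, b, c, a] := fun a b c h => by
    simp at h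
    obtain ⟨⟨h₁, h₂⟩, h₃⟩ := h
    exact hq₁.of_subst (fun d => if d = a then [.y 0] else if d = b then [.x 0] else [.t 0]) [] []
      (by simp) (by simp [h₁, h₂, h₃, Ne.symm h₁, Ne.symm h₂, Ne.symm h₃])
      (by simp [h₁, h₂, h₃, Ne.symm h₁, Ne.symm h₂, Ne.symm h₃])
      (by simp [h₁, h₂, h₃, Ne.symm h₁, Ne.symm h₂, Ne.symm h₃])
  refine nonFinitelyBased_of_invariant (fun _ w => occ w (.y 0) 0 < occ w (.x 0) 0) hUV
    ?_ ?_ ?_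
  · intro n hn
    have := row2_U hn
    omega
  · intro n hn
    have := row2_V hn
    omega
  · intro L hL
    refine ⟨L + 1, by omega, fun w w' hs hP hstep => ?_⟩
    obtain ⟨hx, hy, hp, hy0, hx0, hx1, hy1, hz⟩ := row2_U (n := L + 1) (by omega)
    have hxw := (has_aa.1 ((i_aa (.x 0)).has hs (has_aa.2 ⟨hx, by omega⟩))).1
    have hyw := (has_aa.1 ((i_aa (.y 0)).has hs (has_aa.2 ⟨hy, by omega⟩))).1
    have hpw := notMem_of_sat i_a hs hp
    have hzx : ∀ i, 1 ≤ i → i ≤ L + 1 → Has w [.z i, .t i, .x 0, .x 0, .z i] :=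
      fun i hi hin => (i_abcca _ _ _ (by simp)).has hs ((has_abcca (by simp)).2 (by
        have := hz i hi hin; omega))
    have htz : ∀ i, 1 ≤ i → i + 1 ≤ L + 1 → Has w [.t i, .z (i + 1), .z (i + 1)] :=
      fun i hi hin => (i_baa _ _ (by simp)).has hs ((has_baa (by simp)).2 (by
        have := hz i hi (by omega); have := hz (i + 1) (by omega) hin; omega))
    have hty : ∀ i, 1 ≤ i → i ≤ L + 1 → Has w [.t i, .y 0, .y 0] :=
      fun i hi hin => (i_baa _ _ (by simp)).has hs ((has_baa (by simp)).2 (by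
        have := hz i hi (by omega); omega))
    -- Otherwise `z t y y z` would appear in `w`, hence, being an isoterm, also in `U`, where the
    -- last letter is `y`.
    have hzy : ∀ i, 1 ≤ i → i ≤ L + 1 → occ w (.z i) 1 < occ w (.y 0) 1 := by
      intro i hi hin
      have h₁ := (has_abcca (by simp)).1 (hzx i hi hin)
      have h₂ := (has_baa (by simp)).1 (hty i hi hin)
      have h₃ := occ_ne (w := w) (a := .z i) (b := .y 0) (i := 1) (j := 1) (by simp)
        (by omega) (by omega)
      by_contra hcon
      have h₄ : Has w [.z i, .t i, .y 0, .y 0, .z i] := (has_abcca (by simp)).2 (by omega)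
      have h₅ := (has_abcca (by simp)).1 ((i_abcca _ _ _ (by simp)).has hs.symm h₄)
      have := hz i hi hin
      omega
    have hlt : ∀ i, 1 ≤ i → i + 1 ≤ L + 1 → occ w (.z i) 0 < occ w (.t i) 0 ∧
        occ w (.t i) 0 < occ w (.z (i + 1)) 0 := fun i hi hin => by
      have h₁ := (has_abcca (by simp)).1 (hzx i hi (by omega))
      have h₂ := (has_baa (by simp)).1 (htz i hi hin)
      omega
    obtain ⟨i, hi, hm⟩ := hstep.exists_mark i_a (fun i => occ w (.z (i + 1)) 0)
      (fun i hi => (hlt (i + 1) (by omega) (by omega)).1.trans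
        (hlt (i + 1) (by omega) (by omega)).2)
      (occ_lt_length (by
        have := (has_abcca (by simp)).1 (hzx (L + 1) (by omega) (by omega)); omega))
    have h₁ := hlt (i + 1) (by omega) (by omega)
    have h₂ := (has_abcca (by simp)).1 (hzx (i + 1) (by omega) (by omega))
    have h₃ := hzy (i + 1) (by omega) (by omega)
    obtain ⟨k, hk, hpw', hst⟩ := hm (.z (i + 1)) (.t (i + 1)) (.p 0) 0 0 hpw (by simp) (by omega)
      (by omega) le_rfl h₁.1 (by simpa using h₁.2.le) (by
        intro k' hk' j' hj' e
        by_contra hne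
        obtain rfl : k' = 1 := by omega
        obtain rfl : j' = 0 := by omega
        omega)
    obtain ⟨m₁, m₂, m₃, m₄⟩ := mark_facts (w := w) (a := .z (i + 1)) (c := .p 0) (k := 0) hpw
      (by simp) (by omega)
    have m₄0 := m₄ 0
    have e : ∀ j, occ (mark w (.z (i + 1)) 0 (.p 0)) (.x 0) j = occ w (.x 0) j ∧
        occ (mark w (.z (i + 1)) 0 (.p 0)) (.y 0) j = occ w (.y 0) j ∧
        occ (mark w' (.z (i + 1)) k (.p 0)) (.x 0) j = occ w' (.x 0) j ∧
        occ (mark w' (.z (i + 1)) k (.p 0)) (.y 0) j = occ w' (.y 0) j := fun j => by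
      simp [occ_mark_of_ne]
    have e₀ := e 0
    have e₁ := e 1
    have ex : (mark w (.z (i + 1)) 0 (.p 0)).count (.x 0) = 2 := by
      rw [count_mark_of_ne (by simp) (by simp), hxw]
    have ey : (mark w (.z (i + 1)) 0 (.p 0)).count (.y 0) = 2 := by
      rw [count_mark_of_ne (by simp) (by simp), hyw]
    simp at m₄0
    -- The linear letter here is the surviving `z (i + 1)`, not the mark; where the mark lands in
    -- `w'` is irrelevant.
    have := (has_abbca (by simp)).1 ((i_abbca (.y 0) (.x 0) (.z (i + 1)) (by simp)).has hst.sat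
      ((has_abbca (by simp)).2 (by omega)))
    omega

end Row2

/-! ### Row 4: `xytyz₁²⋯zₙ²x` -/

section Row4

variable {S : Type*} [Monoid S]

theorem up_zz {n : ℕ} :
    (∀ a, (∀ j, a ≠ Var.z j) → (lst (up (fun i => zs i * zs i) n)).count a = 0) ∧
    (1 ≤ n → (lst (up (fun i => zs i * zs i) n)).length = 2 * n) ∧
    ∀ i, 1 ≤ i → i ≤ n → (lst (up (fun i => zs i * zs i) n)).count (.z i) = 2 ∧
      occ (lst (up (fun i => zs i * zs i) n)) (.z i) 0 = 2 * (i - 1) ∧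
      occ (lst (up (fun i => zs i * zs i) n)) (.z i) 1 = 2 * (i - 1) + 1 := by
  have e : ∀ j, lst (zs j * zs j) = [.z j, .z j] := fun j => rfl
  refine ⟨fun a h₁ => ?_, fun hn => ?_, fun i hi hin => ?_⟩
  · exact count_up_of_notMem (by intro j; simp [e, h₁]) n
  · obtain ⟨n, rfl⟩ : ∃ m, n = m + 1 := ⟨n - 1, by omega⟩
    exact length_up (ℓ := 2) (fun _ => rfl) n
  · have hz : ∀ j, j ≠ i → Var.z i ∉ lst (zs j * zs j) := by
      intro j hj; simp [e, hj.symm]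
    rw [count_up hz hi hin,
      occ_up (ℓ := 2) (fun _ => rfl) hz hi hin (by simp [e]),
      occ_up (ℓ := 2) (fun _ => rfl) hz hi hin (by simp [e])]
    simp [e]

theorem row4_U {n : ℕ} (hn : 1 < n) :
    (lst (row4.U n)).count (.x 0) = 2 ∧ (lst (row4.U n)).count (.y 0) = 2 ∧
    (lst (row4.U n)).count (.t 0) = 1 ∧ (lst (row4.U n)).count (.p 0) = 0 ∧
    occ (lst (row4.U n)) (.x 0) 0 = 0 ∧ occ (lst (row4.U n)) (.y 0) 0 = 1 ∧
    occ (lst (row4.U n)) (.t 0) 0 = 2 ∧ occ (lst (row4.U n)) (.y 0) 1 = 3 ∧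
    occ (lst (row4.U n)) (.x 0) 1 = 4 + 2 * n ∧
    ∀ i, 1 ≤ i → i ≤ n → (lst (row4.U n)).count (.z i) = 2 ∧
      occ (lst (row4.U n)) (.z i) 0 = 4 + 2 * (i - 1) ∧
      occ (lst (row4.U n)) (.z i) 1 = 4 + 2 * (i - 1) + 1 := by
  obtain ⟨h₁, h₂, h₃⟩ := up_zz (n := n)
  have hx := h₁ (.x 0) (by simp)
  have hy := h₁ (.y 0) (by simp)
  have hp := h₁ (.p 0) (by simp)
  have ht := h₁ (.t 0) (by simp)
  have hl := h₂ (by omega)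
  simp only [row4, lst_mul, lst_x, lst_y, lst_t]
  refine ⟨?_, ?_, ?_, ?_, ?_, ?_, ?_, ?_, ?_, fun i hi hin => ?_⟩
  · simp [hx]
  · simp [hy]
  · simp [ht]
  · simp [hp]
  · simp [occ_append]
  · simp [occ_append]
  · simp [occ_append]
  · simp [occ_append]
  · simp [occ_append, hx, hl]
    omega
  · obtain ⟨e₁, e₂, e₃⟩ := h₃ i hi hin
    simp [occ_append, e₁, e₂, e₃]
    omega

theorem row4_V (n : ℕ) : occ (lst (row4.V n)) (.y 0) 0 < occ (lst (row4.V n)) (.x 0) 0 := by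
  simp only [row4, lst_mul, lst_x, lst_y, lst_t]
  simp

/-- The isoterm `xytytx` would fix the order of the first `x` and `y` if there were a linear letter
between the second `y` and the second `x`. The isoterm `xxyy` keeps the squares in order, and
marking the first letter of one of them supplies the linear letter. -/
theorem row4_nonFinitelyBased (hUV : ∀ n, 1 < n → Satisfies S (row4.U n) (row4.V n))
    (hW : ∀ w ∈ row4.W, IsIsoterm S w) : NonFinitelyBased S := by
  have hq₁ : Iso S [Var.x 0, .x 0, .y 0, .y 0] := (hW (x * x * y * y) (by simp [row4])).iso
  have hq₂ : Iso S [Var.x 0, .y 0, .t 1, .y 0, .t 2, .x 0] :=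
    (hW (x * y * ts 1 * y * ts 2 * x) (by simp [row4])).iso
  have i_a : Iso S [Var.x 0] :=
    hq₁.of_subst (fun c => [c]) [] [.x 0, .y 0, .y 0] (by simp) (by simp) (by simp) (by simp)
  have i_aba : ∀ a b : Var, a ≠ b → Iso S [a, b, a] := fun a b h =>
    hq₂.of_subst (fun c => if c = a then [.y 0] else [.t 1]) [.x 0] [.t 2, .x 0]
      (by simp) (by simp [h.symm]) (by simp [h.symm]) (by simp [h, h.symm])
  have i_aabb : ∀ a b : Var, a ≠ b → Iso S [a, a, b, b] := fun a b h =>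
    hq₁.of_subst (fun c => if c = a then [.x 0] else [.y 0]) [] []
      (by simp) (by simp [h.symm]) (by simp [h.symm]) (by simp [h, h.symm])
  have i_absbra : Iso S [Var.x 0, .y 0, .t 0, .y 0, .p 0, .x 0] :=
    hq₂.of_subst (fun d => if d = .t 0 then [.t 1] else if d = .p 0 then [.t 2] else [d]) [] []
      (by simp) (by simp) (by simp) (by simp)
  refine nonFinitelyBased_of_invariant (fun _ w => occ w (.x 0) 0 < occ w (.y 0) 0) hUV
    ?_ ?_ ?_
  · intro n hn
    have := row4_U hn
    omega
  · intro n hn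
    have := row4_V n
    omega
  · intro L hL
    refine ⟨L + 1, by omega, fun w w' hs hP hstep => ?_⟩
    obtain ⟨hx, hy, ht, hp, hx0, hy0, ht0, hy1, hx1, hz⟩ := row4_U (n := L + 1) (by omega)
    have hxt := (has_aba (by simp)).1 ((i_aba (.x 0) (.t 0) (by simp)).has hs
      ((has_aba (by simp)).2 (by omega)))
    have hyt := (has_aba (by simp)).1 ((i_aba (.y 0) (.t 0) (by simp)).has hs
      ((has_aba (by simp)).2 (by omega)))
    have hpw := notMem_of_sat i_a hs hp
    have hyz : ∀ i, 1 ≤ i → i ≤ L + 1 → Has w [.y 0, .y 0, .z i, .z i] :=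
      fun i hi hin => (i_aabb _ _ (by simp)).has hs ((has_aabb (by simp)).2 (by
        have := hz i hi hin; omega))
    have hzz : ∀ i, 1 ≤ i → i + 1 ≤ L + 1 → occ w (.z i) 1 < occ w (.z (i + 1)) 0 :=
      fun i hi hin => by
        have := (has_aabb (by simp)).1 ((i_aabb (.z i) (.z (i + 1)) (by simp)).has hs
          ((has_aabb (by simp)).2 (by
            have := hz i hi (by omega); have := hz (i + 1) (by omega) hin; omega)))
        omega
    -- Otherwise `x x z z` would appear in `w` and therefore in `U`.
    have hzx : ∀ i, 1 ≤ i → i ≤ L + 1 → occ w (.z i) 0 < occ w (.x 0) 1 := fun i hi hin => by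
      have h₁ := (has_aabb (by simp)).1 (hyz i hi hin)
      have h₃ := occ_ne (w := w) (a := .z i) (b := .x 0) (i := 0) (j := 1) (by simp)
        (by omega) (by omega)
      by_contra hcon
      have h₄ : Has w [.x 0, .x 0, .z i, .z i] := (has_aabb (by simp)).2 (by omega)
      have h₅ := (has_aabb (by simp)).1 ((i_aabb _ _ (by simp)).has hs.symm h₄)
      have := hz i hi hin
      omega
    obtain ⟨i, hi, hm⟩ := hstep.exists_mark i_a (fun i => occ w (.z (i + 1)) 0)
      (fun i hi => by
        have h₁ := (has_aabb (by simp)).1 (hyz (i + 1) (by omega) (by omega))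
        have := hzz (i + 1) (by omega) (by omega)
        omega)
      (occ_lt_length (by
        have := (has_aabb (by simp)).1 (hyz (L + 1) (by omega) (by omega)); omega))
    have h₁ := (has_aabb (by simp)).1 (hyz (i + 1) (by omega) (by omega))
    have h₂ := hzz (i + 1) (by omega) (by omega)
    have h₃ := hzx (i + 1) (by omega) (by omega)
    -- Both letters of the pair are `z (i + 1)`: starting from its second occurrence, the distance
    -- would be zero or negative.
    obtain ⟨k, hk, hpw', hst⟩ := hm (.z (i + 1)) (.z (i + 1)) (.p 0) 0 1 hpw (by simp) (by omega)
      (by omega) le_rfl (by omega) h₂.le (by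
        intro k' hk' j' hj' e
        by_contra hne
        obtain rfl : k' = 1 := by omega
        obtain rfl | rfl : j' = 0 ∨ j' = 1 := by omega
        · omega
        · omega)
    obtain ⟨m₁, m₂, m₃, m₄⟩ := mark_facts (w := w) (a := .z (i + 1)) (c := .p 0) (k := 0) hpw
      (by simp) (by omega)
    have e : ∀ j, occ (mark w (.z (i + 1)) 0 (.p 0)) (.x 0) j = occ w (.x 0) j ∧
        occ (mark w (.z (i + 1)) 0 (.p 0)) (.y 0) j = occ w (.y 0) j ∧
        occ (mark w (.z (i + 1)) 0 (.p 0)) (.t 0) j = occ w (.t 0) j ∧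
        occ (mark w' (.z (i + 1)) k (.p 0)) (.x 0) j = occ w' (.x 0) j ∧
        occ (mark w' (.z (i + 1)) k (.p 0)) (.y 0) j = occ w' (.y 0) j := fun j => by
      simp [occ_mark_of_ne]
    have e₀ := e 0
    have e₁ := e 1
    have ec : (mark w (.z (i + 1)) 0 (.p 0)).count (.x 0) = w.count (.x 0) ∧
        (mark w (.z (i + 1)) 0 (.p 0)).count (.y 0) = w.count (.y 0) ∧
        (mark w (.z (i + 1)) 0 (.p 0)).count (.t 0) = w.count (.t 0) := by
      simp [count_mark_of_ne]
    have := (has_absbra (by simp)).1 (i_absbra.has hst.sat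
      ((has_absbra (by simp)).2 (by omega)))
    omega

end Row4

/-! ### Rows 5 and 6: `x` and `y` around `[Zn]` -/

section Row56

variable {S : Type*} [Monoid S]

/-- The letters `x` and `y`, in this order, occur on both sides of `z₁, …, zₙ`. -/
structure Surround (n : ℕ) (w : List Var) : Prop where
  cx : w.count (.x 0) = 2
  cy : w.count (.y 0) = 2
  xy : occ w (.x 0) 0 < occ w (.y 0) 0
  xt : occ w (.x 0) 1 < occ w (.t 0) 0
  yt : occ w (.y 0) 1 < occ w (.t 0) 0
  z : ∀ i, 1 ≤ i → i ≤ n → occ w (.y 0) 0 < occ w (.z i) 0 ∧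
    occ w (.z i) 0 < occ w (.x 0) 1 ∧ occ w (.z i) 0 < occ w (.y 0) 1

/-- One argument serves both rows, since the invariant ignores the order of the second `x` and the
second `y`. A mark `p` on some first `z (i + 1)` separates the two occurrences of `x` and of `y`, so
`xypxy` or `xypyx` fixes their order. To carry the invariant to the next step, the other `z l` must
also stay inside: those before the mark by `xzpxz`, those behind it by `xpzxtz`, and likewise with
`y`. -/
theorem nonFinitelyBased_of_surround {U V : ℕ → Word}
    (hU : ∀ n, 1 < n → Surround n (lst (U n)) ∧ (lst (U n)).count (.p 0) = 0 ∧
      (lst (U n)).count (.t 0) = 1 ∧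
      (∀ i, 1 ≤ i → i ≤ n → (lst (U n)).count (.z i) = 2 ∧
        occ (lst (U n)) (.z i) 0 < occ (lst (U n)) (.t 0) 0 ∧
        occ (lst (U n)) (.t 0) 0 < occ (lst (U n)) (.z i) 1) ∧
      ∀ i j, 1 ≤ i → i < j → j ≤ n →
        occ (lst (U n)) (.z i) 0 < occ (lst (U n)) (.z j) 0 ∧
        occ (lst (U n)) (.z j) 1 < occ (lst (U n)) (.z i) 1)
    (hV : ∀ n, 1 < n → occ (lst (V n)) (.y 0) 0 < occ (lst (V n)) (.x 0) 0)
    (hUV : ∀ n, 1 < n → Satisfies S (U n) (V n))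
    (hq₁ : Iso S [Var.x 0, .t 1, .y 0, .x 0, .t 2, .y 0])
    (hq₂ : Iso S [Var.x 0, .y 0, .t 0, .x 0, .y 0])
    (hq₃ : Iso S [Var.x 0, .y 0, .t 0, .y 0, .x 0]) : NonFinitelyBased S := by
  have i_a : Iso S [Var.x 0] :=
    hq₂.of_subst (fun c => [c]) [] [.y 0, .t 0, .x 0, .y 0] (by simp) (by simp) (by simp) (by simp)
  have i_ab : ∀ a b : Var, a ≠ b → Iso S [a, b] := fun a b h =>
    hq₂.of_subst (fun c => if c = a then [.x 0] else [.y 0]) [] [.t 0, .x 0, .y 0]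
      (by simp) (by simp [h.symm]) (by simp [h.symm]) (by simp [h, h.symm])
  have i_aba : ∀ a b : Var, a ≠ b → Iso S [a, b, a] := fun a b h =>
    hq₂.of_subst (fun c => if c = a then [.x 0, .y 0] else [.t 0]) [] []
      (by simp) (by simp [h.symm]) (by simp [h.symm]) (by simp [h, h.symm])
  have i_abac : ∀ a b c : Var, [a, b, c].Nodup → Iso S [a, b, a, c] := fun a b c h => by
    simp at h
    obtain ⟨⟨h₁, h₂⟩, h₃⟩ := h
    exact hq₁.of_subst
      (fun d => if d = a then [.x 0] else if d = b then [.t 1, .y 0] else [.t 2, .y 0]) [] []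
      (by simp) (by simp [h₁, h₂, h₃, Ne.symm h₁, Ne.symm h₂, Ne.symm h₃])
      (by simp [h₁, h₂, h₃, Ne.symm h₁, Ne.symm h₂, Ne.symm h₃])
      (by simp [h₁, h₂, h₃, Ne.symm h₁, Ne.symm h₂, Ne.symm h₃])
  have i_absab : ∀ a b s : Var, [a, b, s].Nodup → Iso S [a, b, s, a, b] := fun a b c h => by
    simp at h
    obtain ⟨⟨h₁, h₂⟩, h₃⟩ := h
    exact hq₂.of_subst (fun d => if d = a then [.x 0] else if d = b then [.y 0] else [.t 0]) [] []
      (by simp) (by simp [h₁, h₂, h₃, Ne.symm h₁, Ne.symm h₂, Ne.symm h₃])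
      (by simp [h₁, h₂, h₃, Ne.symm h₁, Ne.symm h₂, Ne.symm h₃])
      (by simp [h₁, h₂, h₃, Ne.symm h₁, Ne.symm h₂, Ne.symm h₃])
  have i_absba : ∀ a b s : Var, [a, b, s].Nodup → Iso S [a, b, s, b, a] := fun a b c h => by
    simp at h
    obtain ⟨⟨h₁, h₂⟩, h₃⟩ := h
    exact hq₃.of_subst (fun d => if d = a then [.x 0] else if d = b then [.y 0] else [.t 0]) [] []
      (by simp) (by simp [h₁, h₂, h₃, Ne.symm h₁, Ne.symm h₂, Ne.symm h₃])
      (by simp [h₁, h₂, h₃, Ne.symm h₁, Ne.symm h₂, Ne.symm h₃])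
      (by simp [h₁, h₂, h₃, Ne.symm h₁, Ne.symm h₂, Ne.symm h₃])
  have i_asbarb : ∀ a b s r : Var, [a, s, b, r].Nodup → Iso S [a, s, b, a, r, b] := by
    intro a b s r h
    simp at h
    obtain ⟨⟨h₁, h₂, h₃⟩, ⟨h₄, h₅⟩, h₆⟩ := h
    exact hq₁.of_subst (fun d => if d = a then [.x 0] else if d = s then [.t 1] else
        if d = b then [.y 0] else [.t 2]) [] []
      (by simp) (by simp [h₁, h₂, h₃, h₄, h₅, h₆, Ne.symm h₁, Ne.symm h₂, Ne.symm h₃,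
        Ne.symm h₄, Ne.symm h₅, Ne.symm h₆])
      (by simp [h₁, h₂, h₃, h₄, h₅, h₆, Ne.symm h₁, Ne.symm h₂, Ne.symm h₃,
        Ne.symm h₄, Ne.symm h₅, Ne.symm h₆])
      (by simp [h₁, h₂, h₃, h₄, h₅, h₆, Ne.symm h₁, Ne.symm h₂, Ne.symm h₃,
        Ne.symm h₄, Ne.symm h₅, Ne.symm h₆])
  have key : ∀ n, 1 < n → ∀ w, Sat S (lst (U n)) w → Var.p 0 ∉ w ∧
      (∀ i, 1 ≤ i → i ≤ n → Has w [.z i, .t 0, .z i]) ∧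
      ∀ i j, 1 ≤ i → i < j → j ≤ n → Has w [.z i, .z j, .t 0, .z j, .z i] := by
    intro n hn w hs
    obtain ⟨-, hp, ht, hz, hzz⟩ := hU n hn
    refine ⟨notMem_of_sat i_a hs hp, fun i hi hin => ?_, fun i j hi hij hj => ?_⟩
    · exact (i_aba _ _ (by simp)).has hs ((has_aba (by simp)).2 (by
        have := hz i hi hin; omega))
    · have hne : i ≠ j := by omega
      refine (i_absba _ _ _ (by simpa using hne)).has hs ((has_absba (by simpa using hne)).2 ?_)
      have := hz i hi (by omega)
      have := hz j (by omega) hj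
      have := hzz i j hi hij hj
      omega
  refine nonFinitelyBased_of_invariant Surround hUV (fun n hn => (hU n hn).1) ?_ ?_
  · intro n hn h
    have := hV n hn
    have := h.xy
    omega
  · intro L hL
    refine ⟨L + 1, by omega, fun w w' hs hP hstep => ?_⟩
    obtain ⟨hp, hz, hzz⟩ := key _ (by omega) w hs
    obtain ⟨hp', hz', hzz'⟩ := key _ (by omega) w' (hs.trans hstep.sat)
    have hzz0 : ∀ i j, 1 ≤ i → i < j → j ≤ L + 1 → occ w (.z i) 0 < occ w (.z j) 0 ∧
        occ w (.z j) 1 < occ w (.z i) 1 := by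
      intro i j hi hij hj
      have hne : i ≠ j := by omega
      have := (has_absba (by simpa using hne)).1 (hzz i j hi hij hj)
      omega
    have hzz0' : ∀ i j, 1 ≤ i → i < j → j ≤ L + 1 → occ w' (.z i) 0 < occ w' (.z j) 0 := by
      intro i j hi hij hj
      have hne : i ≠ j := by omega
      have := (has_absba (by simpa using hne)).1 (hzz' i j hi hij hj)
      omega
    have hz0 := fun i hi hin => (has_aba (by simp)).1 (hz i hi hin)
    have hz0' := fun i hi hin => (has_aba (by simp)).1 (hz' i hi hin)
    obtain ⟨i, hi, hm⟩ := hstep.exists_mark i_a (fun i => occ w (.z (i + 1)) 0)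
      (fun i hi => (hzz0 (i + 1) (i + 2) (by omega) (by omega) (by omega)).1)
      (occ_lt_length (by have := hz0 (L + 1) (by omega) (by omega); omega))
    have h₁ := hz0 (i + 1) (by omega) (by omega)
    have h₁' := hz0' (i + 1) (by omega) (by omega)
    have h₂ := hz0 (i + 2) (by omega) (by omega)
    have h₃ := hzz0 (i + 1) (i + 2) (by omega) (by omega) (by omega)
    -- After `t` the `z` come in reverse order, so the second `z (i + 1)` has no `z (i + 2)` behind
    -- it.
    obtain ⟨k, hk, -, hst⟩ := hm (.z (i + 1)) (.z (i + 2)) (.p 0) 0 0 hp (by simp) (by omega)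
      (by omega) le_rfl h₃.1 le_rfl (by
        intro k' hk' j' hj' e
        by_contra hne
        obtain rfl : k' = 1 := by omega
        obtain rfl | rfl : j' = 0 ∨ j' = 1 := by omega
        · omega
        · omega)
    obtain ⟨m₁, m₂, m₃, m₄⟩ := mark_facts (w := w) (a := .z (i + 1)) (c := .p 0) (k := 0) hp
      (by simp) (by omega)
    obtain ⟨m₁', m₂', m₃', m₄'⟩ := mark_facts (w := w') (a := .z (i + 1)) (c := .p 0) hp'
      (by simp) hk
    have m₄0 := m₄ 0
    have m₄0' := m₄' 0
    simp only [lt_irrefl, if_false, zero_add] at m₄0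
    have hk0 : k = 0 := by
      by_contra hk0
      obtain rfl : k = 1 := by omega
      have := (has_ab (by simp)).1 ((i_ab (.p 0) (.z (i + 1)) (by simp)).has hst.sat
        ((has_ab (by simp)).2 (by omega)))
      simp at m₄0'
      omega
    subst hk0
    have hs₁ := hst.sat
    set w₁ := mark w (.z (i + 1)) 0 (.p 0) with hw₁
    set w₁' := mark w' (.z (i + 1)) 0 (.p 0) with hw₁'
    have e : ∀ d, d ≠ Var.z (i + 1) → d ≠ .p 0 → (w₁.count d = w.count d ∧
        w₁'.count d = w'.count d) ∧ (occ w₁ d 0 = occ w d 0 ∧ occ w₁' d 0 = occ w' d 0) ∧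
        occ w₁ d 1 = occ w d 1 ∧ occ w₁' d 1 = occ w' d 1 := fun d h₁ h₂ =>
      ⟨⟨count_mark_of_ne h₁ h₂, count_mark_of_ne h₁ h₂⟩,
        ⟨occ_mark_of_ne h₁ h₂ _, occ_mark_of_ne h₁ h₂ _⟩,
        occ_mark_of_ne h₁ h₂ _, occ_mark_of_ne h₁ h₂ _⟩
    clear_value w₁ w₁'
    obtain ⟨cx, cy, hxy, hxt, hyt, hxyz⟩ := hP
    have hi₁ := hxyz (i + 1) (by omega) (by omega)
    have ex := e (.x 0) (by simp) (by simp)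
    have ey := e (.y 0) (by simp) (by simp)
    have et := e (.t 0) (by simp) (by simp)
    have hX : w'.count (.x 0) = 2 ∧ w'.count (.y 0) = 2 ∧ occ w' (.x 0) 0 < occ w' (.y 0) 0 ∧
        occ w' (.y 0) 0 < occ w' (.z (i + 1)) 0 ∧ occ w' (.z (i + 1)) 0 < occ w' (.x 0) 1 ∧
        occ w' (.z (i + 1)) 0 < occ w' (.y 0) 1 := by
      -- The order of the second occurrences may be either; both resulting words are isoterms.
      have hne := occ_ne (w := w) (a := .x 0) (b := .y 0) (i := 1) (j := 1) (by simp)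
        (by omega) (by omega)
      rcases lt_or_gt_of_ne hne with h | h
      · have := (has_absab (by simp)).1 ((i_absab (.x 0) (.y 0) (.p 0) (by simp)).has hs₁
          ((has_absab (by simp)).2 (by omega)))
        omega
      · have := (has_absba (by simp)).1 ((i_absba (.x 0) (.y 0) (.p 0) (by simp)).has hs₁
          ((has_absba (by simp)).2 (by omega)))
        omega
    have hXt := (has_abac (by simp)).1 ((i_abac (.x 0) (.p 0) (.t 0) (by simp)).has hs₁
      ((has_abac (by simp)).2 (by omega)))
    have hYt := (has_abac (by simp)).1 ((i_abac (.y 0) (.p 0) (.t 0) (by simp)).has hs₁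
      ((has_abac (by simp)).2 (by omega)))
    refine ⟨by omega, by omega, by omega, by omega, by omega, fun l hl hln => ?_⟩
    rcases lt_trichotomy l (i + 1) with hli | rfl | hli
    · have hz₁ := hz0 l hl hln
      have hz₂ := hxyz l hl hln
      have hz₃ := hzz0 l (i + 1) hl hli (by omega)
      have el := e (.z l) (by simp; omega) (by simp)
      have a₁ := (has_absab (by simp)).1 ((i_absab (.x 0) (.z l) (.p 0) (by simp)).has hs₁
        ((has_absab (by simp)).2 (by omega)))
      have a₂ := (has_absab (by simp)).1 ((i_absab (.y 0) (.z l) (.p 0) (by simp)).has hs₁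
        ((has_absab (by simp)).2 (by omega)))
      omega
    · omega
    · have hz₁ := hz0 l hl hln
      have hz₂ := hxyz l hl hln
      have hz₃ := hzz0 (i + 1) l (by omega) hli (by omega)
      have hz₄ := hzz0' (i + 1) l (by omega) hli (by omega)
      have el := e (.z l) (by simp; omega) (by simp)
      have a₁ := (has_asbarb (by simp)).1 ((i_asbarb (.x 0) (.z l) (.p 0) (.t 0) (by simp)).has hs₁
        ((has_asbarb (by simp)).2 (by omega)))
      have a₂ := (has_asbarb (by simp)).1 ((i_asbarb (.y 0) (.z l) (.p 0) (.t 0) (by simp)).has hs₁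
        ((has_asbarb (by simp)).2 (by omega)))
      omega

theorem row5_nonFinitelyBased (hUV : ∀ n, 1 < n → Satisfies S (row5.U n) (row5.V n))
    (hW : ∀ w ∈ row5.W, IsIsoterm S w) : NonFinitelyBased S := by
  refine nonFinitelyBased_of_surround (fun n hn => ?_) (fun n hn => ?_) hUV
    (hW (x * ts 1 * y * x * ts 2 * y) (by simp [row5])).iso
    (hW (x * y * t * x * y) (by simp [row5])).iso (hW (x * y * t * y * x) (by simp [row5])).iso
  · have hl := length_up_of Var.z (n := n) (by omega)
    have hu := fun i hi hin => count_up_of z_injective (i := i) (n := n) hi hin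
    have hd := fun i hi hin => count_down_of z_injective (i := i) (n := n) hi hin
    have ou := fun i hi hin => occ_up_of z_injective (i := i) (n := n) hi hin
    have od := fun i hi hin => occ_down_of z_injective (i := i) (n := n) hi hin
    simp only [row5, lst_mul, lst_x, lst_y, lst_t, zs_eq]
    refine ⟨⟨?_, ?_, ?_, ?_, ?_, fun i hi hin => ?_⟩, ?_, ?_, fun i hi hin => ?_,
      fun i j hi hij hj => ?_⟩
    · simp [count_up_of_ne, count_down_of_ne]
    · simp [count_up_of_ne, count_down_of_ne]
    · simp [occ_append]
    · simp [occ_append, count_up_of_ne, count_down_of_ne, hl]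
    · simp [occ_append, count_up_of_ne, count_down_of_ne, hl]
    · simp [occ_append, count_up_of_ne, count_down_of_ne, hl, hu i hi hin, ou i hi hin]
      omega
    · simp [count_up_of_ne, count_down_of_ne]
    · simp [count_up_of_ne, count_down_of_ne]
    · simp [occ_append, count_up_of_ne, count_down_of_ne, hl, hu i hi hin, ou i hi hin,
        hd i hi hin, od i hi hin]
      omega
    · have hi' : i ≤ n := by omega
      have hj' : 1 ≤ j := by omega
      simp [occ_append, count_up_of_ne, count_down_of_ne, hl, hu i hi hi', ou i hi hi',
        hd i hi hi', od i hi hi', hu j hj' hj, ou j hj' hj, hd j hj' hj, od j hj' hj]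
      omega
  · simp only [row5, lst_mul, lst_x, lst_y, lst_t]
    simp

theorem row6_nonFinitelyBased (hUV : ∀ n, 1 < n → Satisfies S (row6.U n) (row6.V n))
    (hW : ∀ w ∈ row6.W, IsIsoterm S w) : NonFinitelyBased S := by
  refine nonFinitelyBased_of_surround (fun n hn => ?_) (fun n hn => ?_) hUV
    (hW (x * ts 1 * y * x * ts 2 * y) (by simp [row6])).iso
    (hW (x * y * t * x * y) (by simp [row6])).iso (hW (x * y * t * y * x) (by simp [row6])).iso
  · have hl := length_up_of Var.z (n := n) (by omega)
    have hu := fun i hi hin => count_up_of z_injective (i := i) (n := n) hi hin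
    have hd := fun i hi hin => count_down_of z_injective (i := i) (n := n) hi hin
    have ou := fun i hi hin => occ_up_of z_injective (i := i) (n := n) hi hin
    have od := fun i hi hin => occ_down_of z_injective (i := i) (n := n) hi hin
    simp only [row6, lst_mul, lst_x, lst_y, lst_t, zs_eq]
    refine ⟨⟨?_, ?_, ?_, ?_, ?_, fun i hi hin => ?_⟩, ?_, ?_, fun i hi hin => ?_,
      fun i j hi hij hj => ?_⟩
    · simp [count_up_of_ne, count_down_of_ne]
    · simp [count_up_of_ne, count_down_of_ne]
    · simp [occ_append]
    · simp [occ_append, count_up_of_ne, count_down_of_ne, hl]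
    · simp [occ_append, count_up_of_ne, count_down_of_ne, hl]
    · simp [occ_append, count_up_of_ne, count_down_of_ne, hl, hu i hi hin, ou i hi hin]
      omega
    · simp [count_up_of_ne, count_down_of_ne]
    · simp [count_up_of_ne, count_down_of_ne]
    · simp [occ_append, count_up_of_ne, count_down_of_ne, hl, hu i hi hin, ou i hi hin,
        hd i hi hin, od i hi hin]
      omega
    · have hi' : i ≤ n := by omega
      have hj' : 1 ≤ j := by omega
      simp [occ_append, count_up_of_ne, count_down_of_ne, hl, hu i hi hi', ou i hi hi',
        hd i hi hi', od i hi hi', hu j hj' hj, ou j hj' hj, hd j hj' hj, od j hj' hj]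
      omega
  · simp only [row6, lst_mul, lst_x, lst_y, lst_t]
    simp

end Row56

/-! ### Row 7: `[Xn][nX][Yn][nY]` -/

section Row7

variable {S : Type*} [Monoid S]

theorem row7_U {n : ℕ} (hn : 1 < n) :
    (lst (row7.U n)).count (.t 0) = 0 ∧ (lst (row7.U n)).count (.p 0) = 0 ∧
    ∀ i, 1 ≤ i → i ≤ n → (lst (row7.U n)).count (.x i) = 2 ∧ (lst (row7.U n)).count (.y i) = 2 ∧
      occ (lst (row7.U n)) (.x i) 0 = i - 1 ∧ occ (lst (row7.U n)) (.x i) 1 = n + (n - i) ∧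
      occ (lst (row7.U n)) (.y i) 0 = 2 * n + (i - 1) ∧
      occ (lst (row7.U n)) (.y i) 1 = 3 * n + (n - i) := by
  have hl := length_up_of Var.x (n := n) (by omega)
  have hl' := length_down_of Var.x (n := n) (by omega)
  have hl'' := length_up_of Var.y (n := n) (by omega)
  simp only [row7, lst_mul, xs_eq, ys_eq]
  refine ⟨?_, ?_, fun i hi hin => ?_⟩
  · simp [count_up_of_ne, count_down_of_ne]
  · simp [count_up_of_ne, count_down_of_ne]
  · have h₁ := count_up_of y_injective hi hin
    have h₂ := count_down_of y_injective hi hin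
    have h₃ := occ_up_of y_injective hi hin
    have h₄ := occ_down_of y_injective hi hin
    have h₅ := count_up_of x_injective hi hin
    have h₆ := count_down_of x_injective hi hin
    have h₇ := occ_up_of x_injective hi hin
    have h₈ := occ_down_of x_injective hi hin
    simp [occ_append, count_up_of_ne, count_down_of_ne, h₁, h₂, h₃, h₄, h₅, h₆, h₇, h₈, hl, hl',
      hl'']
    omega

theorem row7_V {n : ℕ} (hn : 1 < n) :
    occ (lst (row7.V n)) (.y 1) 0 < occ (lst (row7.V n)) (.x 1) 1 := by
  have hl := length_up_of Var.y (n := n) (by omega)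
  have hl' := length_down_of Var.y (n := n) (by omega)
  simp only [row7, lst_mul, xs_eq, ys_eq]
  have h₁ := count_up_of y_injective le_rfl hn.le
  have h₃ := occ_up_of y_injective le_rfl hn.le
  have h₅ := count_up_of x_injective le_rfl hn.le
  simp [occ_append, count_up_of_ne, count_down_of_ne, h₁, h₃, h₅, hl, hl']
  omega

/-- By `xyyx` the `x i` stay nested in `x 1` and the `y i` in `y 1`. Two markings put a linear
letter between the two `x 1` and another between the two `y 1`; then `xtxyty` shows that `x 1` still
ends before `y 1` begins. -/
theorem row7_nonFinitelyBased (hUV : ∀ n, 1 < n → Satisfies S (row7.U n) (row7.V n))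
    (hW : ∀ w ∈ row7.W, IsIsoterm S w) : NonFinitelyBased S := by
  have hq₁ : Iso S [Var.x 0, .t 1, .x 0, .y 0, .t 2, .y 0] :=
    (hW (x * ts 1 * x * y * ts 2 * y) (by simp [row7])).iso
  have hq₂ : Iso S [Var.x 0, .y 0, .y 0, .x 0] :=
    (hW (x * y * y * x) (by simp [row7])).iso
  have i_a : Iso S [Var.x 0] :=
    hq₂.of_subst (fun c => [c]) [] [.y 0, .y 0, .x 0] (by simp) (by simp) (by simp) (by simp)
  have i_abba : ∀ a b : Var, a ≠ b → Iso S [a, b, b, a] := fun a b h =>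
    hq₂.of_subst (fun c => if c = a then [.x 0] else [.y 0]) [] []
      (by simp) (by simp [h.symm]) (by simp [h.symm]) (by simp [h, h.symm])
  have i_asabrb : Iso S [Var.x 1, .t 0, .x 1, .y 1, .p 0, .y 1] :=
    hq₁.of_subst (fun d => if d = .x 1 then [.x 0] else if d = .t 0 then [.t 1] else
      if d = .y 1 then [.y 0] else [.t 2]) [] [] (by simp) (by simp) (by simp) (by simp)
  refine nonFinitelyBased_of_invariant (fun _ w => occ w (.x 1) 1 < occ w (.y 1) 0) hUV
    ?_ ?_ ?_
  · intro n hn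
    have := (row7_U hn).2.2 1 le_rfl hn.le
    omega
  · intro n hn
    have := row7_V hn
    omega
  · intro L hL
    refine ⟨L + 2, by omega, fun w w' hs hP hstep => ?_⟩
    obtain ⟨ht, hp, hxy⟩ := row7_U (n := L + 2) (by omega)
    have htw := notMem_of_sat i_a hs ht
    have hpw := notMem_of_sat i_a hs hp
    have hxx : ∀ i j, 1 ≤ i → i < j → j ≤ L + 2 →
        (w.count (Var.x i) = 2 ∧ w.count (Var.x j) = 2) ∧
        occ w (.x i) 0 < occ w (.x j) 0 ∧ occ w (.x j) 0 < occ w (.x j) 1 ∧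
          occ w (.x j) 1 < occ w (.x i) 1 := fun i j hi hij hj => by
      have hne : i ≠ j := by omega
      refine (has_abba (by simpa using hne)).1
        ((i_abba _ _ (by simpa using hne)).has hs ((has_abba (by simpa using hne)).2 ?_))
      have := hxy i hi (by omega)
      have := hxy j (by omega) hj
      omega
    have hyy : ∀ i j, 1 ≤ i → i < j → j ≤ L + 2 →
        (w.count (Var.y i) = 2 ∧ w.count (Var.y j) = 2) ∧
        occ w (.y i) 0 < occ w (.y j) 0 ∧ occ w (.y j) 0 < occ w (.y j) 1 ∧
          occ w (.y j) 1 < occ w (.y i) 1 := fun i j hi hij hj => by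
      have hne : i ≠ j := by omega
      refine (has_abba (by simpa using hne)).1
        ((i_abba _ _ (by simpa using hne)).has hs ((has_abba (by simpa using hne)).2 ?_))
      have := hxy i hi (by omega)
      have := hxy j (by omega) hj
      omega
    -- The positions start with `x 2`, so that `x 1` itself is never marked.
    obtain ⟨i, hi, hm⟩ := hstep.exists_mark i_a (fun i => occ w (.x (i + 2)) 0)
      (fun i hi => (hxx (i + 2) (i + 3) (by omega) (by omega) (by omega)).2.1)
      (occ_lt_length (by
        have := hxx 1 (L + 2) (by omega) (by omega) (by omega); omega))
    have h₁ := hxx (i + 2) (i + 3) (by omega) (by omega) (by omega)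
    have h₁₁ := hxx 1 (i + 2) (by omega) (by omega) (by omega)
    obtain ⟨k, hk, -, hst⟩ := hm (.x (i + 2)) (.x (i + 3)) (.t 0) 0 0 htw (by simp) (by omega)
      (by omega) le_rfl h₁.2.1 le_rfl (by
        intro k' hk' j' hj' e
        by_contra hne
        obtain rfl : k' = 1 := by omega
        obtain rfl | rfl : j' = 0 ∨ j' = 1 := by omega
        · omega
        · omega)
    obtain ⟨m₁, m₂, -, -⟩ := mark_facts (w := w) (a := .x (i + 2)) (c := .t 0) (k := 0) htw
      (by simp) (by omega)
    have e : ∀ d, d ≠ Var.x (i + 2) → d ≠ .t 0 → ∀ j,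
        (mark w (.x (i + 2)) 0 (.t 0)).count d = w.count d ∧
        occ (mark w (.x (i + 2)) 0 (.t 0)) d j = occ w d j ∧
        occ (mark w' (.x (i + 2)) k (.t 0)) d j = occ w' d j := fun d h₁ h₂ j =>
      ⟨count_mark_of_ne h₁ h₂, occ_mark_of_ne h₁ h₂ _, occ_mark_of_ne h₁ h₂ _⟩
    have hpw₁ : Var.p 0 ∉ mark w (.x (i + 2)) 0 (.t 0) := not_mem_mark hpw (by simp)
    set w₁ := mark w (.x (i + 2)) 0 (.t 0) with hw₁
    set w₁' := mark w' (.x (i + 2)) k (.t 0) with hw₁'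
    clear_value w₁ w₁'
    have ey : ∀ l j, w₁.count (.y l) = w.count (.y l) ∧ occ w₁ (.y l) j = occ w (.y l) j :=
      fun l j => ⟨(e (.y l) (by simp) (by simp) j).1, (e (.y l) (by simp) (by simp) j).2.1⟩
    -- The marked words form a step with the same bound `L`, so they can be marked again.
    obtain ⟨i', hi', hm'⟩ := hst.exists_mark i_a (fun i => occ w₁ (.y (i + 2)) 0)
      (fun i hi => by
        have := (hyy (i + 2) (i + 3) (by omega) (by omega) (by omega)).2.1
        have := ey (i + 2) 0
        have := ey (i + 3) 0
        show occ w₁ (.y (i + 2)) 0 < occ w₁ (.y (i + 3)) 0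
        omega)
      (occ_lt_length (by
        have := hyy 1 (L + 2) (by omega) (by omega) (by omega)
        have := ey (L + 2) 0
        omega))
    have h₂ := hyy (i' + 2) (i' + 3) (by omega) (by omega) (by omega)
    have h₂₁ := hyy 1 (i' + 2) (by omega) (by omega) (by omega)
    have e₁ := ey (i' + 2) 0
    have e₂ := ey (i' + 2) 1
    have e₃ := ey (i' + 3) 0
    have e₄ := ey (i' + 3) 1
    obtain ⟨k', hk', -, hst'⟩ := hm' (.y (i' + 2)) (.y (i' + 3)) (.p 0) 0 0 hpw₁ (by simp)
      (by omega) (by omega) le_rfl (by omega) le_rfl (by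
        intro k' hk' j' hj' e
        by_contra hne
        obtain rfl : k' = 1 := by omega
        obtain rfl | rfl : j' = 0 ∨ j' = 1 := by omega
        · omega
        · omega)
    obtain ⟨m₁', m₂', -, -⟩ := mark_facts (w := w₁) (a := .y (i' + 2)) (c := .p 0) (k := 0) hpw₁
      (by simp) (by omega)
    have e' : ∀ d, d ≠ Var.y (i' + 2) → d ≠ .p 0 → ∀ j,
        (mark w₁ (.y (i' + 2)) 0 (.p 0)).count d = w₁.count d ∧
        occ (mark w₁ (.y (i' + 2)) 0 (.p 0)) d j = occ w₁ d j ∧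
        occ (mark w₁' (.y (i' + 2)) k' (.p 0)) d j = occ w₁' d j := fun d h₁ h₂ j =>
      ⟨count_mark_of_ne h₁ h₂, occ_mark_of_ne h₁ h₂ _, occ_mark_of_ne h₁ h₂ _⟩
    have := hst'.sat
    set w₂ := mark w₁ (.y (i' + 2)) 0 (.p 0) with hw₂
    set w₂' := mark w₁' (.y (i' + 2)) k' (.p 0) with hw₂'
    clear_value w₂ w₂'
    have a₁ := e (.x 1) (by simp) (by simp) 0
    have a₂ := e (.x 1) (by simp) (by simp) 1
    have a₃ := e (.y 1) (by simp) (by simp) 0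
    have a₄ := e (.y 1) (by simp) (by simp) 1
    have b₁ := e' (.x 1) (by simp) (by simp) 0
    have b₂ := e' (.x 1) (by simp) (by simp) 1
    have b₃ := e' (.y 1) (by simp) (by simp) 0
    have b₄ := e' (.y 1) (by simp) (by simp) 1
    have b₅ := e' (.t 0) (by simp) (by simp) 0
    have := (has_asabrb (by simp)).1 (i_asabrb.has this ((has_asabrb (by simp)).2 (by omega)))
    omega

end Row7

/-! ### Row 3: interlaced blocks with separated letters -/

section Row3

variable {S : Type*} [Monoid S]

theorem up_pair {g h : ℕ → Var} (hg : Function.Injective g) (hh : Function.Injective h)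
    (hgh : ∀ i j, g i ≠ h j) {n : ℕ} {f : ℕ → Word} (e : ∀ j, lst (f j) = [g j, h j]) :
    (∀ a, (∀ j, a ≠ g j) → (∀ j, a ≠ h j) → (lst (up f n)).count a = 0) ∧
    (1 ≤ n → (lst (up f n)).length = 2 * n) ∧
    ∀ i, 1 ≤ i → i ≤ n → ((lst (up f n)).count (g i) = 1 ∧ (lst (up f n)).count (h i) = 1) ∧
      occ (lst (up f n)) (g i) 0 = 2 * (i - 1) ∧
      occ (lst (up f n)) (h i) 0 = 2 * (i - 1) + 1 := by
  refine ⟨fun a h₁ h₂ => ?_, fun hn => ?_, fun i hi hin => ?_⟩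
  · exact count_up_of_notMem (by intro j; simp [e, h₁, h₂]) n
  · obtain ⟨n, rfl⟩ : ∃ m, n = m + 1 := ⟨n - 1, by omega⟩
    exact length_up (ℓ := 2) (fun _ => by simp [e]) n
  · have hz : ∀ j, j ≠ i → g i ∉ lst (f j) := by
      intro j hj; simp [e, hj.symm, hg.eq_iff, hgh]
    have ht : ∀ j, j ≠ i → h i ∉ lst (f j) := by
      intro j hj; simp [e, hj.symm, hh.eq_iff, (hgh _ _).symm]
    rw [count_up hz hi hin, count_up ht hi hin,
      occ_up (ℓ := 2) (fun _ => by simp [e]) hz hi hin (by simp [e]),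
      occ_up (ℓ := 2) (fun _ => by simp [e]) ht hi hin (by simp [e])]
    simp [e, hgh, (hgh _ _).symm]

theorem ZPt_facts (n : ℕ) :
    (∀ i, (lst (ZPt n)).count (.x i) = 0 ∧ (lst (ZPt n)).count (.y i) = 0 ∧
      (lst (ZPt n)).count (.q i) = 0 ∧ (lst (ZPt n)).count (.r i) = 0 ∧
      (lst (ZPt n)).count (.t (4 * i + 2)) = 0 ∧ (lst (ZPt n)).count (.t (4 * i + 3)) = 0) ∧
    (1 ≤ n → (lst (ZPt n)).length = 4 * n) ∧
    ∀ i, 1 ≤ i → i ≤ n → ((lst (ZPt n)).count (.z i) = 1 ∧ (lst (ZPt n)).count (.p i) = 1 ∧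
      (lst (ZPt n)).count (.t (4 * i)) = 1 ∧ (lst (ZPt n)).count (.t (4 * i + 1)) = 1) ∧
      occ (lst (ZPt n)) (.z i) 0 = 4 * (i - 1) ∧
      occ (lst (ZPt n)) (.t (4 * i)) 0 = 4 * (i - 1) + 1 ∧
      occ (lst (ZPt n)) (.p i) 0 = 4 * (i - 1) + 2 ∧
      occ (lst (ZPt n)) (.t (4 * i + 1)) 0 = 4 * (i - 1) + 3 := by
  have e : ∀ j, lst (zs j * ts (4 * j) * ps j * ts (4 * j + 1)) =
    [.z j, .t (4 * j), .p j, .t (4 * j + 1)] := fun j => rfl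
  unfold ZPt
  refine ⟨fun i => ⟨?_, ?_, ?_, ?_, ?_, ?_⟩, fun hn => ?_, fun i hi hin => ?_⟩
  · exact count_up_of_notMem (by intro j; simp [e]) n
  · exact count_up_of_notMem (by intro j; simp [e]) n
  · exact count_up_of_notMem (by intro j; simp [e]) n
  · exact count_up_of_notMem (by intro j; simp [e]) n
  · exact count_up_of_notMem (by intro j; simp [e]; omega) n
  · exact count_up_of_notMem (by intro j; simp [e]; omega) n
  · obtain ⟨n, rfl⟩ : ∃ m, n = m + 1 := ⟨n - 1, by omega⟩
    exact length_up (ℓ := 4) (fun _ => rfl) n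
  · have h₁ : ∀ j, j ≠ i → Var.z i ∉ lst (zs j * ts (4 * j) * ps j * ts (4 * j + 1)) := by
      intro j hj; simp [e, hj.symm]
    have h₂ : ∀ j, j ≠ i → Var.p i ∉ lst (zs j * ts (4 * j) * ps j * ts (4 * j + 1)) := by
      intro j hj; simp [e, hj.symm]
    have h₃ : ∀ j, j ≠ i → Var.t (4 * i) ∉ lst (zs j * ts (4 * j) * ps j * ts (4 * j + 1)) := by
      intro j hj; simp [e]; omega
    have h₄ : ∀ j, j ≠ i → Var.t (4 * i + 1) ∉
        lst (zs j * ts (4 * j) * ps j * ts (4 * j + 1)) := by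
      intro j hj; simp [e]; omega
    rw [count_up h₁ hi hin, count_up h₂ hi hin, count_up h₃ hi hin, count_up h₄ hi hin,
      occ_up (ℓ := 4) (fun _ => rfl) h₁ hi hin (by simp [e]),
      occ_up (ℓ := 4) (fun _ => rfl) h₂ hi hin (by simp [e]),
      occ_up (ℓ := 4) (fun _ => rfl) h₃ hi hin (by simp [e]),
      occ_up (ℓ := 4) (fun _ => rfl) h₄ hi hin (by simp [e])]
    simp [e]

theorem tQR_facts (n : ℕ) :
    (∀ i, (lst (tQR n)).count (.x i) = 0 ∧ (lst (tQR n)).count (.y i) = 0 ∧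
      (lst (tQR n)).count (.z i) = 0 ∧ (lst (tQR n)).count (.p i) = 0 ∧
      (lst (tQR n)).count (.t (4 * i)) = 0 ∧ (lst (tQR n)).count (.t (4 * i + 1)) = 0) ∧
    ∀ i, 1 ≤ i → i ≤ n → ((lst (tQR n)).count (.q i) = 1 ∧ (lst (tQR n)).count (.r i) = 1 ∧
      (lst (tQR n)).count (.t (4 * i + 2)) = 1 ∧ (lst (tQR n)).count (.t (4 * i + 3)) = 1) ∧
      occ (lst (tQR n)) (.t (4 * i + 2)) 0 = 4 * (i - 1) ∧
      occ (lst (tQR n)) (.q i) 0 = 4 * (i - 1) + 1 ∧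
      occ (lst (tQR n)) (.t (4 * i + 3)) 0 = 4 * (i - 1) + 2 ∧
      occ (lst (tQR n)) (.r i) 0 = 4 * (i - 1) + 3 := by
  have e : ∀ j, lst (ts (4 * j + 2) * qs j * ts (4 * j + 3) * rs j) =
    [.t (4 * j + 2), .q j, .t (4 * j + 3), .r j] := fun j => rfl
  unfold tQR
  refine ⟨fun i => ⟨?_, ?_, ?_, ?_, ?_, ?_⟩, fun i hi hin => ?_⟩
  · exact count_up_of_notMem (by intro j; simp [e]) n
  · exact count_up_of_notMem (by intro j; simp [e]) n
  · exact count_up_of_notMem (by intro j; simp [e]) n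
  · exact count_up_of_notMem (by intro j; simp [e]) n
  · exact count_up_of_notMem (by intro j; simp [e]; omega) n
  · exact count_up_of_notMem (by intro j; simp [e]; omega) n
  · have h₁ : ∀ j, j ≠ i → Var.q i ∉ lst (ts (4 * j + 2) * qs j * ts (4 * j + 3) * rs j) := by
      intro j hj; simp [e, hj.symm]
    have h₂ : ∀ j, j ≠ i → Var.r i ∉ lst (ts (4 * j + 2) * qs j * ts (4 * j + 3) * rs j) := by
      intro j hj; simp [e, hj.symm]
    have h₃ : ∀ j, j ≠ i → Var.t (4 * i + 2) ∉
        lst (ts (4 * j + 2) * qs j * ts (4 * j + 3) * rs j) := by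
      intro j hj; simp [e]; omega
    have h₄ : ∀ j, j ≠ i → Var.t (4 * i + 3) ∉
        lst (ts (4 * j + 2) * qs j * ts (4 * j + 3) * rs j) := by
      intro j hj; simp [e]; omega
    rw [count_up h₁ hi hin, count_up h₂ hi hin, count_up h₃ hi hin, count_up h₄ hi hin,
      occ_up (ℓ := 4) (fun _ => rfl) h₁ hi hin (by simp [e]),
      occ_up (ℓ := 4) (fun _ => rfl) h₂ hi hin (by simp [e]),
      occ_up (ℓ := 4) (fun _ => rfl) h₃ hi hin (by simp [e]),
      occ_up (ℓ := 4) (fun _ => rfl) h₄ hi hin (by simp [e])]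
    simp [e]

theorem row3_U {n : ℕ} (hn : 1 < n) :
    ((lst (row3.U n)).count (.x 0) = 2 ∧ (lst (row3.U n)).count (.y 0) = 2 ∧
      (lst (row3.U n)).count (.x 1) = 0 ∧ (lst (row3.U n)).count (.y 1) = 0) ∧
    (occ (lst (row3.U n)) (.x 0) 0 = 4 * n ∧ occ (lst (row3.U n)) (.x 0) 1 = 6 * n + 1 ∧
      occ (lst (row3.U n)) (.y 0) 0 = 6 * n + 2 ∧ occ (lst (row3.U n)) (.y 0) 1 = 8 * n + 3) ∧
    ∀ i, 1 ≤ i → i ≤ n →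
      ((lst (row3.U n)).count (.z i) = 2 ∧ (lst (row3.U n)).count (.t (4 * i)) = 1 ∧
        occ (lst (row3.U n)) (.z i) 0 = 4 * (i - 1) ∧
        occ (lst (row3.U n)) (.t (4 * i)) 0 = 4 * (i - 1) + 1 ∧
        occ (lst (row3.U n)) (.z i) 1 = 4 * n + 1 + 2 * (i - 1)) ∧
      ((lst (row3.U n)).count (.p i) = 2 ∧ (lst (row3.U n)).count (.t (4 * i + 1)) = 1 ∧
        occ (lst (row3.U n)) (.p i) 0 = 4 * (i - 1) + 2 ∧
        occ (lst (row3.U n)) (.t (4 * i + 1)) 0 = 4 * (i - 1) + 3 ∧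
        occ (lst (row3.U n)) (.p i) 1 = 6 * n + 3 + 2 * (i - 1)) ∧
      ((lst (row3.U n)).count (.q i) = 2 ∧ (lst (row3.U n)).count (.t (4 * i + 2)) = 1 ∧
        occ (lst (row3.U n)) (.q i) 0 = 4 * n + 2 + 2 * (i - 1) ∧
        occ (lst (row3.U n)) (.t (4 * i + 2)) 0 = 8 * n + 4 + 4 * (i - 1) ∧
        occ (lst (row3.U n)) (.q i) 1 = 8 * n + 5 + 4 * (i - 1)) ∧
      ((lst (row3.U n)).count (.r i) = 2 ∧ (lst (row3.U n)).count (.t (4 * i + 3)) = 1 ∧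
        occ (lst (row3.U n)) (.r i) 0 = 6 * n + 4 + 2 * (i - 1) ∧
        occ (lst (row3.U n)) (.t (4 * i + 3)) 0 = 8 * n + 6 + 4 * (i - 1) ∧
        occ (lst (row3.U n)) (.r i) 1 = 8 * n + 7 + 4 * (i - 1)) := by
  obtain ⟨a₁, a₂, a₃⟩ := ZPt_facts n
  obtain ⟨d₁, d₃⟩ := tQR_facts n
  obtain ⟨b₁, b₂, b₃⟩ := up_pair (n := n) (f := fun i => zs i * qs i) (g := Var.z) (h := Var.q)
    (fun _ _ h => by simpa using h) (fun _ _ h => by simpa using h) (by simp) (fun j => rfl)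
  obtain ⟨c₁, c₂, c₃⟩ := up_pair (n := n) (f := fun i => ps i * rs i) (g := Var.p) (h := Var.r)
    (fun _ _ h => by simpa using h) (fun _ _ h => by simpa using h) (by simp) (fun j => rfl)
  have hn1 : 1 ≤ n := hn.le
  simp only [row3, lst_mul, lst_x, lst_y]
  refine ⟨⟨?_, ?_, ?_, ?_⟩, ⟨?_, ?_, ?_, ?_⟩, fun i hi hin => ?_⟩
  · simp [a₁, b₁, c₁, d₁]
  · simp [a₁, b₁, c₁, d₁]
  · simp [a₁, b₁, c₁, d₁]
  · simp [a₁, b₁, c₁, d₁]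
  · simp [occ_append, a₁, b₁, c₁, d₁, a₂ hn1]
  · simp [occ_append, a₁, b₁, c₁, d₁, a₂ hn1, b₂ hn1]; omega
  · simp [occ_append, a₁, b₁, c₁, d₁, a₂ hn1, b₂ hn1]; omega
  · simp [occ_append, a₁, b₁, c₁, d₁, a₂ hn1, b₂ hn1, c₂ hn1]; omega
  · obtain ⟨⟨z₁, p₁, s₁, s₂⟩, z₂, t₂, p₂, t₃⟩ := a₃ i hi hin
    obtain ⟨⟨q₁, r₁, s₃, s₄⟩, s₅, q₂, s₆, r₂⟩ := d₃ i hi hin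
    obtain ⟨⟨z₃, q₃⟩, z₄, q₄⟩ := b₃ i hi hin
    obtain ⟨⟨p₃, r₃⟩, p₄, r₄⟩ := c₃ i hi hin
    refine ⟨⟨?_, ?_, ?_, ?_, ?_⟩, ⟨?_, ?_, ?_, ?_, ?_⟩, ⟨?_, ?_, ?_, ?_, ?_⟩, ⟨?_, ?_, ?_, ?_, ?_⟩⟩
    · simp [a₁, b₁, c₁, d₁, z₁, z₃]
    · simp [a₁, b₁, c₁, d₁, s₁]
    · simp [occ_append, z₁, z₂]
    · simp [occ_append, s₁, t₂]
    · simp [occ_append, a₁, b₁, c₁, d₁, z₁, z₃, z₄, a₂ hn1]; omega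
    · simp [a₁, b₁, c₁, d₁, p₁, p₃]
    · simp [a₁, b₁, c₁, d₁, s₂]
    · simp [occ_append, p₁, p₂]
    · simp [occ_append, s₂, t₃]
    · simp [occ_append, a₁, b₁, c₁, d₁, p₁, p₃, p₄, a₂ hn1, b₂ hn1]; omega
    · simp [a₁, b₁, c₁, d₁, q₁, q₃]
    · simp [a₁, b₁, c₁, d₁, s₃]
    · simp [occ_append, a₁, b₁, c₁, d₁, q₁, q₂, q₃, q₄, a₂ hn1]; omega
    · simp [occ_append, a₁, b₁, c₁, d₁, s₃, s₅, a₂ hn1, b₂ hn1, c₂ hn1]; omega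
    · simp [occ_append, a₁, b₁, c₁, d₁, q₁, q₂, q₃, q₄, a₂ hn1, b₂ hn1, c₂ hn1]; omega
    · simp [a₁, b₁, c₁, d₁, r₁, r₃]
    · simp [a₁, b₁, c₁, d₁, s₄]
    · simp [occ_append, a₁, b₁, c₁, d₁, r₁, r₂, r₃, r₄, a₂ hn1, b₂ hn1]; omega
    · simp [occ_append, a₁, b₁, c₁, d₁, s₄, s₆, a₂ hn1, b₂ hn1, c₂ hn1]; omega
    · simp [occ_append, a₁, b₁, c₁, d₁, r₁, r₂, r₃, r₄, a₂ hn1, b₂ hn1, c₂ hn1]; omega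

theorem row3_V (n : ℕ) :
    occ (lst (row3.V n)) (.y 0) 0 < occ (lst (row3.V n)) (.x 0) 1 := by
  obtain ⟨a₁, a₂, a₃⟩ := ZPt_facts n
  obtain ⟨b₁, b₂, b₃⟩ := up_pair (n := n) (f := fun i => zs i * qs i) (g := Var.z) (h := Var.q)
    (fun _ _ h => by simpa using h) (fun _ _ h => by simpa using h) (by simp) (fun j => rfl)
  simp only [row3, lst_mul, lst_x, lst_y]
  simp [occ_append, a₁, b₁]

/-- Once each of `a` and `b` has a linear letter between its two occurrences, `asabrb` is an
isoterm. Using the identity in both directions gives an equivalence, so that the failure of the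
inequality is transferred too. -/
theorem not_between_iff (hq : Iso S [Var.x 0, .t 1, .x 0, .y 0, .t 2, .y 0]) {u v : List Var}
    (hs : Sat S u v) {a s b r : Var} (h : [a, s, b, r].Nodup) (ha : Has u [a, s, a])
    (hb : Has u [b, r, b]) : Has v [a, s, a] ∧ Has v [b, r, b] ∧
      (occ u a 1 < occ u b 0 ↔ occ v a 1 < occ v b 0) := by
  have h' := h
  simp at h'
  obtain ⟨⟨h₁, h₂, h₃⟩, ⟨h₄, h₅⟩, h₆⟩ := h'
  have i_aba : ∀ a b : Var, a ≠ b → Iso S [a, b, a] := fun a b h =>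
    hq.of_subst (fun c => if c = a then [.x 0] else [.t 1]) [] [.y 0, .t 2, .y 0]
      (by simp) (by simp [h.symm]) (by simp [h.symm]) (by simp [h, h.symm])
  have i_asabrb : Iso S [a, s, a, b, r, b] :=
    hq.of_subst (fun d => if d = a then [.x 0] else if d = s then [.t 1] else
        if d = b then [.y 0] else [.t 2]) [] []
      (by simp) (by simp [h₁, h₂, h₃, h₄, h₅, h₆, Ne.symm h₁, Ne.symm h₂, Ne.symm h₃,
        Ne.symm h₄, Ne.symm h₅, Ne.symm h₆])
      (by simp [h₁, h₂, h₃, h₄, h₅, h₆, Ne.symm h₁, Ne.symm h₂, Ne.symm h₃,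
        Ne.symm h₄, Ne.symm h₅, Ne.symm h₆])
      (by simp [h₁, h₂, h₃, h₄, h₅, h₆, Ne.symm h₁, Ne.symm h₂, Ne.symm h₃,
        Ne.symm h₄, Ne.symm h₅, Ne.symm h₆])
  have ha' := (i_aba _ _ h₁).has hs ha
  have hb' := (i_aba _ _ h₆).has hs hb
  refine ⟨ha', hb', fun hlt => ?_, fun hlt => ?_⟩
  · rw [has_aba (by simpa using h₁)] at ha
    rw [has_aba (by simpa using h₆)] at hb
    have := (has_asabrb h).1 (i_asabrb.has hs ((has_asabrb h).2 (by omega)))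
    omega
  · rw [has_aba (by simpa using h₁)] at ha'
    rw [has_aba (by simpa using h₆)] at hb'
    have := (has_asabrb h).1 (i_asabrb.has hs.symm ((has_asabrb h).2 (by omega)))
    omega

/-- The occurrences of `x` and `y` have the same order with respect to the second occurrences of
`zᵢ` and `pᵢ` and the first occurrences of `qᵢ` and `rᵢ` as in the left-hand side of row 3. -/
structure Interlaced (n : ℕ) (w : List Var) : Prop where
  cx : w.count (.x 0) = 2
  cy : w.count (.y 0) = 2
  xy : occ w (.x 0) 1 < occ w (.y 0) 0
  zq : ∀ i, 1 ≤ i → i ≤ n → occ w (.x 0) 0 < occ w (.z i) 1 ∧ occ w (.q i) 0 < occ w (.x 0) 1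
  pr : ∀ i, 1 ≤ i → i ≤ n → occ w (.y 0) 0 < occ w (.p i) 1 ∧ occ w (.r i) 0 < occ w (.y 0) 1

/-- The letters `t` separate the two occurrences of every `z`, `p`, `q` and `r`, so
`not_between_iff` applies without marking. `z i` before `q i` is the positive case; `q i` before `z
(i + 1)` is the negative one. Together they keep the whole sequences `[ZQn]` and `[PRn]` in order.
-/
theorem row3_order (hq : Iso S [Var.x 0, .t 1, .x 0, .y 0, .t 2, .y 0]) {n : ℕ} (hn : 1 < n)
    {w : List Var} (hs : Sat S (lst (row3.U n)) w) :
    (∀ i, 1 ≤ i → i ≤ n → Has w [.z i, .t (4 * i), .z i] ∧ Has w [.p i, .t (4 * i + 1), .p i] ∧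
      Has w [.q i, .t (4 * i + 2), .q i] ∧ Has w [.r i, .t (4 * i + 3), .r i] ∧
      occ w (.z i) 1 < occ w (.q i) 0 ∧ occ w (.p i) 1 < occ w (.r i) 0) ∧
    ∀ i, 1 ≤ i → i + 1 ≤ n → occ w (.q i) 0 < occ w (.z (i + 1)) 1 ∧
      occ w (.r i) 0 < occ w (.p (i + 1)) 1 := by
  obtain ⟨-, -, hU⟩ := row3_U hn
  have hz : ∀ i, 1 ≤ i → i ≤ n → Has (lst (row3.U n)) [.z i, .t (4 * i), .z i] := fun i hi hin =>
    (has_aba (by simp)).2 (by have := (hU i hi hin).1; omega)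
  have hp : ∀ i, 1 ≤ i → i ≤ n → Has (lst (row3.U n)) [.p i, .t (4 * i + 1), .p i] :=
    fun i hi hin => (has_aba (by simp)).2 (by have := (hU i hi hin).2.1; omega)
  have hq' : ∀ i, 1 ≤ i → i ≤ n → Has (lst (row3.U n)) [.q i, .t (4 * i + 2), .q i] :=
    fun i hi hin => (has_aba (by simp)).2 (by have := (hU i hi hin).2.2.1; omega)
  have hr : ∀ i, 1 ≤ i → i ≤ n → Has (lst (row3.U n)) [.r i, .t (4 * i + 3), .r i] :=
    fun i hi hin => (has_aba (by simp)).2 (by have := (hU i hi hin).2.2.2; omega)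
  refine ⟨fun i hi hin => ?_, fun i hi hin => ?_⟩
  · obtain ⟨a₁, a₂, a₃⟩ := not_between_iff hq hs (by simp) (hz i hi hin) (hq' i hi hin)
    obtain ⟨b₁, b₂, b₃⟩ := not_between_iff hq hs (by simp) (hp i hi hin) (hr i hi hin)
    have := hU i hi hin
    exact ⟨a₁, b₁, a₂, b₂, a₃.1 (by omega), b₃.1 (by omega)⟩
  · have hi' : 1 ≤ i + 1 := by omega
    have hin' : i ≤ n := by omega
    obtain ⟨a₁, a₂, a₃⟩ := not_between_iff hq hs (by simp; omega) (hz (i + 1) hi' hin)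
      (hq' i hi hin')
    obtain ⟨b₁, b₂, b₃⟩ := not_between_iff hq hs (by simp; omega) (hp (i + 1) hi' hin)
      (hr i hi hin')
    have h₁ := hU i hi hin'
    have h₂ := hU (i + 1) hi' hin
    rw [has_aba (by simp)] at a₁ a₂ b₁ b₂
    have h₃ := occ_ne (w := w) (a := .z (i + 1)) (b := .q i) (i := 1) (j := 0) (by simp)
      (by omega) (by omega)
    have h₄ := occ_ne (w := w) (a := .p (i + 1)) (b := .r i) (i := 1) (j := 0) (by simp)
      (by omega) (by omega)
    have h₅ : ¬ occ w (.z (i + 1)) 1 < occ w (.q i) 0 := by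
      rw [← a₃]; omega
    have h₆ : ¬ occ w (.p (i + 1)) 1 < occ w (.r i) 0 := by
      rw [← b₃]; omega
    omega

/-- Only `x` and `y` lack a separating letter. The invariant `Interlaced` keeps `[ZQn]` between the
two `x` and `[PRn]` between the two `y`; marking one second `z` by `x 1` and one second `p` by `y 1`
supplies the separators. `not_between_iff` then preserves the order of `x` and `y` as well as the
rest of the invariant. -/
theorem row3_nonFinitelyBased (hUV : ∀ n, 1 < n → Satisfies S (row3.U n) (row3.V n))
    (hW : ∀ w ∈ row3.W, IsIsoterm S w) : NonFinitelyBased S := by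
  have hq : Iso S [Var.x 0, .t 1, .x 0, .y 0, .t 2, .y 0] :=
    (hW (x * ts 1 * x * y * ts 2 * y) (by simp [row3])).iso
  have i_a : Iso S [Var.x 0] :=
    hq.of_subst (fun c => [c]) [] [.t 1, .x 0, .y 0, .t 2, .y 0] (by simp) (by simp) (by simp)
      (by simp)
  have i_ab : ∀ a b : Var, a ≠ b → Iso S [a, b] := fun a b h =>
    hq.of_subst (fun c => if c = a then [.x 0] else [.y 0]) [.x 0, .t 1] [.t 2, .y 0]
      (by simp) (by simp [h.symm]) (by simp [h.symm]) (by simp [h, h.symm])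
  refine nonFinitelyBased_of_invariant Interlaced hUV ?_ ?_ ?_
  · intro n hn
    obtain ⟨h₁, h₂, h₃⟩ := row3_U hn
    refine ⟨h₁.1, h₁.2.1, by omega, fun i hi hin => ?_, fun i hi hin => ?_⟩
    · have := h₃ i hi hin
      omega
    · have := h₃ i hi hin
      omega
  · intro n hn h
    have h₁ := row3_V n
    have := h.xy
    omega
  · intro L hL
    refine ⟨L + 1, by omega, fun w w' hs hP hstep => ?_⟩
    obtain ⟨⟨-, -, hx1, hy1⟩, -, -⟩ := row3_U (n := L + 1) (by omega)
    have hxw := notMem_of_sat i_a hs hx1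
    have hyw := notMem_of_sat i_a hs hy1
    obtain ⟨ho, hoo⟩ := row3_order hq (by omega) hs
    obtain ⟨ho', -⟩ := row3_order hq (by omega) (hs.trans hstep.sat)
    have hz := fun i hi hin => (has_aba (by simp)).1 (ho i hi hin).1
    have hp := fun i hi hin => (has_aba (by simp)).1 (ho i hi hin).2.1
    have hq' := fun i hi hin => (has_aba (by simp)).1 (ho i hi hin).2.2.1
    have hr := fun i hi hin => (has_aba (by simp)).1 (ho i hi hin).2.2.2.1
    have hz' := fun i hi hin => (has_aba (by simp)).1 (ho' i hi hin).1
    have hp' := fun i hi hin => (has_aba (by simp)).1 (ho' i hi hin).2.1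
    have hzq := fun i hi hin => (ho i hi hin).2.2.2.2.1
    have hpr := fun i hi hin => (ho i hi hin).2.2.2.2.2
    obtain ⟨i, hi, hm⟩ := hstep.exists_mark i_a (fun i => occ w (.z (i + 1)) 1)
      (fun i hi => (hzq (i + 1) (by omega) (by omega)).trans
        (hoo (i + 1) (by omega) (by omega)).1)
      (occ_lt_length (by have := hz (L + 1) (by omega) (by omega); omega))
    have z₁ := hz (i + 1) (by omega) (by omega)
    have q₁ := hq' (i + 1) (by omega) (by omega)
    have zq₁ := hzq (i + 1) (by omega) (by omega)
    have zz₁ := (hoo (i + 1) (by omega) (by omega)).1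
    obtain ⟨k, hk, hxw', hst⟩ := hm (.z (i + 1)) (.q (i + 1)) (.x 1) 1 0 hxw (by simp) (by omega)
      (by omega) le_rfl (by omega) zz₁.le (by
        intro k' hk' j' hj' e
        by_contra hne
        obtain rfl : k' = 0 := by omega
        obtain rfl | rfl : j' = 0 ∨ j' = 1 := by omega
        · omega
        · omega)
    obtain ⟨m₁, m₂, m₃, m₄⟩ := mark_facts (w := w) (a := .z (i + 1)) (c := .x 1) (k := 1) hxw
      (by simp) (by omega)
    obtain ⟨m₁', m₂', m₃', m₄'⟩ := mark_facts (w := w') (a := .z (i + 1)) (c := .x 1) hxw'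
      (by simp) hk
    have m₄0 := m₄ 0
    have m₄0' := m₄' 0
    simp only [zero_lt_one, if_true] at m₄0
    have hyw₁ : Var.y 1 ∉ mark w (.z (i + 1)) 1 (.x 1) := not_mem_mark hyw (by simp)
    have z₁' := hz' (i + 1) (by omega) (by omega)
    -- The mark follows the surviving `z (i + 1)`, so in `w'` too it replaces the second occurrence.
    have hk1 : k = 1 := by
      by_contra hk1
      obtain rfl : k = 0 := by omega
      have := (has_ab (by simp)).1 ((i_ab (.z (i + 1)) (.x 1) (by simp)).has hst.sat
        ((has_ab (by simp)).2 (by omega)))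
      simp at m₄0'
      omega
    subst hk1
    have e : ∀ d, d ≠ Var.z (i + 1) → d ≠ .x 1 → ∀ j,
        (mark w (.z (i + 1)) 1 (.x 1)).count d = w.count d ∧
        (mark w' (.z (i + 1)) 1 (.x 1)).count d = w'.count d ∧
        occ (mark w (.z (i + 1)) 1 (.x 1)) d j = occ w d j ∧
        occ (mark w' (.z (i + 1)) 1 (.x 1)) d j = occ w' d j := fun d h₁ h₂ j =>
      ⟨count_mark_of_ne h₁ h₂, count_mark_of_ne h₁ h₂, occ_mark_of_ne h₁ h₂ _,
        occ_mark_of_ne h₁ h₂ _⟩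
    set w₁ := mark w (.z (i + 1)) 1 (.x 1) with hw₁
    set w₁' := mark w' (.z (i + 1)) 1 (.x 1) with hw₁'
    clear_value w₁ w₁'
    have ep : ∀ l j, w₁.count (.p l) = w.count (.p l) ∧ w₁'.count (.p l) = w'.count (.p l) ∧
        occ w₁ (.p l) j = occ w (.p l) j ∧ occ w₁' (.p l) j = occ w' (.p l) j :=
      fun l j => e (.p l) (by simp) (by simp) j
    obtain ⟨i', hi', hm'⟩ := hst.exists_mark i_a (fun i => occ w₁ (.p (i + 1)) 1)
      (fun i hi => by
        have := hpr (i + 1) (by omega) (by omega)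
        have := (hoo (i + 1) (by omega) (by omega)).2
        have := ep (i + 1) 1
        have := ep (i + 1 + 1) 1
        show occ w₁ (.p (i + 1)) 1 < occ w₁ (.p (i + 1 + 1)) 1
        omega)
      (occ_lt_length (by
        have := hp (L + 1) (by omega) (by omega)
        have := ep (L + 1) 0
        omega))
    have p₁ := hp (i' + 1) (by omega) (by omega)
    have p₁' := hp' (i' + 1) (by omega) (by omega)
    have r₁ := hr (i' + 1) (by omega) (by omega)
    have pr₁ := hpr (i' + 1) (by omega) (by omega)
    have pp₁ := (hoo (i' + 1) (by omega) (by omega)).2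
    have e₁ := ep (i' + 1) 0
    have e₂ := ep (i' + 1) 1
    have e₃ := ep (i' + 1 + 1) 1
    have e₄ := e (.r (i' + 1)) (by simp) (by simp) 0
    have e₅ := e (.r (i' + 1)) (by simp) (by simp) 1
    obtain ⟨k', hk', hyw₁', hst'⟩ := hm' (.p (i' + 1)) (.r (i' + 1)) (.y 1) 1 0 hyw₁ (by simp)
      (by omega) (by omega) le_rfl (by omega)
      (by show occ w₁ (.r (i' + 1)) 0 ≤ occ w₁ (.p (i' + 1 + 1)) 1; omega) (by
        intro k' hk' j' hj' e
        by_contra hne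
        obtain rfl : k' = 0 := by omega
        obtain rfl | rfl : j' = 0 ∨ j' = 1 := by omega
        · omega
        · omega)
    obtain ⟨n₁, n₂, n₃, n₄⟩ := mark_facts (w := w₁) (a := .p (i' + 1)) (c := .y 1) (k := 1) hyw₁
      (by simp) (by omega)
    obtain ⟨n₁', n₂', n₃', n₄'⟩ := mark_facts (w := w₁') (a := .p (i' + 1)) (c := .y 1) hyw₁'
      (by simp) hk'
    have n₄0 := n₄ 0
    have n₄0' := n₄' 0
    simp only [zero_lt_one, if_true] at n₄0
    have hk1 : k' = 1 := by
      by_contra hk1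
      obtain rfl : k' = 0 := by omega
      have := (has_ab (by simp)).1 ((i_ab (.p (i' + 1)) (.y 1) (by simp)).has hst'.sat
        ((has_ab (by simp)).2 (by omega)))
      simp at n₄0'
      omega
    subst hk1
    have e' : ∀ d, d ≠ Var.p (i' + 1) → d ≠ .y 1 → ∀ j,
        (mark w₁ (.p (i' + 1)) 1 (.y 1)).count d = w₁.count d ∧
        (mark w₁' (.p (i' + 1)) 1 (.y 1)).count d = w₁'.count d ∧
        occ (mark w₁ (.p (i' + 1)) 1 (.y 1)) d j = occ w₁ d j ∧
        occ (mark w₁' (.p (i' + 1)) 1 (.y 1)) d j = occ w₁' d j := fun d h₁ h₂ j =>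
      ⟨count_mark_of_ne h₁ h₂, count_mark_of_ne h₁ h₂, occ_mark_of_ne h₁ h₂ _,
        occ_mark_of_ne h₁ h₂ _⟩
    have hs₂ := hst'.sat
    set w₂ := mark w₁ (.p (i' + 1)) 1 (.y 1) with hw₂
    set w₂' := mark w₁' (.p (i' + 1)) 1 (.y 1) with hw₂'
    clear_value w₂ w₂'
    have E : ∀ d, d ≠ Var.z (i + 1) → d ≠ .x 1 → d ≠ Var.p (i' + 1) → d ≠ .y 1 →
        (w₂.count d = w.count d ∧ w₂'.count d = w'.count d) ∧
        (occ w₂ d 0 = occ w d 0 ∧ occ w₂ d 1 = occ w d 1) ∧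
        occ w₂' d 0 = occ w' d 0 ∧ occ w₂' d 1 = occ w' d 1 := fun d h₁ h₂ h₃ h₄ => by
      have a₁ := e d h₁ h₂ 0
      have a₂ := e d h₁ h₂ 1
      have a₃ := e' d h₃ h₄ 0
      have a₄ := e' d h₃ h₄ 1
      omega
    obtain ⟨cx, cy, hxy, hxz, hyp⟩ := hP
    have Ex := E (.x 0) (by simp) (by simp) (by simp) (by simp)
    have Ey := E (.y 0) (by simp) (by simp) (by simp) (by simp)
    have et := e' (.x 1) (by simp) (by simp) 0
    have xz₁ := hxz (i + 1) (by omega) (by omega)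
    have yp₁ := hyp (i' + 1) (by omega) (by omega)
    have hx : Has w₂ [.x 0, .x 1, .x 0] := (has_aba (by simp)).2 (by omega)
    have hy : Has w₂ [.y 0, .y 1, .y 0] := (has_aba (by simp)).2 (by omega)
    obtain ⟨hx', hy', hxy'⟩ := not_between_iff hq hs₂ (by simp) hx hy
    have hx'' := (has_aba (by simp)).1 hx'
    have hy'' := (has_aba (by simp)).1 hy'
    have hxy'' := hxy'.1 (by omega)
    refine ⟨by omega, by omega, by omega, fun l hl hln => ⟨?_, ?_⟩, fun l hl hln => ⟨?_, ?_⟩⟩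
    -- The second `z (i + 1)` has itself become the separator `x 1`, so its place is read off
    -- `hx''`. For other `l` the claim is the negation of `z l` ending before `x` begins.
    · by_cases hli : l = i + 1
      · subst hli
        omega
      · have El := E (.z l) (by simp; omega) (by simp) (by simp) (by simp)
        have Et := E (.t (4 * l)) (by simp) (by simp) (by simp) (by simp)
        have hl₁ := hz l hl hln
        have hl₂ := hxz l hl hln
        obtain ⟨a₁, -, a₃⟩ := not_between_iff hq hs₂ (b := .x 0) (r := .x 1) (by simp)
          (show Has w₂ [.z l, .t (4 * l), .z l] from (has_aba (by simp)).2 (by omega)) hx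
        have a₁' := (has_aba (by simp)).1 a₁
        have hne := occ_ne (w := w₂') (a := .x 0) (b := .z l) (i := 0) (j := 1) (by simp)
          (by omega) (by omega)
        omega
    · have El := E (.q l) (by simp) (by simp) (by simp) (by simp)
      have Et := E (.t (4 * l + 2)) (by simp) (by simp) (by simp) (by simp)
      have hl₁ := hq' l hl hln
      have hl₂ := hxz l hl hln
      obtain ⟨-, a₁, a₃⟩ := not_between_iff hq hs₂ (a := .x 0) (s := .x 1) (by simp) hx
        (show Has w₂ [.q l, .t (4 * l + 2), .q l] from (has_aba (by simp)).2 (by omega))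
      have a₁' := (has_aba (by simp)).1 a₁
      have hne := occ_ne (w := w₂') (a := .x 0) (b := .q l) (i := 1) (j := 0) (by simp)
        (by omega) (by omega)
      omega
    · by_cases hli : l = i' + 1
      · subst hli
        omega
      · have El := E (.p l) (by simp) (by simp) (by simp; omega) (by simp)
        have Et := E (.t (4 * l + 1)) (by simp) (by simp) (by simp) (by simp)
        have hl₁ := hp l hl hln
        have hl₂ := hyp l hl hln
        obtain ⟨a₁, -, a₃⟩ := not_between_iff hq hs₂ (b := .y 0) (r := .y 1) (by simp)
          (show Has w₂ [.p l, .t (4 * l + 1), .p l] from (has_aba (by simp)).2 (by omega)) hy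
        have a₁' := (has_aba (by simp)).1 a₁
        have hne := occ_ne (w := w₂') (a := .y 0) (b := .p l) (i := 0) (j := 1) (by simp)
          (by omega) (by omega)
        omega
    · have El := E (.r l) (by simp) (by simp) (by simp) (by simp)
      have Et := E (.t (4 * l + 3)) (by simp) (by simp) (by simp) (by simp)
      have hl₁ := hr l hl hln
      have hl₂ := hyp l hl hln
      obtain ⟨-, a₁, a₃⟩ := not_between_iff hq hs₂ (a := .y 0) (s := .y 1) (by simp) hy
        (show Has w₂ [.r l, .t (4 * l + 3), .r l] from (has_aba (by simp)).2 (by omega))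
      have a₁' := (has_aba (by simp)).1 a₁
      have hne := occ_ne (w := w₂') (a := .y 0) (b := .r l) (i := 1) (j := 0) (by simp)
        (by omega) (by omega)
      omega

end Row3

/-! ### Patterns that contain powers of a letter -/

section Replicate

variable {α : Type*} [DecidableEq α] {w : List α} {a b c r : α}

theorem occ_replicate {n k : ℕ} (h : k < n) : occ (List.replicate n a) a k = k := by
  induction n generalizing k with
  | zero => omega
  | succ n ih =>
    cases k with
    | zero => simp [List.replicate_succ]
    | succ k => rw [List.replicate_succ, occ_cons_self_succ, ih (by omega)]

theorem inc_replicate : ∀ (k : ℕ) (s : List α), s.count a + k + 1 ≤ w.count a →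
    Inc w s (List.replicate (k + 1) a)
  | 0, _, _ => trivial
  | k + 1, s, h => by
    refine ⟨occ_lt_occ (by simp) (by omega), ?_⟩
    exact inc_replicate k (a :: s) (by simp; omega)

/-- Inside a run of equal letters the order is automatic; only the passage from its last letter to
`b` imposes a condition. The exponent `k + 1` makes the run nonempty. -/
theorem inc_replicate_append : ∀ (k : ℕ) (s p : List α), s.count a + k + 1 ≤ w.count a →
    (Inc w s (List.replicate (k + 1) a ++ b :: p) ↔
      occ w a (s.count a + k) < occ w b ((List.replicate (k + 1) a ++ s).count b) ∧
        Inc w (List.replicate (k + 1) a ++ s) (b :: p))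
  | 0, _, _, _ => by simp [Inc]
  | k + 1, s, p, h => by
    have ih := inc_replicate_append k (a :: s) p (by simp; omega)
    have e : List.replicate (k + 1) a ++ a :: s = List.replicate (k + 2) a ++ s := by
      rw [List.replicate_succ' (n := k + 1)]; simp
    rw [e] at ih
    rw [List.count_cons_self] at ih
    have h' : Inc w s (List.replicate (k + 2) a ++ b :: p) ↔
        occ w a (s.count a) < occ w a ((a :: s).count a) ∧
          Inc w (a :: s) (List.replicate (k + 1) a ++ b :: p) := Iff.rfl
    rw [h', ih, List.count_cons_self, show s.count a + 1 + k = s.count a + (k + 1) by omega]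
    have := occ_lt_occ (w := w) (a := a) (i := s.count a) (j := s.count a + 1) (by omega)
      (by omega)
    tauto

theorem has_split {j k : ℕ} (hca : c ≠ a) :
    Has w (List.replicate (j + 1) a ++ c :: List.replicate (k + 1) a) ↔
      (w.count a = j + k + 2 ∧ w.count c = 1) ∧ occ w a j < occ w c 0 ∧
        occ w c 0 < occ w a (j + 1) := by
  have key : w.count a = j + k + 2 →
      (Inc w [] (List.replicate (j + 1) a ++ c :: List.replicate (k + 1) a) ↔
      occ w a j < occ w c 0 ∧ occ w c 0 < occ w a (j + 1)) := by
    intro h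
    rw [inc_replicate_append j [] _ (by simp; omega)]
    have h₁ : Inc w (c :: (List.replicate (j + 1) a ++ [])) (List.replicate (k + 1) a) :=
      inc_replicate k _ (by simp [hca]; omega)
    rw [List.replicate_succ (n := k)] at h₁ ⊢
    simp only [Inc, h₁, and_true]
    simp [List.count_replicate, hca, Ne.symm hca]
  rw [has_iff]
  have hc : (∀ d ∈ List.replicate (j + 1) a ++ c :: List.replicate (k + 1) a, w.count d =
      (List.replicate (j + 1) a ++ c :: List.replicate (k + 1) a).count d) ↔
      (w.count a = j + k + 2 ∧ w.count c = 1) := by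
    constructor
    · intro h
      have h₁ := h a (by simp)
      have h₂ := h c (by simp)
      simp [List.count_replicate, hca, Ne.symm hca] at h₁ h₂
      omega
    · rintro ⟨h₁, h₂⟩ d hd
      simp only [List.mem_append, List.mem_replicate, List.mem_cons] at hd
      obtain rfl | rfl : d = a ∨ d = c := by tauto
      · simp [List.count_replicate, hca, Ne.symm hca]; omega
      · simp [List.count_replicate, hca, Ne.symm hca]; omega
  rw [hc]
  constructor
  · rintro ⟨h₁, h₂⟩
    exact ⟨h₁, (key h₁.1).1 h₂⟩
  · rintro ⟨h₁, h₂⟩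
    exact ⟨h₁, (key h₁.1).2 h₂⟩

theorem has_aba_split {j k : ℕ} (h : [a, b, c, r].Nodup) :
    Has w (b :: r :: b :: (List.replicate (j + 1) a ++ c :: List.replicate (k + 1) a)) ↔
      (w.count a = j + k + 2 ∧ w.count c = 1 ∧ w.count b = 2 ∧ w.count r = 1) ∧
        (occ w b 0 < occ w r 0 ∧ occ w r 0 < occ w b 1 ∧ occ w b 1 < occ w a 0) ∧
        occ w a j < occ w c 0 ∧ occ w c 0 < occ w a (j + 1) := by
  simp only [List.nodup_cons, List.mem_cons, List.not_mem_nil, or_false, not_or,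
    not_false_eq_true, List.nodup_nil, and_true] at h
  obtain ⟨⟨hab, hac, har⟩, ⟨hbc, hbr⟩, hcr⟩ := h
  have key : w.count a = j + k + 2 →
      (Inc w [] (b :: r :: b :: (List.replicate (j + 1) a ++ c :: List.replicate (k + 1) a)) ↔
      (occ w b 0 < occ w r 0 ∧ occ w r 0 < occ w b 1 ∧ occ w b 1 < occ w a 0) ∧
        occ w a j < occ w c 0 ∧ occ w c 0 < occ w a (j + 1)) := by
    intro h
    have h₀ := inc_replicate_append (w := w) (a := a) (b := c) j [b, r, b]
      (List.replicate (k + 1) a) (by simp [hab, har, Ne.symm hab, Ne.symm har]; omega)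
    have h₁ : Inc w (c :: (List.replicate (j + 1) a ++ [b, r, b])) (List.replicate (k + 1) a) :=
      inc_replicate k _ (by simp [hab, har, hac, Ne.symm hab, Ne.symm har, Ne.symm hac]; omega)
    rw [List.replicate_succ (n := k)] at h₀ h₁ ⊢
    rw [List.replicate_succ (n := j)] at h₀ h₁ ⊢
    simp only [Inc, List.cons_append, h₁, and_true] at h₀ ⊢
    rw [h₀]
    simp [List.count_replicate, List.count_cons, hab, hac, har, hbc, hbr, hcr, Ne.symm hab,
      Ne.symm hac, Ne.symm har, Ne.symm hbc, Ne.symm hbr, Ne.symm hcr]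
    tauto
  rw [has_iff]
  have hc : (∀ d ∈ b :: r :: b :: (List.replicate (j + 1) a ++ c :: List.replicate (k + 1) a),
      w.count d = (b :: r :: b :: (List.replicate (j + 1) a ++
        c :: List.replicate (k + 1) a)).count d) ↔
      (w.count a = j + k + 2 ∧ w.count c = 1 ∧ w.count b = 2 ∧ w.count r = 1) := by
    constructor
    · intro h
      have h₁ := h a (by simp)
      have h₂ := h c (by simp)
      have h₃ := h b (by simp)
      have h₄ := h r (by simp)
      simp [List.count_replicate, List.count_cons, hab, hac, har, hbc, hbr, hcr, Ne.symm hab,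
        Ne.symm hac, Ne.symm har, Ne.symm hbc, Ne.symm hbr, Ne.symm hcr] at h₁ h₂ h₃ h₄
      omega
    · rintro ⟨h₁, h₂, h₃, h₄⟩ d hd
      simp only [List.mem_append, List.mem_replicate, List.mem_cons] at hd
      obtain rfl | rfl | rfl | rfl : d = a ∨ d = c ∨ d = b ∨ d = r := by tauto
      all_goals
        simp [List.count_replicate, List.count_cons, hab, hac, har, hbc, hbr, hcr, Ne.symm hab,
          Ne.symm hac, Ne.symm har, Ne.symm hbc, Ne.symm hbr, Ne.symm hcr]
        omega
  rw [hc]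
  constructor
  · rintro ⟨h₁, h₂⟩
    exact ⟨h₁, (key h₁.1).1 h₂⟩
  · rintro ⟨h₁, h₂⟩
    exact ⟨h₁, (key h₁.1).2 h₂⟩

theorem has_split_aba {j k : ℕ} (h : [a, b, c, r].Nodup) :
    Has w (List.replicate (j + 1) a ++ c :: (List.replicate (k + 1) a ++ [b, r, b])) ↔
      (w.count a = j + k + 2 ∧ w.count c = 1 ∧ w.count b = 2 ∧ w.count r = 1) ∧
        (occ w a j < occ w c 0 ∧ occ w c 0 < occ w a (j + 1)) ∧
        occ w a (j + 1 + k) < occ w b 0 ∧ occ w b 0 < occ w r 0 ∧ occ w r 0 < occ w b 1 := by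
  simp only [List.nodup_cons, List.mem_cons, List.not_mem_nil, or_false, not_or,
    not_false_eq_true, List.nodup_nil, and_true] at h
  obtain ⟨⟨hab, hac, har⟩, ⟨hbc, hbr⟩, hcr⟩ := h
  have key : w.count a = j + k + 2 →
      (Inc w [] (List.replicate (j + 1) a ++ c :: (List.replicate (k + 1) a ++ [b, r, b])) ↔
      (occ w a j < occ w c 0 ∧ occ w c 0 < occ w a (j + 1)) ∧
        occ w a (j + 1 + k) < occ w b 0 ∧ occ w b 0 < occ w r 0 ∧ occ w r 0 < occ w b 1) := by
    intro h
    rw [inc_replicate_append j [] _ (by simp; omega)]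
    have h₀ := inc_replicate_append (w := w) (a := a) (b := b) k
      (c :: (List.replicate (j + 1) a ++ [])) [r, b]
      (by simp [hab, hac, har, Ne.symm hab, Ne.symm har, Ne.symm hac]; omega)
    rw [List.replicate_succ (n := k)] at h₀ ⊢
    simp only [Inc, List.cons_append] at h₀ ⊢
    rw [h₀]
    simp [List.count_replicate, List.count_cons, hab, hac, har, hbc, hbr, hcr, Ne.symm hab,
      Ne.symm hac, Ne.symm har, Ne.symm hbc, Ne.symm hbr, Ne.symm hcr]
    tauto
  rw [has_iff]
  have hc : (∀ d ∈ List.replicate (j + 1) a ++ c :: (List.replicate (k + 1) a ++ [b, r, b]),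
      w.count d = (List.replicate (j + 1) a ++
        c :: (List.replicate (k + 1) a ++ [b, r, b])).count d) ↔
      (w.count a = j + k + 2 ∧ w.count c = 1 ∧ w.count b = 2 ∧ w.count r = 1) := by
    constructor
    · intro h
      have h₁ := h a (by simp)
      have h₂ := h c (by simp)
      have h₃ := h b (by simp)
      have h₄ := h r (by simp)
      simp [List.count_replicate, List.count_cons, hab, hac, har, hbc, hbr, hcr, Ne.symm hab,
        Ne.symm hac, Ne.symm har, Ne.symm hbc, Ne.symm hbr, Ne.symm hcr] at h₁ h₂ h₃ h₄
      omega
    · rintro ⟨h₁, h₂, h₃, h₄⟩ d hd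
      simp only [List.mem_append, List.mem_replicate, List.mem_cons, List.not_mem_nil] at hd
      obtain rfl | rfl | rfl | rfl : d = a ∨ d = c ∨ d = b ∨ d = r := by tauto
      all_goals
        simp [List.count_replicate, List.count_cons, hab, hac, har, hbc, hbr, hcr, Ne.symm hab,
          Ne.symm hac, Ne.symm har, Ne.symm hbc, Ne.symm hbr, Ne.symm hcr]
        omega
  rw [hc]
  constructor
  · rintro ⟨h₁, h₂⟩
    exact ⟨h₁, (key h₁.1).1 h₂⟩
  · rintro ⟨h₁, h₂⟩
    exact ⟨h₁, (key h₁.1).2 h₂⟩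

end Replicate

/-! ### Row 8: powers of `x` split by a linear letter -/

section Row8

variable {S : Type*} [Monoid S]

theorem lst_pow_of (a : Var) :
    ∀ n, lst (pow (FreeSemigroup.of a) (n + 1)) = List.replicate (n + 1) a
  | 0 => rfl
  | n + 1 => by
    have : pow (FreeSemigroup.of a) (n + 2) = pow (FreeSemigroup.of a) (n + 1) *
      FreeSemigroup.of a := rfl
    rw [this, lst_mul, lst_pow_of a n, lst_of, ← List.replicate_succ']

theorem lst_pow_x {n : ℕ} (hn : 0 < n) : lst (pow x n) = List.replicate n (.x 0) := by
  obtain ⟨n, rfl⟩ : ∃ m, n = m + 1 := ⟨n - 1, by omega⟩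
  exact lst_pow_of _ _

theorem Iso.of_map {α β : Type*} [DecidableEq α] {q : List β} (hq : Iso S q) {p : List α}
    (g : α → β) (l r : List β) (hp0 : p ≠ []) (e : q = l ++ p.map g ++ r)
    (h1 : ∀ a ∈ p, ∀ b ∈ p, g a = g b → a = b) : Iso S p :=
  hq.of_subst (fun a => [g a]) l r hp0 (by rw [e, List.map_eq_flatMap]) (by simp)
    (by simpa using h1)

theorem up_pp {n : ℕ} :
    (∀ a, (∀ j, a ≠ Var.p j) → (lst (up (fun i => ps i * ps i) n)).count a = 0) ∧
    (1 ≤ n → (lst (up (fun i => ps i * ps i) n)).length = 2 * n) ∧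
    ∀ i, 1 ≤ i → i ≤ n → (lst (up (fun i => ps i * ps i) n)).count (.p i) = 2 ∧
      occ (lst (up (fun i => ps i * ps i) n)) (.p i) 0 = 2 * (i - 1) ∧
      occ (lst (up (fun i => ps i * ps i) n)) (.p i) 1 = 2 * (i - 1) + 1 := by
  have e : ∀ j, lst (ps j * ps j) = [.p j, .p j] := fun j => rfl
  refine ⟨fun a h₁ => ?_, fun hn => ?_, fun i hi hin => ?_⟩
  · exact count_up_of_notMem (by intro j; simp [e, h₁]) n
  · obtain ⟨n, rfl⟩ : ∃ m, n = m + 1 := ⟨n - 1, by omega⟩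
    exact length_up (ℓ := 2) (fun _ => rfl) n
  · have hz : ∀ j, j ≠ i → Var.p i ∉ lst (ps j * ps j) := by
      intro j hj; simp [e, hj.symm]
    rw [count_up hz hi hin,
      occ_up (ℓ := 2) (fun _ => rfl) hz hi hin (by simp [e]),
      occ_up (ℓ := 2) (fun _ => rfl) hz hi hin (by simp [e])]
    simp [e]

theorem row8_U {m n : ℕ} (hm : 2 < m) (hn : 1 < n) :
    ((lst ((row8 m).U n)).count (.x 0) = m ∧ (lst ((row8 m).U n)).count (.y 0) = 2 ∧
      (lst ((row8 m).U n)).count (.z 0) = 2 ∧ (lst ((row8 m).U n)).count (.t 1) = 1 ∧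
      (lst ((row8 m).U n)).count (.t 2) = 1 ∧ (lst ((row8 m).U n)).count (.q 0) = 0) ∧
    (occ (lst ((row8 m).U n)) (.y 0) 0 = 0 ∧ occ (lst ((row8 m).U n)) (.t 1) 0 = 1 ∧
      occ (lst ((row8 m).U n)) (.x 0) 0 = 2 ∧ occ (lst ((row8 m).U n)) (.y 0) 1 = m + 1 ∧
      occ (lst ((row8 m).U n)) (.z 0) 0 = m + 2 + 2 * n ∧
      occ (lst ((row8 m).U n)) (.x 0) (m - 1) = m + 3 + 2 * n ∧
      occ (lst ((row8 m).U n)) (.t 2) 0 = m + 4 + 2 * n ∧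
      occ (lst ((row8 m).U n)) (.z 0) 1 = m + 5 + 2 * n) ∧
    ∀ i, 1 ≤ i → i ≤ n → (lst ((row8 m).U n)).count (.p i) = 2 ∧
      occ (lst ((row8 m).U n)) (.p i) 0 = m + 2 + 2 * (i - 1) ∧
      occ (lst ((row8 m).U n)) (.p i) 1 = m + 2 + 2 * (i - 1) + 1 := by
  obtain ⟨m, rfl⟩ : ∃ k, m = k + 3 := ⟨m - 3, by omega⟩
  obtain ⟨h₁, h₂, h₃⟩ := up_pp (n := n)
  have hl := h₂ (by omega)
  have hx := h₁ (.x 0) (by simp)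
  have hy := h₁ (.y 0) (by simp)
  have hz := h₁ (.z 0) (by simp)
  have ht₁ := h₁ (.t 1) (by simp)
  have ht₂ := h₁ (.t 2) (by simp)
  have hq := h₁ (.q 0) (by simp)
  simp only [row8, lst_mul, lst_x, lst_y, lst_z, lst_ts]
  rw [lst_pow_x (by omega), show m + 3 - 1 = m + 2 by omega]
  refine ⟨⟨?_, ?_, ?_, ?_, ?_, ?_⟩, ⟨?_, ?_, ?_, ?_, ?_, ?_, ?_, ?_⟩, fun i hi hin => ?_⟩
  · simp [hx, List.count_replicate]
  · simp [hy, List.count_replicate]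
  · simp [hz, List.count_replicate]
  · simp [ht₁, List.count_replicate]
  · simp [ht₂, List.count_replicate]
  · simp [hq, List.count_replicate]
  · simp
  · simp
  · simp [occ_append, occ_replicate, List.count_replicate]
  · simp [occ_append, List.count_replicate]
  · simp [occ_append, List.count_replicate, hz, hl]; omega
  · simp [occ_append, List.count_replicate, hx, hl]; omega
  · simp [occ_append, List.count_replicate, ht₂, hl]; omega
  · simp [occ_append, List.count_replicate, hz, hl]; omega
  · obtain ⟨e₁, e₂, e₃⟩ := h₃ i hi hin
    simp [occ_append, List.count_replicate, e₁, e₂, e₃]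
    omega

theorem row8_V {m n : ℕ} (hm : 2 < m) :
    occ (lst ((row8 m).V n)) (.x 0) (m - 1) < occ (lst ((row8 m).V n)) (.z 0) 0 := by
  have hz := (up_pp (n := n)).1 (.z 0) (by simp)
  simp only [row8, lst_mul, lst_x, lst_y, lst_z, lst_ts]
  rw [lst_pow_x (by omega)]
  have h₁ : 0 < m := by omega
  simp [occ_append, List.count_replicate, occ_replicate, hz, h₁]
  omega

/-- The invariant is that `x` occurs `m` times, first before the second `y` and last after the first
`z`; in `V n` no `x` follows the first `z`. Marking a letter of a square `p (i + 1)` puts a linear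
`q` between the second `y` and the first `z`, so `q` cuts the powers of `x` into two nonempty parts.
The lengths of these parts are not known, which is why `W` contains the words for all `d`. -/
theorem row8_nonFinitelyBased {m : ℕ} (hm : 2 < m)
    (hUV : ∀ n, 1 < n → Satisfies S ((row8 m).U n) ((row8 m).V n))
    (hW : ∀ w ∈ (row8 m).W, IsIsoterm S w) : NonFinitelyBased S := by
  have hq₀ : Iso S [Var.x 0, .x 0, .y 0, .y 0] := (hW (x * x * y * y) (by simp [row8])).iso
  have hqA : ∀ d, 0 < d → d < m → Iso S (.y 0 :: .t 1 :: .y 0 ::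
      (List.replicate d (.x 0) ++ Var.t 2 :: List.replicate (m - d) (.x 0))) := by
    intro d hd hdm
    have := (hW (y * ts 1 * y * pow x d * ts 2 * pow x (m - d))
      (Or.inr ⟨d, hd, hdm, Or.inl rfl⟩)).iso
    simp only [lst_mul, lst_y, lst_ts] at this
    rw [lst_pow_x hd, lst_pow_x (by omega)] at this
    simpa using this
  have hqB : ∀ d, 0 < d → d < m → Iso S (List.replicate (m - d) (.x 0) ++ .t 1 ::
      (List.replicate d (.x 0) ++ [Var.y 0, .t 2, .y 0])) := by
    intro d hd hdm
    have := (hW (pow x (m - d) * ts 1 * pow x d * y * ts 2 * y)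
      (Or.inr ⟨d, hd, hdm, Or.inr rfl⟩)).iso
    simp only [lst_mul, lst_y, lst_ts] at this
    rw [lst_pow_x hd, lst_pow_x (by omega)] at this
    simpa using this
  have i_a : Iso S [Var.x 0] :=
    hq₀.of_subst (fun c => [c]) [] [.x 0, .y 0, .y 0] (by simp) (by simp) (by simp) (by simp)
  have i_aabb : ∀ a b : Var, a ≠ b → Iso S [a, a, b, b] := fun a b h =>
    hq₀.of_subst (fun c => if c = a then [.x 0] else [.y 0]) [] []
      (by simp) (by simp [h.symm]) (by simp [h.symm]) (by simp [h, h.symm])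
  have i_aba : ∀ a b : Var, a ≠ b → Iso S [a, b, a] := fun a b h =>
    (hqA 1 (by omega) (by omega)).of_subst (fun c => if c = a then [.y 0] else [.t 1]) []
      (List.replicate 1 (.x 0) ++ Var.t 2 :: List.replicate (m - 1) (.x 0))
      (by simp) (by simp [h.symm]) (by simp [h.symm]) (by simp [h, h.symm])
  have i_A : ∀ j k, j + k + 2 = m → Iso S (.y 0 :: .t 1 :: .y 0 ::
      (List.replicate (j + 1) (.x 0) ++ Var.q 0 :: List.replicate (k + 1) (.x 0))) := by
    intro j k hjk
    refine (hqA (j + 1) (by omega) (by omega)).of_map (fun c => if c = .q 0 then .t 2 else c)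
      [] [] (by simp) ?_ ?_
    · rw [show m - (j + 1) = k + 1 by omega]
      simp
    · simp only [List.mem_append, List.mem_replicate, List.mem_cons]
      rintro a ha b hb
      obtain rfl | rfl | rfl | rfl : a = .y 0 ∨ a = .t 1 ∨ a = .x 0 ∨ a = .q 0 := by tauto
      all_goals
        obtain rfl | rfl | rfl | rfl : b = .y 0 ∨ b = .t 1 ∨ b = .x 0 ∨ b = .q 0 := by tauto
        all_goals simp
  have i_B : ∀ j k, j + k + 2 = m → Iso S (List.replicate (j + 1) (.x 0) ++ .q 0 ::
      (List.replicate (k + 1) (.x 0) ++ [Var.z 0, .t 2, .z 0])) := by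
    intro j k hjk
    refine (hqB (k + 1) (by omega) (by omega)).of_map
      (fun c => if c = .q 0 then .t 1 else if c = .z 0 then .y 0 else c)
      [] [] (by simp) ?_ ?_
    · rw [show m - (k + 1) = j + 1 by omega]
      simp
    · simp only [List.mem_append, List.mem_replicate, List.mem_cons, List.not_mem_nil]
      rintro a ha b hb
      obtain rfl | rfl | rfl | rfl : a = .z 0 ∨ a = .t 2 ∨ a = .x 0 ∨ a = .q 0 := by tauto
      all_goals
        obtain rfl | rfl | rfl | rfl : b = .z 0 ∨ b = .t 2 ∨ b = .x 0 ∨ b = .q 0 := by tauto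
        all_goals simp
  have i_split : ∀ j k, j + k + 2 = m →
      Iso S (List.replicate (j + 1) (.x 0) ++ Var.q 0 :: List.replicate (k + 1) (.x 0)) :=
    fun j k hjk => (i_A j k hjk).of_map (fun c => c) [.y 0, .t 1, .y 0] [] (by simp) (by simp)
      (by simp)
  have key : ∀ n, 1 < n → ∀ w, Sat S (lst ((row8 m).U n)) w → Var.q 0 ∉ w ∧
      Has w [.y 0, .t 1, .y 0] ∧ Has w [.z 0, .t 2, .z 0] ∧
      (∀ i, 1 ≤ i → i ≤ n → Has w [.y 0, .y 0, .p i, .p i] ∧ Has w [.p i, .p i, .z 0, .z 0]) ∧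
      ∀ i, 1 ≤ i → i + 1 ≤ n → Has w [.p i, .p i, .p (i + 1), .p (i + 1)] := by
    intro n hn w hs
    obtain ⟨h₁, h₂, h₃⟩ := row8_U hm hn
    refine ⟨notMem_of_sat i_a hs h₁.2.2.2.2.2, ?_, ?_, fun i hi hin => ⟨?_, ?_⟩,
      fun i hi hin => ?_⟩
    · exact (i_aba _ _ (by simp)).has hs ((has_aba (by simp)).2 (by omega))
    · exact (i_aba _ _ (by simp)).has hs ((has_aba (by simp)).2 (by omega))
    · have := h₃ i hi hin
      exact (i_aabb _ _ (by simp)).has hs ((has_aabb (by simp)).2 (by omega))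
    · have := h₃ i hi hin
      exact (i_aabb _ _ (by simp)).has hs ((has_aabb (by simp)).2 (by omega))
    · have := h₃ i hi (by omega)
      have := h₃ (i + 1) (by omega) hin
      exact (i_aabb _ _ (by simp)).has hs ((has_aabb (by simp)).2 (by omega))
  refine nonFinitelyBased_of_invariant (fun _ w => w.count (.x 0) = m ∧
    occ w (.x 0) 0 < occ w (.y 0) 1 ∧ occ w (.z 0) 0 < occ w (.x 0) (m - 1)) hUV ?_ ?_ ?_
  · intro n hn
    have := row8_U hm hn
    omega
  · intro n hn
    have := row8_V (n := n) hm
    omega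
  · intro L hL
    refine ⟨L + 1, by omega, fun w w' hs hP hstep => ?_⟩
    obtain ⟨hqw, hy, hz, hp, hpp⟩ := key _ (by omega) w hs
    obtain ⟨-, hy', hz', -, -⟩ := key _ (by omega) w' (hs.trans hstep.sat)
    rw [has_aba (by simp)] at hy hz hy' hz'
    have hyp := fun i hi hin => (has_aabb (by simp)).1 (hp i hi hin).1
    have hpz := fun i hi hin => (has_aabb (by simp)).1 (hp i hi hin).2
    have hpp₀ := fun i hi hin => (has_aabb (by simp)).1 (hpp i hi hin)
    obtain ⟨i, hi, hmk⟩ := hstep.exists_mark i_a (fun i => occ w (.p (i + 1)) 0)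
      (fun i hi => by
        have h₁ := hpp₀ (i + 1) (by omega) (by omega)
        omega)
      (occ_lt_length (by
        have := hyp (L + 1) (by omega) (by omega); omega))
    have h₁ := hyp (i + 1) (by omega) (by omega)
    have h₂ := hpz (i + 1) (by omega) (by omega)
    have h₃ := hpp₀ (i + 1) (by omega) (by omega)
    obtain ⟨k, hk, hqw', hst⟩ := hmk (.p (i + 1)) (.p (i + 1)) (.q 0) 0 1 hqw (by simp) (by omega)
      (by omega) le_rfl (by omega) (by omega) (by
        intro k' hk' j' hj' e
        by_contra hne
        obtain rfl : k' = 1 := by omega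
        obtain rfl | rfl : j' = 0 ∨ j' = 1 := by omega
        · omega
        · omega)
    obtain ⟨m₁, m₂, m₃, m₄⟩ := mark_facts (w := w) (a := .p (i + 1)) (c := .q 0) (k := 0) hqw
      (by simp) (by omega)
    have e : ∀ d, d ≠ Var.p (i + 1) → d ≠ .q 0 → ∀ j,
        (mark w (.p (i + 1)) 0 (.q 0)).count d = w.count d ∧
        (mark w' (.p (i + 1)) k (.q 0)).count d = w'.count d ∧
        occ (mark w (.p (i + 1)) 0 (.q 0)) d j = occ w d j ∧
        occ (mark w' (.p (i + 1)) k (.q 0)) d j = occ w' d j := fun d h₁ h₂ j =>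
      ⟨count_mark_of_ne h₁ h₂, count_mark_of_ne h₁ h₂, occ_mark_of_ne h₁ h₂ _,
        occ_mark_of_ne h₁ h₂ _⟩
    have hs₁ := hst.sat
    set w₁ := mark w (.p (i + 1)) 0 (.q 0) with hw₁
    set w₁' := mark w' (.p (i + 1)) k (.q 0) with hw₁'
    clear_value w₁ w₁'
    have ex := e (.x 0) (by simp) (by simp)
    have ey₀ := e (.y 0) (by simp) (by simp) 0
    have ey₁ := e (.y 0) (by simp) (by simp) 1
    have ez₀ := e (.z 0) (by simp) (by simp) 0
    have ez₁ := e (.z 0) (by simp) (by simp) 1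
    have et₁ := e (.t 1) (by simp) (by simp) 0
    have et₂ := e (.t 2) (by simp) (by simp) 0
    have ex₀ := ex 0
    have exm := ex (m - 1)
    obtain ⟨cx, hxy, hzx⟩ := hP
    -- The least index of an `x` behind `q` is not `0`, as the first `x` precedes the second `y`,
    -- and is at most `m - 1`, as the last `x` follows the first `z`.
    obtain ⟨j, hjm, hj₁, hj₂⟩ : ∃ j, j + 2 ≤ m ∧ occ w₁ (.x 0) j < occ w₁ (.q 0) 0 ∧
        occ w₁ (.q 0) 0 < occ w₁ (.x 0) (j + 1) := by
      have hex : ∃ j, occ w₁ (.q 0) 0 < occ w₁ (.x 0) j := ⟨m - 1, by omega⟩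
      have hspec := Nat.find_spec hex
      have hle : Nat.find hex ≤ m - 1 := Nat.find_min' hex (by omega)
      have hpos : Nat.find hex ≠ 0 := by
        intro h0
        rw [h0] at hspec
        omega
      obtain ⟨j, hj⟩ : ∃ j, Nat.find hex = j + 1 := ⟨Nat.find hex - 1, by omega⟩
      have hmin := Nat.find_min hex (m := j) (by omega)
      rw [hj] at hspec
      have := occ_ne (w := w₁) (a := .x 0) (b := .q 0) (i := j) (j := 0) (by simp)
        (by omega) (by omega)
      exact ⟨j, by omega, by omega, hspec⟩
    obtain ⟨k', rfl⟩ : ∃ k', m = j + k' + 2 := ⟨m - (j + 2), by omega⟩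
    have hsp := (has_split (by simp)).1 ((i_split j k' rfl).has hs₁
      ((has_split (by simp)).2 (by omega)))
    have hne₁ := occ_ne (w := w') (a := .x 0) (b := .y 0) (i := 0) (j := 1) (by simp)
      (by omega) (by omega)
    have hne₂ := occ_ne (w := w') (a := .x 0) (b := .z 0) (i := j + k' + 2 - 1) (j := 0) (by simp)
      (by omega) (by omega)
    rw [show j + k' + 2 - 1 = j + 1 + k' by omega] at *
    refine ⟨by omega, ?_, ?_⟩
    -- If the second `y` preceded all `x` in `w'`, then `yty` followed by the split power would be
    -- an isoterm pattern in the marked `w'`, hence in the marked `w`, against the invariant there.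
    -- The case of `z` is the mirror image.
    · by_contra hcon
      have := (has_aba_split (by simp)).1 ((i_A j k' rfl).has hs₁.symm
        ((has_aba_split (by simp)).2 (by omega)))
      omega
    · by_contra hcon
      have := (has_split_aba (by simp)).1 ((i_B j k' rfl).has hs₁.symm
        ((has_split_aba (by simp)).2 (by omega)))
      omega

end Row8

end NFB

theorem theorem4 (R : NFB.Row) (hR : R ∈ NFB.table) (S : Type*) [Monoid S]
    (hUV : ∀ n : ℕ, 1 < n → NFB.Satisfies S (R.U n) (R.V n))
    (hW : ∀ w ∈ R.W, NFB.IsIsoterm S w) :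
    NFB.NonFinitelyBased S := by
  rcases hR with hR | ⟨m, hm, rfl⟩
  · simp only [Set.mem_insert_iff, Set.mem_singleton_iff] at hR
    rcases hR with rfl | rfl | rfl | rfl | rfl | rfl | rfl
    · exact NFB.row1_nonFinitelyBased hUV hW
    · exact NFB.row2_nonFinitelyBased hUV hW
    · exact NFB.row3_nonFinitelyBased hUV hW
    · exact NFB.row4_nonFinitelyBased hUV hW
    · exact NFB.row5_nonFinitelyBased hUV hW
    · exact NFB.row6_nonFinitelyBased hUV hW
    · exact NFB.row7_nonFinitelyBased hUV hW
  · exact NFB.row8_nonFinitelyBased hm hUV hW
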